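/- **Setting.** A (closed, i.e. vacuum) $4$-colored graph $\mathcal G$ is a finite bipartite graph (white and black nodes, multiple lines allowed) whose lines carry colors in $\{1,2,3,4\}$, each node having exactly one line of each color. For a color $\ell$, the set $\mathcal B_\ell$ of bubbles of color $\ell$ is the set of connected components of the graph (with all nodes) formed by the lines of colors $\neq\ell$. For $b\in\mathcal B_\ell$, let $|F_b|$ and $|E_b|$ be its numbers of nodes and of lines, and $|V_b|$ the number of its bicolored cycles (connected components of the lines of $b$ of two given colors $\neq \ell$, for all three choices of these colors); these are the numbers of triangles, edges and vertices of the dual closed surface, and the genus $g_b$ is defined by $2-2g_b=|V_b|-|E_b|+|F_b|$. Let $N^s_\ell$ be the number of $b\in\mathcal B_\ell$ with $g_b\neq0$ (singular vertices of color $\ell$). For $\alpha>0$ let $K_\alpha(g)=\sum_{j\in\mathbb N/2}(2j+1)e^{-\alpha j(j+1)}\chi_j(g)$ be the heat kernel on $\mathrm{SU}(2)$, $\chi_j$ being the spin-$j$ character. Assign to each line of color $c$ three variables $G^c_i\in \mathrm{SU}(2)$, $i\neq c$. The regularized amplitude of the colored Boulatov model in vertex variables is the integral, with respect to the normalized Haar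 measures, over all these variables of the product of * a closure constraint for each line, according to its color: $\delta(G^1_2G^1_3G^1_4)$, $\delta(G^2_4G^2_3G^2_1)$, $\delta(G^3_4G^3_1G^3_2)$ or $\delta(G^4_1G^4_3G^4_2)$, and * for each node (white or black), with the variables of its four lines, the kernel $$\frac{K_\alpha(G^2_1G^3_1G^4_1)\,K_\alpha(G^4_2G^3_2G^1_2)\,K_\alpha(G^4_3G^1_3G^2_3)\,K_\alpha(G^1_4G^3_4G^2_4)}{K_\alpha(\mathbf 1)}.$$ Let $\mathcal A^\alpha_{\mathcal G}$ be this amplitude multiplied by one factor $K_\alpha(\mathbf 1)^{-1/2}$ per node (this is the rescaling $\lambda\to\lambda/\sqrt{K_\alpha(\mathbf 1)}$ of the coupling constant), and let the divergence degree be $$\gamma_{\mathcal G}=\inf\{\gamma\in\mathbb R:\ \lim_{\alpha\to0^+}K_\alpha(\mathbf 1)^{-\gamma}\mathcal A^\alpha_{\mathcal G}\text{ exists and is finite}\}\in[-\infty,+\infty].$$ **Chains of canonical bubbles.** For $g\in\mathbb N$ let $\mathcal C_g$ have white nodes $e,u_0,v_0,\dots,u_{g-1},v_{g-1}$ and black nodes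 $f,p_0,q_0,\dots,p_{g-1},q_{g-1}$, with the following lines (for $0\le k<g$, resp. $0\le k<g-1$ where the index $k+1$ occurs). Color $1$: $u_kq_k$, $v_kp_k$. Color $2$: $ef$, $u_kp_k$, $v_kq_k$. Color $3$: $v_kp_k$, $e\,q_0$, $u_kq_{k+1}$, $u_{g-1}f$. Color $4$: $u_kq_k$, $e\,p_0$, $v_kp_{k+1}$, $v_{g-1}f$. (For $g=0$: three lines $ef$, of colors $2,3,4$.) Only $e$ and $f$ have a free leg, of color $1$. For $n\ge1$ and $g_1,\dots,g_n\in\mathbb N$, the closed chain $\mathcal C_{g_1,\dots,g_n}$ is obtained from the disjoint union of $\mathcal C_{g_1},\dots,\mathcal C_{g_n}$ by joining, cyclically, the node $f$ of each one to the node $e$ of the next one by a line of color $1$. **Proposition.** (i) For every connected vacuum graph $\mathcal G$ and every color $\ell$, $$\gamma_{\mathcal G}\le 2-2\sum_{b\in\mathcal B_\ell}g_b ,\qquad\text{and hence}\qquad \gamma_{\mathcal G}\le 2\,(1-N^s_\ell).$$ (ii) The first bound is saturated: for all $n\ge1$ and $g_1,\dots,g_n\in\mathbb N$ the chain $\mathcal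 C_{g_1,\dots,g_n}$ is connected, has exactly $n$ bubbles of color $1$, of genera $g_1,\dots,g_n$, and $$\gamma_{\mathcal C_{g_1,\dots,g_n}}=2-2\sum_{i=1}^n g_i .$$ -/

import Mathlib

open MeasureTheory Filter Topology

noncomputable section

namespace Boulatov

/-! ### The group `SU(2)`, its normalized Haar measure and its heat kernel -/

/-- The compact group `SU(2)`. -/
abbrev SU2 : Type := Matrix.specialUnitaryGroup (Fin 2) ℂ

instance : MeasurableSpace SU2 := borel SU2

instance : BorelSpace SU2 := ⟨rfl⟩

instance : SecondCountableTopology SU2 :=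
  haveI : SecondCountableTopology (Matrix (Fin 2) (Fin 2) ℂ) :=
    inferInstanceAs (SecondCountableTopology (Fin 2 → Fin 2 → ℂ))
  inferInstanceAs (SecondCountableTopology
    ((Matrix.specialUnitaryGroup (Fin 2) ℂ : Set (Matrix (Fin 2) (Fin 2) ℂ))))

instance : IsTopologicalGroup SU2 where
  continuous_mul := by
    refine Continuous.subtype_mk ?_ _
    exact (continuous_subtype_val.comp continuous_fst).mul
      (continuous_subtype_val.comp continuous_snd)
  continuous_inv := by
    refine Continuous.subtype_mk ?_ _
    exact continuous_star.comp continuous_subtype_val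

instance : CompactSpace SU2 := by
  refine isCompact_iff_compactSpace.mp ?_
  have hK : IsCompact (Set.pi Set.univ fun _ : Fin 2 => Set.pi Set.univ fun _ : Fin 2 =>
      Metric.closedBall (0 : ℂ) 1) :=
    isCompact_univ_pi fun _ => isCompact_univ_pi fun _ => isCompact_closedBall 0 1
  refine IsCompact.of_isClosed_subset hK ?_ ?_
  · have h1 : IsClosed {A : Matrix (Fin 2) (Fin 2) ℂ | A * star A = 1} :=
      isClosed_eq (continuous_id.mul continuous_star) continuous_const
    have h2 : IsClosed {A : Matrix (Fin 2) (Fin 2) ℂ | A.det = 1} :=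
      isClosed_eq (continuous_id.matrix_det) continuous_const
    have h3 : ((Matrix.specialUnitaryGroup (Fin 2) ℂ : Set (Matrix (Fin 2) (Fin 2) ℂ)))
        = {A | A * star A = 1} ∩ {A | A.det = 1} := by
      ext A
      simp [Matrix.mem_specialUnitaryGroup_iff, Matrix.mem_unitaryGroup_iff]
    rw [h3]
    exact h1.inter h2
  · intro A hA i _ j _
    have h := entry_norm_bound_of_unitary (Matrix.mem_specialUnitaryGroup_iff.mp hA).1 i j
    simpa using h

/-- The Haar probability measure on `SU(2)`. -/
def haarSU2 : Measure SU2 := Measure.haarMeasure ⊤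

/-- The character `χ_j` of the spin `j = n/2` representation of `SU(2)`: if `tr g = 2 cos θ`,
then `χ_j(g) = sin ((n+1) θ) / sin θ = U_n (cos θ)`, `U_n` the Chebyshev polynomial of the
second kind. -/
def character (n : ℕ) (g : SU2) : ℝ :=
  (Polynomial.Chebyshev.U ℝ (n : ℤ)).eval ((Matrix.trace (g : Matrix (Fin 2) (Fin 2) ℂ)).re / 2)

/-- The heat kernel `K_α(g) = ∑_{j ∈ ℕ/2} (2j+1) e^{-α j (j+1)} χ_j(g)`; here `n = 2j`. -/
def heatKernel (α : ℝ) (g : SU2) : ℝ :=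
  ∑' n : ℕ, ((n : ℝ) + 1) * Real.exp (-α * (((n : ℝ) / 2) * ((n : ℝ) / 2 + 1))) * character n g

/-! ### Four-coloured graphs

The colours `1, 2, 3, 4` are the elements `0, 1, 2, 3` of `Fin 4`. -/

/-- A closed `4`-coloured graph with white nodes `W` and black nodes `B`: every node has exactly
one line of every colour, and lines join white nodes to black ones. Thus the lines of colour `c`
are the pairs `w`, `line c w`, and a line is labelled by `(c, w) : Fin 4 × W`. -/
structure ColoredGraph (W B : Type*) where
  /-- the black end of the line of colour `c` starting at a white node -/
  line : Fin 4 → W ≃ B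

namespace ColoredGraph

variable {W B : Type*} (G : ColoredGraph W B)

/-- The graph on all the nodes in which only the lines with colours in `S` are kept. -/
def restrict (S : Set (Fin 4)) : SimpleGraph (W ⊕ B) :=
  SimpleGraph.fromRel fun x y => ∃ c ∈ S, ∃ w : W, x = Sum.inl w ∧ y = Sum.inr (G.line c w)

/-- Connectedness of the coloured graph (this includes that it has a node). -/
def Connected : Prop := (G.restrict Set.univ).Connected

/-- `B_ℓ`, the bubbles of colour `ℓ`: the connected components of the lines with colours
different from `ℓ`. -/
abbrev Bubble (ℓ : Fin 4) : Type _ := (G.restrict {ℓ}ᶜ).ConnectedComponent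

variable {ℓ : Fin 4}

/-- `V_b(ℓ')`, the vertices of colour `ℓ'` of the closed triangulated surface dual to the bubble
`b` of colour `ℓ`: the connected components (bicoloured cycles) of the lines of `b` with colours
different from `ℓ` and `ℓ'`. -/
def BubbleVertex (b : G.Bubble ℓ) (ℓ' : Fin 4) : Type _ :=
  {v : (G.restrict {ℓ, ℓ'}ᶜ).ConnectedComponent // v.supp ⊆ b.supp}

/-- The edges of the surface dual to the bubble `b`: its lines. -/
def BubbleEdge (b : G.Bubble ℓ) : Type _ :=
  {e : Fin 4 × W // e.1 ≠ ℓ ∧ Sum.inl e.2 ∈ b.supp}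

/-- The triangles of the surface dual to the bubble `b`: its nodes. -/
def BubbleFace (b : G.Bubble ℓ) : Type _ := {x : W ⊕ B // x ∈ b.supp}

/-- The Euler characteristic `|V_b| - |E_b| + |F_b|` of a bubble. -/
def eulerChar (b : G.Bubble ℓ) : ℤ :=
  (∑ ℓ' ∈ Finset.univ.erase ℓ, (Nat.card (G.BubbleVertex b ℓ') : ℤ))
    - Nat.card (G.BubbleEdge b) + Nat.card (G.BubbleFace b)

/-- The genus of a bubble, defined by `2 - 2 g_b = |V_b| - |E_b| + |F_b|`. -/
def genus (b : G.Bubble ℓ) : ℝ := (2 - (G.eulerChar b : ℝ)) / 2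

/-- `N^s_ℓ`: the number of singular vertices of colour `ℓ`, i.e. of bubbles of colour `ℓ` which
are not spheres. -/
def numSingular (ℓ : Fin 4) : ℕ := Nat.card {b : G.Bubble ℓ // G.genus b ≠ 0}

end ColoredGraph

/-! ### Regularized Feynman amplitudes in vertex variables -/

/-- The cyclic orders `1 ↦ (2,3,4)`, `2 ↦ (4,3,1)`, `3 ↦ (4,1,2)`, `4 ↦ (1,3,2)`. They order the
arguments of the fields, `ψ_ℓ^{ijk} = ψ_ℓ(G^ℓ_i, G^ℓ_j, G^ℓ_k)`, as well as the holonomies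
`G^i_ℓ G^j_ℓ G^k_ℓ` around the vertex of colour `ℓ` of a tetrahedron. -/
def ord : Fin 4 → Fin 3 → Fin 4 :=
  ![![1, 2, 3], ![3, 2, 0], ![3, 0, 1], ![0, 2, 1]]

/-- The position of the argument `G^c_i` in the field `ψ_c`. -/
def slot (c i : Fin 4) : Fin 3 := if ord c 0 = i then 0 else if ord c 1 = i then 1 else 2

theorem ord_slot : ∀ c i : Fin 4, c ≠ i → ord c (slot c i) = i := by decide

/-- Parametrization of the triples with `g₁ g₂ g₃ = 1`. -/
def closedTriple (p : SU2 × SU2) : Fin 3 → SU2 := ![p.1, p.2, (p.1 * p.2)⁻¹]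

theorem measurable_closedTriple : Measurable closedTriple := by
  refine measurable_pi_lambda _ fun k => ?_
  fin_cases k
  · exact measurable_fst
  · exact measurable_snd
  · exact (measurable_fst.mul measurable_snd).inv

/-- The measure `δ(g₁ g₂ g₃) dg₁ dg₂ dg₃` on `SU(2)³` carried by a line. -/
def closureMeasure : Measure (Fin 3 → SU2) := (haarSU2.prod haarSU2).map closedTriple

/-- The regularized interaction kernel at a node,
`K_α(G²₁ G³₁ G⁴₁) K_α(G⁴₂ G³₂ G¹₂) K_α(G⁴₃ G¹₃ G²₃) K_α(G¹₄ G³₄ G²₄) / K_α(1)`,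
where `x c k` is the `k`-th argument of the field of colour `c`. -/
def nodeKernel (α : ℝ) (x : Fin 4 → Fin 3 → SU2) : ℝ :=
  (∏ i : Fin 4, heatKernel α
    (x (ord i 0) (slot (ord i 0) i) * x (ord i 1) (slot (ord i 1) i)
      * x (ord i 2) (slot (ord i 2) i))) / heatKernel α 1

namespace ColoredGraph

variable {W B : Type*} [Fintype W] [Fintype B] (G : ColoredGraph W B)

/-- The regularized amplitude before rescaling (the coupling constants being stripped off): the
covariance of each line identifies the arguments of the two fields it contracts and imposes the
closure constraint; each white or black node carries the interaction kernel. -/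
def bareAmplitude (α : ℝ) : ℝ :=
  ∫ x : Fin 4 × W → Fin 3 → SU2,
    (∏ w : W, nodeKernel α fun c => x (c, w)) *
      (∏ b : B, nodeKernel α fun c => x (c, (G.line c).symm b))
    ∂(Measure.pi fun _ => closureMeasure)

/-- The amplitude with the rescaled coupling `λ → λ / √(K_α(1))`: every node, white or black,
contributes a further factor `1 / √(K_α(1))`. -/
def amplitude (α : ℝ) : ℝ :=
  G.bareAmplitude α / Real.sqrt (heatKernel α 1) ^ (Fintype.card W + Fintype.card B)

/-- The divergence degree
`γ_G = inf {γ ∈ ℝ | lim_{α → 0⁺} K_α(1)^{-γ} A_G^α is finite}`, as an extended real. -/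
def divergenceDegree : EReal :=
  sInf {y : EReal | ∃ γ : ℝ, y = (γ : EReal) ∧
    ∃ L : ℝ, Tendsto (fun α : ℝ => heatKernel α 1 ^ (-γ) * G.amplitude α) (𝓝[>] 0) (𝓝 L)}

end ColoredGraph

/-! ### Chains of canonical bubbles -/

/-- The white (or black) nodes of the canonical graph of genus `g`: one external node `none` and
`g` pairs of nodes `(k, false)`, `(k, true)`; this makes `2 (2g + 1)` nodes in all. -/
abbrev CanonicalNode (g : ℕ) : Type := Option (Fin g × Bool)

/-- The first handle, or the external node if there is none. -/
def firstNode (g : ℕ) (s : Bool) : CanonicalNode g :=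
  if h : 0 < g then some (⟨0, h⟩, s) else none

/-- The handle after the `k`-th one, or the external node if there is none. -/
def nextNode {g : ℕ} (k : Fin g) (s : Bool) : CanonicalNode g :=
  if h : (k : ℕ) + 1 < g then some (⟨(k : ℕ) + 1, h⟩, s) else none

/-- The lines of colour `3` (`s = true`) and `4` (`s = false`) of the canonical graph. -/
def canonicalFun {g : ℕ} (s : Bool) : CanonicalNode g → CanonicalNode g
  | none => firstNode g s
  | some (k, b) => if b = s then some (k, !s) else nextNode k s

theorem canonicalFun_injective {g : ℕ} (s : Bool) :
    Function.Injective (canonicalFun (g := g) s) := by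
  intro x y h
  rcases x with _ | ⟨k, b⟩ <;> rcases y with _ | ⟨l, c⟩ <;>
    simp only [canonicalFun, firstNode, nextNode] at h ⊢ <;> cases s
  all_goals try cases b
  all_goals try cases c
  all_goals
    simp only [Bool.not_false, Bool.not_true, if_true, Bool.false_eq_true, if_false,
      reduceCtorEq] at h
    try split_ifs at h
  all_goals
    simp only [Option.some.injEq, Prod.mk.injEq, Fin.ext_iff, reduceCtorEq, and_true, and_false]
      at h ⊢
  all_goals omega

/-- `canonicalFun` as a bijection from white to black nodes. -/
def canonicalLine (g : ℕ) (s : Bool) : CanonicalNode g ≃ CanonicalNode g :=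
  Equiv.ofBijective (canonicalFun s)
    (Finite.injective_iff_bijective.mp (canonicalFun_injective s))

/-- The white (or black) nodes of the chain. -/
abbrev ChainNode {n : ℕ} (g : Fin n → ℕ) : Type := Σ i : Fin n, CanonicalNode (g i)

/-- The lines of colour `1`: inside each canonical graph they pair up all the nodes but the two
external ones, and the external black node of each canonical graph is joined to the external white
node of the next one, cyclically. -/
def chainLink {n : ℕ} (g : Fin n → ℕ) : ChainNode g ≃ ChainNode g where
  toFun
    | ⟨i, none⟩ => ⟨(finRotate n).symm i, none⟩
    | ⟨i, some (k, b)⟩ => ⟨i, some (k, !b)⟩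
  invFun
    | ⟨i, none⟩ => ⟨finRotate n i, none⟩
    | ⟨i, some (k, b)⟩ => ⟨i, some (k, !b)⟩
  left_inv := by
    have key : ∀ i j : Fin n, i = j → (⟨i, none⟩ : ChainNode g) = ⟨j, none⟩ := by
      rintro i _ rfl
      rfl
    rintro ⟨i, _ | ⟨k, b⟩⟩
    · exact key _ _ ((finRotate n).apply_symm_apply i)
    · simp
  right_inv := by
    have key : ∀ i j : Fin n, i = j → (⟨i, none⟩ : ChainNode g) = ⟨j, none⟩ := by
      rintro i _ rfl
      rfl
    rintro ⟨i, _ | ⟨k, b⟩⟩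
    · exact key _ _ ((finRotate n).symm_apply_apply i)
    · simp

/-- The closed chain of the canonical bubbles (of colour `1`) of genera `g 0, …, g (n-1)`. In each
of them, with white nodes `e, u_k, v_k` and black nodes `f, p_k, q_k` (`k < g`; `e`, `f` are
`none`, while `u_k`, `p_k` are `(k, false)` and `v_k`, `q_k` are `(k, true)`) the lines are
* colour 1: `u_k q_k` and `v_k p_k`, while `e` and `f` carry the links of the chain;
* colour 2: `e f`, `u_k p_k`, `v_k q_k`;
* colour 3: `v_k p_k`, `e q_0`, `u_k q_{k+1}`, `u_{g-1} f`;
* colour 4: `u_k q_k`, `e p_0`, `v_k p_{k+1}`, `v_{g-1} f`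
(for `g = 0`: `e f` in colours 2, 3 and 4). -/
def chain {n : ℕ} (g : Fin n → ℕ) : ColoredGraph (ChainNode g) (ChainNode g) where
  line := ![chainLink g, Equiv.refl _, Equiv.sigmaCongrRight fun i => canonicalLine (g i) true,
    Equiv.sigmaCongrRight fun i => canonicalLine (g i) false]

end Boulatov

end

noncomputable section

namespace Boulatov

/-! ### Elementary geometry of `SU(2)` -/

/-! With N nodes, the amplitude is K_α(1)^(-3N/2) times the integral of 4N heat kernels, one for
each pair (node n, index i), evaluated at the holonomy around the vertex i of the tetrahedron n
(`amplitude_eq`). Suppose a set S of kernels can be integrated out exactly, one at a time, each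
giving 1. Bounding the others by K_α(1) yields the power 5N/2 - |S|. The proof finds an S of the
right size, and for the chains shows that nothing was lost.

Upper bound. Fix a colour ℓ and keep only indices i ≠ ℓ. In each bicoloured cycle of a bubble choose
a root. A kernel (n, i) away from its root is integrated with the variable G^c_i of the line leading
towards the root, and the closure constraint is restored by G^c_ℓ, which enters only kernels of
index ℓ. This keeps 3N - V kernels, V being the number of cycles. The bubbles are moreover joined by
lines of colour ℓ. At the base node of every bubble but one, such a line integrates two more
kernels, its third variable serving to restore closure. Hence |S| = 3N - V + 2(|B_ℓ| - 1)
(`Rooting.card_kept`), and adding up the Euler characteristics turns the exponent into 2 - 2 ∑ g_b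
(`Rooting.exponent_eq`). The bound by singular vertices follows once each genus is known to be a
natural number: it is an integer by a parity of permutation signs (`even_card_add_numVertices`), and
nonnegative because the coboundaries of vertices and of faces have orthogonal images
(`numVertices_le`).

Lower bound. The same S is used with the kernels truncated to balls of squared radius 3α, where each
retains at least half of its mass. If small holonomies in S force all holonomies to be small, the
remaining kernels are at least a constant times K_α(1) on that region, and the powers match
(`Elimination.le_divergenceDegree`). For chains the exact version is algebra valid in any group:
trivial holonomies in S force all to be trivial (`chain_holonomy_eq_one`). It becomes quantitative
when applied to a quotient of a power of SU(2) by the families which are O(ε)-close to the identity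
(`exists_gap_holonomy_le`).

Analytic input. The heat kernel is nonnegative, is maximal at 1, has integral 1 and second moment
O(α), and is comparable with K_α(1) at squared distance O(α). Nonnegativity and comparison come from
a finite Jacobi triple product: up to positive factors the kernel is a limit of derivatives of
products of affine functions of cos θ. The moments come from integration by parts for the Haar
measure. -/

theorem SU2.apply_one_one (g : SU2) :
    (g : Matrix (Fin 2) (Fin 2) ℂ) 1 1 = star ((g : Matrix (Fin 2) (Fin 2) ℂ) 0 0) := by
  have h1 := (Matrix.mem_specialUnitaryGroup_iff.mp g.2)
  have h2 : star (g : Matrix (Fin 2) (Fin 2) ℂ) = (g : Matrix (Fin 2) (Fin 2) ℂ).adjugate := by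
    have h3 := Matrix.mem_unitaryGroup_iff'.mp h1.1
    have h4 := Matrix.mul_adjugate (g : Matrix (Fin 2) (Fin 2) ℂ)
    rw [h1.2, one_smul] at h4
    exact left_inv_eq_right_inv h3 h4
  have := congrFun (congrFun h2 0) 0
  rw [Matrix.adjugate_fin_two] at this
  simpa [Matrix.star_apply] using this.symm

theorem SU2.apply_one_zero (g : SU2) :
    (g : Matrix (Fin 2) (Fin 2) ℂ) 1 0 = -star ((g : Matrix (Fin 2) (Fin 2) ℂ) 0 1) := by
  have h1 := (Matrix.mem_specialUnitaryGroup_iff.mp g.2)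
  have h2 : star (g : Matrix (Fin 2) (Fin 2) ℂ) = (g : Matrix (Fin 2) (Fin 2) ℂ).adjugate := by
    have h3 := Matrix.mem_unitaryGroup_iff'.mp h1.1
    have h4 := Matrix.mul_adjugate (g : Matrix (Fin 2) (Fin 2) ℂ)
    rw [h1.2, one_smul] at h4
    exact left_inv_eq_right_inv h3 h4
  have := congrFun (congrFun h2 1) 0
  rw [Matrix.adjugate_fin_two] at this
  have h5 : star ((g : Matrix (Fin 2) (Fin 2) ℂ) 0 1) = -(g : Matrix (Fin 2) (Fin 2) ℂ) 1 0 := by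
    simpa [Matrix.star_apply] using this
  rw [h5, neg_neg]

/-- The real coordinates of `SU(2)`, viewed as the unit sphere of `ℝ⁴`. -/
def coord (k : Fin 4) (g : SU2) : ℝ :=
  ![((g : Matrix (Fin 2) (Fin 2) ℂ) 0 0).re, ((g : Matrix (Fin 2) (Fin 2) ℂ) 0 0).im,
    ((g : Matrix (Fin 2) (Fin 2) ℂ) 0 1).re, ((g : Matrix (Fin 2) (Fin 2) ℂ) 0 1).im] k

theorem coord_sq_sum (g : SU2) :
    coord 0 g ^ 2 + coord 1 g ^ 2 + coord 2 g ^ 2 + coord 3 g ^ 2 = 1 := by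
  have h1 := (Matrix.mem_specialUnitaryGroup_iff.mp g.2).2
  rw [Matrix.det_fin_two, SU2.apply_one_one, SU2.apply_one_zero] at h1
  have := congrArg Complex.re h1
  simp only [RCLike.star_def, Complex.sub_re, Complex.mul_re, Complex.conj_re, Complex.conj_im,
    Complex.neg_re, Complex.neg_im, Complex.one_re] at this
  simp only [coord, Fin.isValue, Matrix.cons_val]
  linarith

theorem trace_eq_coord (g : SU2) :
    (Matrix.trace (g : Matrix (Fin 2) (Fin 2) ℂ)).re = 2 * coord 0 g := by
  rw [Matrix.trace_fin_two, SU2.apply_one_one]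
  simp [coord]
  ring

theorem coord_mul (g h : SU2) : coord 0 (g * h) =
    coord 0 g * coord 0 h - coord 1 g * coord 1 h - coord 2 g * coord 2 h
      - coord 3 g * coord 3 h := by
  simp only [coord, Fin.isValue, Matrix.cons_val, Submonoid.coe_mul, Matrix.mul_apply,
    Fin.sum_univ_two, SU2.apply_one_zero]
  simp
  ring

theorem coord_zero_inv (g : SU2) : coord 0 g⁻¹ = coord 0 g := by
  have : ((g⁻¹ : SU2) : Matrix (Fin 2) (Fin 2) ℂ) = star (g : Matrix (Fin 2) (Fin 2) ℂ) := rfl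
  simp [coord, this, Matrix.star_apply]

theorem coord_zero_mul_comm (g h : SU2) : coord 0 (g * h) = coord 0 (h * g) := by
  rw [coord_mul, coord_mul]; ring

theorem coord_zero_one : coord 0 (1 : SU2) = 1 := by
  simp [coord]

theorem abs_coord_le (k : Fin 4) (g : SU2) : |coord k g| ≤ 1 := by
  have h := coord_sq_sum g
  rw [abs_le_one_iff_mul_self_le_one]
  fin_cases k <;> simp only [Fin.isValue, Fin.zero_eta, Fin.mk_one, Fin.reduceFinMk] <;>
    nlinarith [sq_nonneg (coord 0 g), sq_nonneg (coord 1 g), sq_nonneg (coord 2 g),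
      sq_nonneg (coord 3 g)]

theorem coord_zero_le_one (g : SU2) : coord 0 g ≤ 1 := (abs_le.mp (abs_coord_le 0 g)).2

theorem continuous_coord (k : Fin 4) : Continuous (coord k) := by
  have h : ∀ i j : Fin 2, Continuous fun g : SU2 => (g : Matrix (Fin 2) (Fin 2) ℂ) i j :=
    fun i j => continuous_subtype_val.matrix_elem i j
  fin_cases k
  · exact Complex.continuous_re.comp (h 0 0)
  · exact Complex.continuous_im.comp (h 0 0)
  · exact Complex.continuous_re.comp (h 0 1)
  · exact Complex.continuous_im.comp (h 0 1)

/-- A multiple of the squared distance to the identity, `2 - tr g = 2 (1 - cos θ)`. -/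
def gap (g : SU2) : ℝ := 2 * (1 - coord 0 g)

theorem gap_nonneg (g : SU2) : 0 ≤ gap g := by
  have := coord_zero_le_one g
  unfold gap; linarith

theorem gap_one : gap 1 = 0 := by simp [gap, coord_zero_one]

theorem gap_inv (g : SU2) : gap g⁻¹ = gap g := by simp [gap, coord_zero_inv]

theorem gap_conj (g h : SU2) : gap (h * g * h⁻¹) = gap g := by
  rw [gap, coord_zero_mul_comm, inv_mul_cancel_left, gap]

theorem continuous_gap : Continuous gap :=
  continuous_const.mul (continuous_const.sub (continuous_coord 0))

/-- `gap` is the squared Euclidean distance to 1 on the unit sphere of ℝ⁴, so a triangle inequality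
holds up to a factor 2. The difference of the two sides is exactly the sum of the four squares
supplied. -/
theorem gap_mul_le (g h : SU2) : gap (g * h) ≤ 2 * gap g + 2 * gap h := by
  have h1 := coord_sq_sum g
  have h2 := coord_sq_sum h
  simp only [gap, coord_mul]
  nlinarith [sq_nonneg (coord 1 g - coord 1 h), sq_nonneg (coord 2 g - coord 2 h),
    sq_nonneg (coord 3 g - coord 3 h), sq_nonneg (2 - coord 0 g - coord 0 h)]

/-! ### The Haar measure -/

instance : IsProbabilityMeasure haarSU2 :=
  ⟨by
    have := Measure.haarMeasure_self (K₀ := (⊤ : TopologicalSpace.PositiveCompacts SU2))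
    simpa [haarSU2] using this⟩

instance : haarSU2.IsHaarMeasure := inferInstanceAs (Measure.haarMeasure ⊤).IsHaarMeasure

/-- Right translates of the Haar measure are again left-invariant probability measures, so
uniqueness applies. -/
instance : haarSU2.IsMulRightInvariant := by
  refine ⟨fun g => ?_⟩
  have : IsProbabilityMeasure (Measure.map (· * g) haarSU2) :=
    Measure.isProbabilityMeasure_map (measurable_mul_const g).aemeasurable
  exact Measure.isHaarMeasure_eq_of_isProbabilityMeasure _ _

/-- The matrix `[[a, b], [-b̄, ā]]` as an element of `SU(2)`. -/
def SU2.mk (a b : ℂ) (h : Complex.normSq a + Complex.normSq b = 1) : SU2 :=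
  ⟨!![a, b; -star b, star a], by
    have h' : a * starRingEnd ℂ a + b * starRingEnd ℂ b = 1 := by
      rw [Complex.mul_conj, Complex.mul_conj]
      exact_mod_cast h
    rw [Matrix.mem_specialUnitaryGroup_iff, Matrix.mem_unitaryGroup_iff]
    constructor
    · ext i j
      fin_cases i <;> fin_cases j <;>
        simp [Matrix.mul_apply, Fin.sum_univ_two, Matrix.star_apply] <;>
        first
          | linear_combination h'
          | ring_nf
    · rw [Matrix.det_fin_two_of, RCLike.star_def]
      linear_combination h'⟩

/-- In quaternionic terms, h = cos s + sin s · e_k for an imaginary unit e_k, and left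
multiplication by it rotates the plane of the coordinates 0 and k. -/
theorem exists_rotation (k : Fin 4) (hk : k ≠ 0) (s : ℝ) : ∃ h : SU2, ∀ g : SU2,
    coord 0 (h * g) = Real.cos s * coord 0 g - Real.sin s * coord k g ∧
    coord k (h * g) = Real.cos s * coord k g + Real.sin s * coord 0 g := by
  have hcs := Real.cos_sq_add_sin_sq s
  fin_cases k
  · exact absurd rfl hk
  · refine ⟨SU2.mk ⟨Real.cos s, Real.sin s⟩ 0 (by
      simp only [Complex.normSq_mk, map_zero]; linarith), fun g => ?_⟩
    simp [coord, SU2.mk, Matrix.mul_apply, Fin.sum_univ_two, SU2.apply_one_zero]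
  · refine ⟨SU2.mk (Real.cos s) (Real.sin s) (by
      simp only [Complex.normSq_ofReal]; linarith), fun g => ?_⟩
    simp [coord, SU2.mk, Matrix.mul_apply, Fin.sum_univ_two, SU2.apply_one_zero,
      SU2.apply_one_one, -Complex.ofReal_cos, -Complex.ofReal_sin]
    ring
  · refine ⟨SU2.mk (Real.cos s) ⟨0, Real.sin s⟩ (by
      simp only [Complex.normSq_ofReal, Complex.normSq_mk]; linarith), fun g => ?_⟩
    simp [coord, SU2.mk, Matrix.mul_apply, Fin.sum_univ_two, SU2.apply_one_zero,
      SU2.apply_one_one, -Complex.ofReal_cos, -Complex.ofReal_sin]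
    try ring

/-! ### Orthogonality relations of the characters -/

theorem integrable_of_continuous {f : SU2 → ℝ} (hf : Continuous f) : Integrable f haarSU2 :=
  hf.integrable_of_hasCompactSupport (HasCompactSupport.of_compactSpace f)

/-- Integration by parts along a one-parameter subgroup. -/
theorem integral_rotation (k : Fin 4) (hk : k ≠ 0) (p : Polynomial ℝ) :
    ∫ g, (p.eval (coord 0 g) * coord 0 g - p.derivative.eval (coord 0 g) * coord k g ^ 2)
      ∂haarSU2 = 0 := by
  let y : ℝ → SU2 → ℝ := fun s g => Real.cos s * coord 0 g - Real.sin s * coord k g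
  let z : ℝ → SU2 → ℝ := fun s g => Real.cos s * coord k g + Real.sin s * coord 0 g
  choose h hh using exists_rotation k hk
  have hy : ∀ s g, y s g = coord 0 (h s * g) := fun s g => (hh s g).1.symm
  have hz : ∀ s g, z s g = coord k (h s * g) := fun s g => (hh s g).2.symm
  let F : ℝ → SU2 → ℝ := fun s g => p.eval (y s g) * z s g
  let F' : ℝ → SU2 → ℝ := fun s g =>
    p.derivative.eval (y s g) * (-z s g) * z s g + p.eval (y s g) * y s g
  have hyd : ∀ s g, HasDerivAt (fun s => y s g) (-z s g) s := by
    intro s g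
    have := ((Real.hasDerivAt_cos s).mul_const (coord 0 g)).sub
      ((Real.hasDerivAt_sin s).mul_const (coord k g))
    exact this.congr_deriv (by simp only [z]; ring)
  have hzd : ∀ s g, HasDerivAt (fun s => z s g) (y s g) s := by
    intro s g
    have := ((Real.hasDerivAt_cos s).mul_const (coord k g)).add
      ((Real.hasDerivAt_sin s).mul_const (coord 0 g))
    exact this.congr_deriv (by simp only [y]; ring)
  have hFd : ∀ s g, HasDerivAt (fun s => F s g) (F' s g) s := by
    intro s g
    exact ((p.hasDerivAt (y s g)).comp s (hyd s g)).mul (hzd s g)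
  have hyc : ∀ s, Continuous (y s) := fun s =>
    (continuous_const.mul (continuous_coord 0)).sub (continuous_const.mul (continuous_coord k))
  have hzc : ∀ s, Continuous (z s) := fun s =>
    (continuous_const.mul (continuous_coord k)).add (continuous_const.mul (continuous_coord 0))
  have hFc : ∀ s, Continuous (F s) := fun s => (p.continuous.comp (hyc s)).mul (hzc s)
  have hF'c : ∀ s, Continuous (F' s) := fun s =>
    (((p.derivative.continuous.comp (hyc s)).mul (hzc s).neg).mul (hzc s)).add
      ((p.continuous.comp (hyc s)).mul (hyc s))
  have hbd : Continuous fun g => F' 0 g := hF'c 0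
  obtain ⟨C, hC⟩ := isCompact_univ.exists_bound_of_continuousOn (f := F' 0) hbd.continuousOn
  have hF'0 : ∀ s g, F' s g = F' 0 (h s * g) := by
    intro s g
    have e1 : y 0 (h s * g) = y s g := by simp [y, ← hy s g]
    have e2 : z 0 (h s * g) = z s g := by simp [z, ← hz s g]
    simp only [F', e1, e2]
  have hF0 : ∀ s g, F s g = F 0 (h s * g) := by
    intro s g
    have e1 : y 0 (h s * g) = y s g := by simp [y, ← hy s g]
    have e2 : z 0 (h s * g) = z s g := by simp [z, ← hz s g]
    simp only [F, e1, e2]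
  have hmain := (hasDerivAt_integral_of_dominated_loc_of_deriv_le (μ := haarSU2) (F := F)
    (F' := F') (x₀ := 0) (s := Set.univ) (bound := fun _ => C) Filter.univ_mem
    (Eventually.of_forall fun s => (hFc s).aestronglyMeasurable)
    (integrable_of_continuous (hFc 0)) (hF'c 0).aestronglyMeasurable
    (Eventually.of_forall fun g s _ => by rw [hF'0]; exact hC _ (Set.mem_univ _))
    (integrable_const C) (Eventually.of_forall fun g s _ => hFd s g)).2
  -- Left invariance makes the integral independent of s, so its derivative at 0, computed under the
  -- integral sign, vanishes.
  have hconst : (fun s => ∫ g, F s g ∂haarSU2) = fun _ => ∫ g, F 0 g ∂haarSU2 := by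
    funext s
    simp_rw [hF0 s]
    exact integral_mul_left_eq_self (F 0) (h s)
  rw [hconst] at hmain
  have h0 := hmain.unique (hasDerivAt_const (0 : ℝ) _)
  rw [← h0]
  refine integral_congr_ae (Eventually.of_forall fun g => ?_)
  simp only [F', y, z, Real.cos_zero, Real.sin_zero]
  ring_nf

/-- Add the three integrations by parts and replace x₁² + x₂² + x₃² by 1 - x₀². This takes the place
of the Weyl integration formula. -/
theorem integral_polynomial (p : Polynomial ℝ) :
    ∫ g, ((1 - Polynomial.X ^ 2) * p.derivative - 3 * Polynomial.X * p).eval (coord 0 g)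
      ∂haarSU2 = 0 := by
  have hi : ∀ k : Fin 4, Integrable (fun g => p.eval (coord 0 g) * coord 0 g
      - p.derivative.eval (coord 0 g) * coord k g ^ 2) haarSU2 := fun k =>
    integrable_of_continuous (((p.continuous.comp (continuous_coord 0)).mul
      (continuous_coord 0)).sub ((p.derivative.continuous.comp (continuous_coord 0)).mul
        ((continuous_coord k).pow 2)))
  have h1 := integral_rotation 1 (by decide) p
  have h2 := integral_rotation 2 (by decide) p
  have h3 := integral_rotation 3 (by decide) p
  have h4 := integral_add ((hi 1).add (hi 2)) (hi 3)
  simp only [Pi.add_apply] at h4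
  rw [integral_add (hi 1) (hi 2), h1, h2, h3] at h4
  have h5 := congrArg Neg.neg h4
  rw [← integral_neg] at h5
  simp only [add_zero, neg_zero] at h5
  rw [← h5]
  refine integral_congr_ae (Eventually.of_forall fun g => ?_)
  have := coord_sq_sum g
  simp only [Polynomial.eval_sub, Polynomial.eval_mul, Polynomial.eval_one, Polynomial.eval_pow,
    Polynomial.eval_X, Polynomial.eval_ofNat]
  linear_combination (-p.derivative.eval (coord 0 g)) * this

theorem character_eq (n : ℕ) (g : SU2) :
    character n g = (Polynomial.Chebyshev.U ℝ (n : ℤ)).eval (coord 0 g) := by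
  rw [character, trace_eq_coord, mul_div_cancel_left₀ _ (two_ne_zero)]

theorem continuous_character (n : ℕ) : Continuous (character n) := by
  have : character n = fun g => (Polynomial.Chebyshev.U ℝ (n : ℤ)).eval (coord 0 g) :=
    funext (character_eq n)
  rw [this]
  exact (Polynomial.continuous _).comp (continuous_coord 0)

-- For p = U_n the differential expression of `integral_polynomial` is a combination of U_{n+1} and
-- U_{n-1} only.
open Polynomial Polynomial.Chebyshev in
theorem integral_character_recurrence (n : ℤ) :
    (n + 3) * ∫ g, (U ℝ (n + 1)).eval (coord 0 g) ∂haarSU2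
      = (n - 1) * ∫ g, (U ℝ (n - 1)).eval (coord 0 g) ∂haarSU2 := by
  have hi : ∀ p : ℝ[X], Integrable (fun g => p.eval (coord 0 g)) haarSU2 := fun p =>
    integrable_of_continuous (p.continuous.comp (continuous_coord 0))
  have h := integral_polynomial (U ℝ n)
  have e1 := add_one_mul_T_eq_poly_in_U (R := ℝ) n
  have e2 := two_mul_T_eq_U_sub_U ℝ (n - 1)
  have e3 := U_add_one ℝ n
  rw [show n - 1 + 2 = n + 1 by ring] at e2
  have hp : ∀ t : ℝ, ((1 - X ^ 2) * derivative (U ℝ n) - 3 * X * U ℝ n).eval t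
      = -((n + 3) / 2) * (U ℝ (n + 1)).eval t + ((n - 1) / 2) * (U ℝ (n - 1)).eval t := by
    intro t
    have e1 := congrArg (Polynomial.eval t) e1
    have e2 := congrArg (Polynomial.eval t) e2
    have e3 := congrArg (Polynomial.eval t) e3
    simp only [eval_sub, eval_mul, eval_one, eval_pow, eval_X, eval_ofNat, eval_add,
      eval_intCast] at e1 e2 e3 ⊢
    linear_combination e1 - ((n : ℝ) + 1) / 2 * e2 + e3
  simp_rw [hp] at h
  rw [integral_add ((hi _).const_mul _) ((hi _).const_mul _), integral_const_mul,
    integral_const_mul] at h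
  linarith

theorem integral_character_zero : ∫ g, character 0 g ∂haarSU2 = 1 := by
  simp [character]

/-- The two-step recurrence starts from zero in both parities: U_{-1} = 0 for the odd indices, and
the factor n - 1 vanishes at n = 1 for the even ones. -/
theorem integral_character_succ (n : ℕ) : ∫ g, character (n + 1) g ∂haarSU2 = 0 := by
  simp_rw [character_eq]
  induction n using Nat.twoStepInduction with
  | zero =>
    have := integral_character_recurrence 0
    simp only [Int.cast_zero, zero_add, zero_sub, Polynomial.Chebyshev.U_neg_one,
      Polynomial.eval_zero, integral_zero, mul_zero] at this
    simpa using this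
  | one =>
    have := integral_character_recurrence 1
    simp only [Int.cast_one, sub_self, zero_mul] at this
    have h4 : (1 : ℝ) + 3 ≠ 0 := by norm_num
    simpa [h4] using this
  | more n ih _ =>
    have := integral_character_recurrence ((n : ℤ) + 2)
    have e : ((n : ℤ) + 2 - 1) = ((n + 1 : ℕ) : ℤ) := by push_cast; ring
    have e' : ((n : ℤ) + 2 + 1) = ((n + 2 + 1 : ℕ) : ℤ) := by push_cast; ring
    rw [e, ih, mul_zero, e'] at this
    refine (mul_eq_zero.mp this).resolve_left ?_
    push_cast
    positivity

/-! ### First moments and pointwise bounds of the characters. -/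

open Polynomial Polynomial.Chebyshev in
theorem two_mul_coord_mul_character (n : ℕ) (g : SU2) :
    2 * coord 0 g * character (n + 1) g = character (n + 2) g + character n g := by
  have := congrArg (Polynomial.eval (coord 0 g)) (U_add_two ℝ (n : ℤ))
  simp only [character_eq]
  simp only [eval_sub, eval_mul, eval_X, eval_ofNat] at this
  push_cast
  linarith

theorem two_mul_coord_mul_character_zero (g : SU2) :
    2 * coord 0 g * character 0 g = character 1 g := by
  simp [character_eq]

theorem integral_coord_mul_character (n : ℕ) :
    ∫ g, 2 * coord 0 g * character n g ∂haarSU2 = if n = 1 then 1 else 0 := by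
  have hi : ∀ n, Integrable (character n) haarSU2 := fun n =>
    integrable_of_continuous (continuous_character n)
  rcases n with _ | _ | n
  · simp_rw [two_mul_coord_mul_character_zero]
    simpa using integral_character_succ 0
  · simp_rw [two_mul_coord_mul_character]
    rw [integral_add (hi _) (hi _), integral_character_succ, integral_character_zero]
    simp
  · simp_rw [two_mul_coord_mul_character]
    rw [integral_add (hi _) (hi _), integral_character_succ, integral_character_succ]
    simp

open Polynomial Polynomial.Chebyshev in
theorem abs_eval_U_le (n : ℕ) {t : ℝ} (ht : |t| ≤ 1) : |(U ℝ (n : ℤ)).eval t| ≤ n + 1 := by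
  have key : ∀ n : ℕ, |(U ℝ (n : ℤ)).eval t| ≤ n + 1 ∧ |(T ℝ ((n : ℤ) + 1)).eval t| ≤ 1 := by
    have hT : ∀ n : ℤ, |(T ℝ n).eval t| ≤ 1 := by
      intro n
      have h := abs_le.mp ht
      rw [← Real.cos_arccos h.1 h.2, T_real_cos]
      exact Real.abs_cos_le_one _
    intro n
    refine ⟨?_, hT _⟩
    induction n with
    | zero => simp
    | succ n ih =>
      have h1 := congrArg (Polynomial.eval t) (U_eq_X_mul_U_add_T ℝ (n : ℤ))
      simp only [eval_add, eval_mul, eval_X] at h1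
      push_cast
      rw [h1]
      refine (abs_add_le _ _).trans ?_
      rw [abs_mul]
      have := hT ((n : ℤ) + 1)
      have h2 : |t| * |(U ℝ (n : ℤ)).eval t| ≤ 1 * (n + 1) :=
        mul_le_mul ht ih (abs_nonneg _) zero_le_one
      linarith
  exact (key n).1

theorem abs_character_le (n : ℕ) (g : SU2) : |character n g| ≤ n + 1 := by
  rw [character_eq]
  exact abs_eval_U_le n (abs_coord_le 0 g)

theorem character_one (n : ℕ) : character n 1 = n + 1 := by
  rw [character_eq, coord_zero_one]
  simp

/-! ### The finite Jacobi triple product and positivity of the heat kernel -/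

theorem hasSum_iff_of_eq {ι : Type*} {f g : ι → ℝ} {a : ℝ} (h : ∀ i, f i = g i) :
    HasSum f a ↔ HasSum g a := by rw [funext h]

open Polynomial in
/-- The partial products `∏ (1 + 2 t q^(2n+1) + q^(4n+2))`. -/
def tripleProd (q : ℝ) (M : ℕ) : ℝ[X] :=
  ∏ n ∈ Finset.range M, (C (1 + (q ^ (2 * n + 1)) ^ 2) + C (2 * q ^ (2 * n + 1)) * X)

/-- The coefficients of the expansion of `tripleProd q M` in the polynomials `T_j`, `j ∈ ℤ`. -/
def tripleCoeff (q : ℝ) : ℕ → ℤ → ℝ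
  | 0, j => if j = 0 then 1 else 0
  | M + 1, j => (1 + (q ^ (2 * M + 1)) ^ 2) * tripleCoeff q M j
      + q ^ (2 * M + 1) * (tripleCoeff q M (j - 1) + tripleCoeff q M (j + 1))

theorem tripleCoeff_neg (q : ℝ) (M : ℕ) (j : ℤ) : tripleCoeff q M (-j) = tripleCoeff q M j := by
  induction M generalizing j with
  | zero => simp [tripleCoeff]
  | succ M ih =>
    simp only [tripleCoeff]
    rw [ih j, show -j - 1 = -(j + 1) by ring, ih, show -j + 1 = -(j - 1) by ring, ih]
    ring

theorem tripleCoeff_nonneg {q : ℝ} (hq : 0 ≤ q) (M : ℕ) (j : ℤ) : 0 ≤ tripleCoeff q M j := by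
  induction M generalizing j with
  | zero => simp only [tripleCoeff]; split_ifs <;> norm_num
  | succ M ih =>
    have h1 := ih j
    have h2 := ih (j - 1)
    have h3 := ih (j + 1)
    simp only [tripleCoeff]
    positivity

theorem tripleCoeff_zero_pos {q : ℝ} (hq : 0 ≤ q) (M : ℕ) : 0 < tripleCoeff q M 0 := by
  induction M with
  | zero => simp [tripleCoeff]
  | succ M ih =>
    have h2 := tripleCoeff_nonneg hq M (0 - 1)
    have h3 := tripleCoeff_nonneg hq M (0 + 1)
    simp only [tripleCoeff]
    positivity

/-- With 2t = z + 1/z, the finite product changes only by its extreme factors under z ↦ q²z;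
comparing coefficients of z^j gives this two-term recursion, of Gaussian binomial type. The
induction on M combines the recursions at j - 1, j and j + 1. -/
theorem tripleCoeff_relation {q : ℝ} (hq : q ≠ 0) (M : ℕ) (j : ℤ) :
    (1 - q ^ (2 * M + 1) * q ^ (2 * j + 1)) * tripleCoeff q M (j + 1)
      = (q ^ (2 * j + 1) - q ^ (2 * M + 1)) * tripleCoeff q M j := by
  induction M generalizing j with
  | zero =>
    simp only [tripleCoeff]
    by_cases h1 : j + 1 = 0
    · have : j = -1 := by omega
      subst this
      have : (q : ℝ) ^ (2 * (-1) + 1 : ℤ) = q⁻¹ := by norm_num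
      rw [this]
      simp [hq]
    · by_cases h2 : j = 0
      · subst h2; simp
      · simp [h1, h2]
  | succ M ih =>
    have r0 := ih j
    have r1 := ih (j + 1)
    have r2 := ih (j - 1)
    have e1 : q ^ (2 * (j + 1) + 1) = q ^ (2 * j + 1) * q ^ 2 := by
      rw [show 2 * (j + 1) + 1 = (2 * j + 1) + 2 by ring, zpow_add₀ hq]
      norm_cast
    have e2 : q ^ (2 * j + 1) = q ^ (2 * (j - 1) + 1) * q ^ 2 := by
      rw [show 2 * j + 1 = (2 * (j - 1) + 1) + 2 by ring, zpow_add₀ hq]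
      norm_cast
    rw [e1] at r1
    rw [sub_add_cancel] at r2
    have r2' : (q ^ (2 * j + 1) - q ^ 2 * q ^ (2 * M + 1)) * tripleCoeff q M (j - 1)
        = (q ^ 2 - q ^ (2 * M + 1) * q ^ (2 * j + 1)) * tripleCoeff q M j := by
      rw [e2]
      linear_combination (-q ^ 2) * r2
    simp only [tripleCoeff]
    rw [show 2 * (M + 1) + 1 = (2 * M + 1) + 2 by ring, pow_add q (2 * M + 1) 2,
      add_sub_cancel_right]
    generalize q ^ (2 * j + 1) = x at *
    generalize q ^ (2 * M + 1) = Q at *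
    linear_combination Q * r1 - Q * r2' + (1 + Q ^ 2 * q ^ 2) * r0

-- The identity T_{j+1} + T_{j-1} = 2t T_j converts multiplication by a new factor into the
-- recursion that defines `tripleCoeff`. Differentiating it produces an extra 2 T_j, so the
-- expansion of the derivative needs that of the product in the same induction.
open Polynomial Polynomial.Chebyshev in
theorem hasSum_tripleProd (q : ℝ) (M : ℕ) (t : ℝ) :
    HasSum (fun j : ℤ => tripleCoeff q M j * (T ℝ j).eval t) ((tripleProd q M).eval t) ∧
    HasSum (fun j : ℤ => tripleCoeff q M j * (derivative (T ℝ j)).eval t)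
      ((derivative (tripleProd q M)).eval t) := by
  induction M with
  | zero =>
    constructor
    · have := hasSum_ite_eq (0 : ℤ) (1 : ℝ)
      refine (hasSum_iff_of_eq fun j => ?_).mp (by simpa [tripleProd] using this)
      by_cases hj : j = 0 <;> simp [tripleCoeff, hj]
    · have : (fun j : ℤ => tripleCoeff q 0 j * (derivative (T ℝ j)).eval t) = fun _ => 0 := by
        funext j
        by_cases hj : j = 0 <;> simp [tripleCoeff, hj]
      rw [this]
      simp [tripleProd]
  | succ M ih =>
    obtain ⟨h1, h2⟩ := ih
    have hP : tripleProd q (M + 1) = tripleProd q M *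
        (C (1 + (q ^ (2 * M + 1)) ^ 2) + C (2 * q ^ (2 * M + 1)) * X) := by
      rw [tripleProd, Finset.prod_range_succ, tripleProd]
    set Q := q ^ (2 * M + 1) with hQ
    have hrec : ∀ j : ℤ, T ℝ (j + 1) + T ℝ (j - 1) = 2 * X * T ℝ j := by
      intro j; rw [T_add_one]; ring
    have hrec' : ∀ j : ℤ, (T ℝ (j + 1)).eval t + (T ℝ (j - 1)).eval t
        = 2 * t * (T ℝ j).eval t := by
      intro j
      simpa using congrArg (Polynomial.eval t) (hrec j)
    have hrec'' : ∀ j : ℤ, (derivative (T ℝ (j + 1))).eval t + (derivative (T ℝ (j - 1))).eval t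
        = 2 * t * (derivative (T ℝ j)).eval t + 2 * (T ℝ j).eval t := by
      intro j
      have := congrArg (fun p => Polynomial.eval t (derivative p)) (hrec j)
      simp only [derivative_add, derivative_mul, derivative_X, eval_add, eval_mul,
        eval_X, eval_ofNat, derivative_ofNat] at this
      rw [this]
      simp
      ring
    -- Summation by parts for an arbitrary sequence f; it serves for both T_j and its derivative.
    -- Finite support of the coefficients settles convergence.
    have shift : ∀ (f : ℤ → ℝ) (P D : ℝ),
        HasSum (fun j : ℤ => tripleCoeff q M j * f j) P →
        HasSum (fun j : ℤ => tripleCoeff q M j * (f (j + 1) + f (j - 1))) D →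
        HasSum (fun j : ℤ => tripleCoeff q (M + 1) j * f j) ((1 + Q ^ 2) * P + Q * D) := by
      intro f P D hf hD
      have hs : ∀ c : ℤ, Summable fun j : ℤ => tripleCoeff q M j * f (j + c) := by
        intro c
        refine summable_of_hasFiniteSupport ?_
        have hfin : ∀ M : ℕ, (Function.support (tripleCoeff q M)).Finite := by
          intro M
          induction M with
          | zero =>
            refine (Set.finite_singleton (0 : ℤ)).subset fun j hj => ?_
            by_contra h
            exact hj (by simp [tripleCoeff, show j ≠ 0 from h])
          | succ M ih =>
            refine ((ih.union (ih.image (· + 1))).union (ih.image (· - 1))).subset fun j hj => ?_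
            by_contra h
            simp only [Set.mem_union, not_or] at h
            obtain ⟨⟨h0, h1⟩, h2⟩ := h
            have e0 : tripleCoeff q M j = 0 := by simpa using h0
            have e1 : tripleCoeff q M (j - 1) = 0 := by
              by_contra h; exact h1 ⟨j - 1, h, by simp⟩
            have e2 : tripleCoeff q M (j + 1) = 0 := by
              by_contra h; exact h2 ⟨j + 1, h, by simp⟩
            exact hj (by simp [tripleCoeff, e0, e1, e2])
        refine (hfin M).subset fun j hj h => hj ?_
        simp [h]
      have hplus := (hs 1).hasSum
      have hminus := (hs (-1)).hasSum
      have hDu : D = (∑' j : ℤ, tripleCoeff q M j * f (j + 1))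
          + ∑' j : ℤ, tripleCoeff q M j * f (j + -1) := by
        refine hD.unique ((hasSum_iff_of_eq fun j => ?_).mp (hplus.add hminus))
        rw [← sub_eq_add_neg]; ring
      have g1 : HasSum (fun j : ℤ => tripleCoeff q M (j - 1) * f j)
          (∑' j : ℤ, tripleCoeff q M j * f (j + 1)) := by
        refine (Equiv.hasSum_iff (Equiv.addRight (1 : ℤ))).mp ?_
        convert hplus using 2 with j
        simp
      have g2 : HasSum (fun j : ℤ => tripleCoeff q M (j + 1) * f j)
          (∑' j : ℤ, tripleCoeff q M j * f (j + -1)) := by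
        refine (Equiv.hasSum_iff (Equiv.addRight (-1 : ℤ))).mp ?_
        convert hminus using 2 with j
        simp
      rw [hDu]
      refine (hasSum_iff_of_eq fun j => ?_).mp ((hf.mul_left (1 + Q ^ 2)).add ((g1.add g2).mul_left Q))
      simp only [tripleCoeff, ← hQ]
      ring
    constructor
    · have h3 := shift (fun j => (T ℝ j).eval t) _ (2 * t * (tripleProd q M).eval t) h1 (by
        refine (hasSum_iff_of_eq fun j => ?_).mp (h1.mul_left (2 * t))
        rw [hrec']; ring)
      rw [hP]
      convert h3 using 1
      simp
      ring
    · have h3 := shift (fun j => (derivative (T ℝ j)).eval t) _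
        (2 * t * (derivative (tripleProd q M)).eval t + 2 * (tripleProd q M).eval t) h2 (by
        refine (hasSum_iff_of_eq fun j => ?_).mp ((h2.mul_left (2 * t)).add (h1.mul_left 2))
        rw [hrec'']; ring)
      rw [hP]
      convert h3 using 1
      simp only [derivative_mul, derivative_add, derivative_C, derivative_X, eval_add, eval_mul,
        eval_C, eval_X, mul_one, zero_mul, zero_add]
      ring

-- The terms j and -j agree because the coefficients and T_j are even in j, and T_j' = j U_{j-1}
-- brings in the polynomials of the characters.
open Polynomial Polynomial.Chebyshev in
theorem hasSum_derivative_tripleProd (q : ℝ) (M : ℕ) (t : ℝ) :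
    HasSum (fun n : ℕ => 2 * tripleCoeff q M (n + 1) * ((n + 1) * (U ℝ (n : ℤ)).eval t))
      ((derivative (tripleProd q M)).eval t) := by
  have h := (hasSum_tripleProd q M t).2
  have h0 := h.nat_add_neg
  simp only [T_zero, derivative_one, eval_zero, mul_zero, add_zero] at h0
  have h1 := (hasSum_nat_add_iff' 1).mpr h0
  simp only [Finset.range_one, Finset.sum_singleton, Nat.cast_zero, neg_zero, T_zero,
    derivative_one, eval_zero, mul_zero, add_zero, sub_zero] at h1
  refine (hasSum_iff_of_eq fun n => ?_).mp h1
  rw [tripleCoeff_neg, T_neg, T_derivative_eq_U]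
  push_cast
  simp only [eval_mul, eval_add, eval_natCast, eval_one, add_sub_cancel_right]
  ring

/-- The successive ratio (x - Q)/(1 - Qx) never exceeds its limit x = q^(2n+1). The resulting bound
is uniform in M, as dominated convergence requires. -/
theorem tripleCoeff_ratio_le {q : ℝ} (hq : 0 < q) (hq1 : q < 1) (M n : ℕ) :
    tripleCoeff q M n / tripleCoeff q M 0 ≤ q ^ n ^ 2 := by
  have ha := tripleCoeff_zero_pos hq.le M
  rw [div_le_iff₀ ha]
  induction n with
  | zero => simp
  | succ n ih =>
    have hr := tripleCoeff_relation hq.ne' M n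
    have hn := tripleCoeff_nonneg hq.le M n
    have e : q ^ (2 * (n : ℤ) + 1) = q ^ (2 * n + 1) := by norm_cast
    rw [e] at hr
    set x := q ^ (2 * n + 1) with hx
    set Q := q ^ (2 * M + 1)
    have hx0 : 0 < x := by positivity
    have hx1 : x < 1 := pow_lt_one₀ hq.le hq1 (by omega)
    have hQ0 : 0 < Q := by positivity
    have hQ1 : Q < 1 := pow_lt_one₀ hq.le hq1 (by omega)
    have hQx : 0 < 1 - Q * x := by nlinarith
    have hle : tripleCoeff q M (n + 1) ≤ x * tripleCoeff q M n := by
      refine le_of_mul_le_mul_left ?_ hQx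
      rw [hr]
      have : x - Q ≤ (1 - Q * x) * x := by nlinarith [mul_pos hQ0 (sub_pos.mpr hx1)]
      calc (x - Q) * tripleCoeff q M n ≤ ((1 - Q * x) * x) * tripleCoeff q M n :=
            mul_le_mul_of_nonneg_right this hn
        _ = _ := by ring
    push_cast
    refine hle.trans ?_
    have : q ^ (n + 1) ^ 2 = x * q ^ n ^ 2 := by
      rw [hx, ← pow_add]; congr 1; ring
    rw [this, mul_assoc]
    exact mul_le_mul_of_nonneg_left ih hx0.le

theorem tendsto_tripleCoeff_ratio {q : ℝ} (hq : 0 < q) (hq1 : q < 1) (n : ℕ) :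
    Tendsto (fun M => tripleCoeff q M n / tripleCoeff q M 0) atTop (𝓝 (q ^ n ^ 2)) := by
  induction n with
  | zero =>
    have : (fun M => tripleCoeff q M (0 : ℕ) / tripleCoeff q M 0) = fun _ => 1 := by
      funext M
      simp [(tripleCoeff_zero_pos hq.le M).ne']
    rw [this]; simp
  | succ n ih =>
    have hQ : Tendsto (fun M : ℕ => q ^ (2 * M + 1)) atTop (𝓝 0) :=
      (tendsto_pow_atTop_nhds_zero_of_lt_one hq.le hq1).comp
        (tendsto_atTop_mono (fun M : ℕ => show M ≤ 2 * M + 1 by omega) tendsto_id)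
    have hlim : Tendsto (fun M : ℕ => (q ^ (2 * n + 1) - q ^ (2 * M + 1))
        / (1 - q ^ (2 * M + 1) * q ^ (2 * n + 1)) * (tripleCoeff q M n / tripleCoeff q M 0))
        atTop (𝓝 ((q ^ (2 * n + 1) - 0) / (1 - 0 * q ^ (2 * n + 1)) * q ^ n ^ 2)) := by
      refine Tendsto.mul (Tendsto.div (tendsto_const_nhds.sub hQ)
        (tendsto_const_nhds.sub (hQ.mul_const _)) (by simp)) ih
    have e1 : (q ^ (2 * n + 1) - 0) / (1 - 0 * q ^ (2 * n + 1)) * q ^ n ^ 2 = q ^ (n + 1) ^ 2 := by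
      rw [zero_mul, sub_zero, sub_zero, div_one, ← pow_add]
      congr 1; ring
    rw [e1] at hlim
    refine hlim.congr fun M => ?_
    have hr := tripleCoeff_relation hq.ne' M n
    have e : q ^ (2 * (n : ℤ) + 1) = q ^ (2 * n + 1) := by norm_cast
    rw [e] at hr
    have hx1 : q ^ (2 * n + 1) < 1 := pow_lt_one₀ hq.le hq1 (by omega)
    have hQ1 : q ^ (2 * M + 1) < 1 := pow_lt_one₀ hq.le hq1 (by omega)
    have hx0 : 0 < q ^ (2 * n + 1) := by positivity
    have hQ0 : 0 < q ^ (2 * M + 1) := by positivity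
    have hQx : 1 - q ^ (2 * M + 1) * q ^ (2 * n + 1) ≠ 0 := by nlinarith
    have ha := (tripleCoeff_zero_pos hq.le M).ne'
    push_cast
    rw [div_mul_div_comm, ← hr]
    field_simp

-- Dividing by the central coefficient removes the factor ∏ (1 - q^(2m)) of the Jacobi identity, so
-- the infinite product itself is never needed.
open Polynomial Polynomial.Chebyshev in
theorem tendsto_derivative_tripleProd {q : ℝ} (hq : 0 < q) (hq1 : q < 1) {t : ℝ}
    (ht : |t| ≤ 1) :
    Tendsto (fun M => (derivative (tripleProd q M)).eval t / (2 * tripleCoeff q M 0)) atTop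
      (𝓝 (∑' n : ℕ, q ^ (n + 1) ^ 2 * ((n + 1) * (U ℝ (n : ℤ)).eval t))) := by
  have hsum : ∀ M, (derivative (tripleProd q M)).eval t / (2 * tripleCoeff q M 0)
      = ∑' n : ℕ, tripleCoeff q M ((n + 1 : ℕ) : ℤ) / tripleCoeff q M 0
          * ((n + 1) * (U ℝ (n : ℤ)).eval t) := by
    intro M
    have ha := (tripleCoeff_zero_pos hq.le M).ne'
    rw [← ((hasSum_derivative_tripleProd q M t).div_const (2 * tripleCoeff q M 0)).tsum_eq]
    refine tsum_congr fun n => ?_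
    push_cast
    field_simp
  simp_rw [hsum]
  refine tendsto_tsum_of_dominated_convergence
    (bound := fun n : ℕ => q ^ n * ((n + 1) * (n + 1))) ?_ ?_ ?_
  · have hq' : ‖q‖ < 1 := by rwa [Real.norm_of_nonneg hq.le]
    have s2 := summable_pow_mul_geometric_of_norm_lt_one 2 hq'
    have s1 := summable_pow_mul_geometric_of_norm_lt_one 1 hq'
    have s0 := summable_pow_mul_geometric_of_norm_lt_one 0 hq'
    refine ((s2.add (s1.mul_left 2)).add s0).congr fun n => ?_
    ring
  · intro n
    exact (tendsto_tripleCoeff_ratio hq hq1 (n + 1)).mul_const _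
  · refine Eventually.of_forall fun M n => ?_
    have h1 := tripleCoeff_ratio_le hq hq1 M (n + 1)
    have h0 : 0 ≤ tripleCoeff q M ((n + 1 : ℕ) : ℤ) / tripleCoeff q M 0 :=
      div_nonneg (tripleCoeff_nonneg hq.le _ _) (tripleCoeff_nonneg hq.le _ _)
    have h2 : q ^ (n + 1) ^ 2 ≤ q ^ n :=
      pow_le_pow_of_le_one hq.le hq1.le (by nlinarith)
    rw [norm_mul, norm_mul, Real.norm_of_nonneg h0, Real.norm_of_nonneg (by positivity),
      Real.norm_eq_abs]
    have := abs_eval_U_le n ht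
    gcongr
    exact h1.trans h2

open Polynomial in
theorem eval_derivative_tripleProd (q : ℝ) (M : ℕ) (t : ℝ) :
    (derivative (tripleProd q M)).eval t = ∑ n ∈ Finset.range M,
      (∏ m ∈ (Finset.range M).erase n, ((1 + (q ^ (2 * m + 1)) ^ 2) + 2 * q ^ (2 * m + 1) * t))
        * (2 * q ^ (2 * n + 1)) := by
  rw [tripleProd, derivative_prod_finset, eval_finsetSum]
  refine Finset.sum_congr rfl fun n _ => ?_
  rw [eval_mul, eval_prod]
  simp only [eval_add, eval_mul, eval_C, eval_X, derivative_add, derivative_C, derivative_mul,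
    derivative_X, zero_mul, zero_add, mul_one]

theorem tripleProd_factor_nonneg {Q t : ℝ} (hQ : 0 ≤ Q) (ht : |t| ≤ 1) :
    0 ≤ (1 + Q ^ 2) + 2 * Q * t := by
  have := (abs_le.mp ht).1
  nlinarith [sq_nonneg (1 - Q)]

-- The product rule leaves products of factors at least (1 - Q)² ≥ 0 on |t| ≤ 1, multiplied by
-- positive slopes.
open Polynomial in
theorem derivative_tripleProd_nonneg {q : ℝ} (hq : 0 < q) (M : ℕ) {t : ℝ} (ht : |t| ≤ 1) :
    0 ≤ (derivative (tripleProd q M)).eval t := by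
  rw [eval_derivative_tripleProd]
  refine Finset.sum_nonneg fun n _ => mul_nonneg (Finset.prod_nonneg fun m _ => ?_) (by positivity)
  exact tripleProd_factor_nonneg (by positivity) ht

/-- Here y is the relative loss of the factor between 1 and t. For t ≥ 0 one has y ≤ 1/2, the range
in which exp(-2y) ≤ 1 - y. -/
theorem tripleProd_factor_le {Q t : ℝ} (hQ : 0 ≤ Q) (ht0 : 0 ≤ t) (ht1 : t ≤ 1) :
    Real.exp (-(4 * (1 - t) * Q)) * ((1 + Q ^ 2) + 2 * Q * 1) ≤ (1 + Q ^ 2) + 2 * Q * t := by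
  set y := 2 * (1 - t) * Q / (1 + Q) ^ 2 with hy
  have hp : 0 < (1 + Q) ^ 2 := by positivity
  have hy0 : 0 ≤ y := div_nonneg (mul_nonneg (by linarith) hQ) hp.le
  have hy1 : y ≤ 1 / 2 := by
    rw [hy, div_le_iff₀ hp]
    nlinarith [sq_nonneg (1 - Q), mul_nonneg ht0 hQ]
  have hy2 : y ≤ 2 * (1 - t) * Q := by
    rw [hy, div_le_iff₀ hp]
    have : 0 ≤ 2 * (1 - t) * Q := mul_nonneg (by linarith) hQ
    nlinarith [mul_nonneg this hQ, mul_nonneg (mul_nonneg this hQ) hQ]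
  have hexp : Real.exp (-(4 * (1 - t) * Q)) ≤ 1 - y := by
    have h1 : Real.exp (-(4 * (1 - t) * Q)) ≤ Real.exp (-(2 * y)) :=
      Real.exp_le_exp.mpr (by linarith)
    refine h1.trans ?_
    rw [Real.exp_neg, inv_le_iff_one_le_mul₀ (Real.exp_pos _)]
    have h2 := Real.add_one_le_exp (2 * y)
    have h3 : (1 - y) * (2 * y + 1) ≤ (1 - y) * Real.exp (2 * y) :=
      mul_le_mul_of_nonneg_left h2 (by linarith)
    nlinarith
  have : (1 + Q ^ 2) + 2 * Q * t = (1 - y) * ((1 + Q ^ 2) + 2 * Q * 1) := by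
    have hne : (1 + Q) ^ 2 ≠ 0 := hp.ne'
    rw [hy]
    field_simp
    ring
  rw [this]
  exact mul_le_mul_of_nonneg_right hexp (by positivity)

-- Compare the products factor by factor; the losses in the exponent add up to at most 4(1 - t) ∑
-- q^(2m+1), which a geometric series bounds independently of M.
open Polynomial in
theorem derivative_tripleProd_ge {q : ℝ} (hq : 0 < q) (hq1 : q < 1) (M : ℕ) {t : ℝ}
    (ht0 : 0 ≤ t) (ht1 : t ≤ 1) :
    Real.exp (-(4 * (1 - t) / (1 - q ^ 2))) * (derivative (tripleProd q M)).eval 1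
      ≤ (derivative (tripleProd q M)).eval t := by
  rw [eval_derivative_tripleProd, eval_derivative_tripleProd, Finset.mul_sum]
  refine Finset.sum_le_sum fun n _ => ?_
  rw [← mul_assoc]
  refine mul_le_mul_of_nonneg_right ?_ (by positivity)
  have hq2 : q ^ 2 < 1 := pow_lt_one₀ hq.le hq1 two_ne_zero
  have hgeo : ∑ m ∈ Finset.range M, q ^ (2 * m + 1) ≤ 1 / (1 - q ^ 2) := by
    calc ∑ m ∈ Finset.range M, q ^ (2 * m + 1) ≤ ∑ m ∈ Finset.range M, (q ^ 2) ^ m := by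
          refine Finset.sum_le_sum fun m _ => ?_
          rw [← pow_mul]
          exact pow_le_pow_of_le_one hq.le hq1.le (by omega)
      _ ≤ ∑' m : ℕ, (q ^ 2) ^ m :=
          (summable_geometric_of_lt_one (by positivity) hq2).sum_le_tsum _
            fun m _ => by positivity
      _ = 1 / (1 - q ^ 2) := by
          rw [tsum_geometric_of_lt_one (by positivity) hq2, one_div]
  have hsum : ∑ m ∈ (Finset.range M).erase n, q ^ (2 * m + 1) ≤ 1 / (1 - q ^ 2) :=
    (Finset.sum_le_sum_of_subset_of_nonneg (Finset.erase_subset _ _)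
      fun m _ _ => by positivity).trans hgeo
  calc Real.exp (-(4 * (1 - t) / (1 - q ^ 2))) * ∏ m ∈ (Finset.range M).erase n,
        ((1 + (q ^ (2 * m + 1)) ^ 2) + 2 * q ^ (2 * m + 1) * 1)
      ≤ (∏ m ∈ (Finset.range M).erase n, Real.exp (-(4 * (1 - t) * q ^ (2 * m + 1))))
        * ∏ m ∈ (Finset.range M).erase n,
          ((1 + (q ^ (2 * m + 1)) ^ 2) + 2 * q ^ (2 * m + 1) * 1) := by
        refine mul_le_mul_of_nonneg_right ?_ (Finset.prod_nonneg fun m _ => by positivity)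
        rw [← Real.exp_sum, Real.exp_le_exp, Finset.sum_neg_distrib, ← Finset.mul_sum,
          neg_le_neg_iff, mul_div_assoc, ← one_div_mul_eq_div]
        have : 0 ≤ 4 * (1 - t) := by linarith
        calc 4 * (1 - t) * ∑ m ∈ (Finset.range M).erase n, q ^ (2 * m + 1)
            ≤ 4 * (1 - t) * (1 / (1 - q ^ 2)) := mul_le_mul_of_nonneg_left hsum this
          _ = _ := by ring
    _ = ∏ m ∈ (Finset.range M).erase n, Real.exp (-(4 * (1 - t) * q ^ (2 * m + 1)))
          * ((1 + (q ^ (2 * m + 1)) ^ 2) + 2 * q ^ (2 * m + 1) * 1) :=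
        Finset.prod_mul_distrib.symm
    _ ≤ _ := Finset.prod_le_prod (fun m _ => by positivity)
        fun m _ => tripleProd_factor_le (by positivity) ht0 ht1

/-! ### The heat kernel -/

theorem exp_neg_div_four_lt_one {α : ℝ} (hα : 0 < α) : Real.exp (-α / 4) < 1 :=
  by
  rw [← Real.exp_zero, Real.exp_lt_exp]; linarith

theorem heatKernel_term_eq (α : ℝ) (n : ℕ) (g : SU2) :
    ((n : ℝ) + 1) * Real.exp (-α * (((n : ℝ) / 2) * ((n : ℝ) / 2 + 1))) * character n g
      = (Real.exp (-α / 4))⁻¹ * (Real.exp (-α / 4) ^ (n + 1) ^ 2 * ((n + 1) *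
        (Polynomial.Chebyshev.U ℝ (n : ℤ)).eval (coord 0 g))) := by
  have : Real.exp (-α * (((n : ℝ) / 2) * ((n : ℝ) / 2 + 1)))
      = (Real.exp (-α / 4))⁻¹ * Real.exp (-α / 4) ^ (n + 1) ^ 2 := by
    rw [← Real.exp_nat_mul, ← Real.exp_neg, ← Real.exp_add]
    congr 1
    push_cast
    ring
  rw [this, character_eq]
  ring

theorem heatKernel_eq (α : ℝ) (g : SU2) :
    heatKernel α g = (Real.exp (-α / 4))⁻¹ * ∑' n : ℕ, Real.exp (-α / 4) ^ (n + 1) ^ 2 *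
      ((n + 1) * (Polynomial.Chebyshev.U ℝ (n : ℤ)).eval (coord 0 g)) := by
  rw [heatKernel, ← tsum_mul_left]
  exact tsum_congr fun n => heatKernel_term_eq α n g

theorem heatKernel_nonneg {α : ℝ} (hα : 0 < α) (g : SU2) : 0 ≤ heatKernel α g := by
  have hq := Real.exp_pos (-α / 4)
  have ht := abs_coord_le 0 g
  rw [heatKernel_eq]
  refine mul_nonneg (inv_nonneg.mpr hq.le) (ge_of_tendsto
    (tendsto_derivative_tripleProd hq (exp_neg_div_four_lt_one hα) ht)
    (Eventually.of_forall fun M => ?_))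
  exact div_nonneg (derivative_tripleProd_nonneg hq M ht)
    (mul_nonneg zero_le_two (tripleCoeff_nonneg hq.le _ _))

theorem heatKernel_ge {α : ℝ} (hα : 0 < α) {g : SU2} (hg : 0 ≤ coord 0 g) :
    Real.exp (-(4 * (1 - coord 0 g) / (1 - Real.exp (-α / 4) ^ 2))) * heatKernel α 1
      ≤ heatKernel α g := by
  have hq := Real.exp_pos (-α / 4)
  have hq1 := exp_neg_div_four_lt_one hα
  have ht := abs_coord_le 0 g
  rw [heatKernel_eq, heatKernel_eq, coord_zero_one, mul_left_comm]
  refine mul_le_mul_of_nonneg_left ?_ (inv_nonneg.mpr hq.le)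
  refine le_of_tendsto_of_tendsto
    ((tendsto_derivative_tripleProd hq hq1 (t := 1) (by simp)).const_mul _)
    (tendsto_derivative_tripleProd hq hq1 ht) (Eventually.of_forall fun M => ?_)
  simp only
  rw [← mul_div_assoc]
  exact div_le_div_of_nonneg_right (derivative_tripleProd_ge hq hq1 M hg (coord_zero_le_one g))
    (mul_nonneg zero_le_two (tripleCoeff_nonneg hq.le _ _))

/-- On balls whose radius is comparable with `√α` the heat kernel is comparable with its value at
the identity. -/
theorem heatKernel_ge_of_gap_le {α C : ℝ} (hα : 0 < α) (hα2 : α ≤ 2) (hC : C * α ≤ 1) {g : SU2}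
    (hg : gap g ≤ C * α) : Real.exp (-(8 * C)) * heatKernel α 1 ≤ heatKernel α g := by
  have h1 : 1 - coord 0 g ≤ C * α / 2 := by unfold gap at hg; linarith
  refine le_trans (mul_le_mul_of_nonneg_right (Real.exp_le_exp.mpr (neg_le_neg ?_))
    (heatKernel_nonneg hα 1)) (heatKernel_ge hα (by linarith))
  have h2 : Real.exp (-α / 4) ^ 2 = Real.exp (-(α / 2)) := by
    rw [← Real.exp_nat_mul]; congr 1; push_cast; ring
  -- The hypothesis α ≤ 2 is what makes 1/(1 + α/2) ≤ 1 - α/4. The constant 8C is then 4 · (C/2) ·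
  -- 4.
  have h3 : α / 4 ≤ 1 - Real.exp (-α / 4) ^ 2 := by
    rw [h2, Real.exp_neg]
    have h4 := Real.add_one_le_exp (α / 2)
    have h5 : (Real.exp (α / 2))⁻¹ ≤ (α / 2 + 1)⁻¹ := inv_anti₀ (by linarith) h4
    have h6 : (α / 2 + 1)⁻¹ ≤ 1 - α / 4 := by
      rw [inv_le_iff_one_le_mul₀ (by linarith)]
      nlinarith
    linarith
  have h4 := coord_zero_le_one g
  rw [div_le_iff₀ (by linarith)]
  have hC0 : 0 ≤ C := by
    by_contra h
    have := mul_neg_of_neg_of_pos (not_le.mp h) hα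
    linarith
  nlinarith [mul_le_mul_of_nonneg_left h3 hC0]

/-! ### The character series: upper bound, moments, divergence at the identity. -/

/-- The coefficients of the expansion of the heat kernel at the identity. -/
def heatCoeff (α : ℝ) (n : ℕ) : ℝ :=
  ((n : ℝ) + 1) * Real.exp (-α * (((n : ℝ) / 2) * ((n : ℝ) / 2 + 1)))

theorem heatCoeff_pos (α : ℝ) (n : ℕ) : 0 < heatCoeff α n := by unfold heatCoeff; positivity

theorem summable_heatCoeff {α : ℝ} (hα : 0 < α) :
    Summable fun n : ℕ => heatCoeff α n * ((n : ℝ) + 1) := by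
  have hq := Real.exp_pos (-α / 4)
  have hq1 := exp_neg_div_four_lt_one hα
  have hq' : ‖Real.exp (-α / 4)‖ < 1 := by rwa [Real.norm_of_nonneg hq.le]
  have s2 := summable_pow_mul_geometric_of_norm_lt_one 2 hq'
  have s1 := summable_pow_mul_geometric_of_norm_lt_one 1 hq'
  have s0 := summable_pow_mul_geometric_of_norm_lt_one 0 hq'
  refine Summable.of_nonneg_of_le (fun n => mul_nonneg (heatCoeff_pos α n).le (by positivity))
    (fun n => ?_) ((s2.add (s1.mul_left 2)).add s0)
  have h1 : Real.exp (-α * (((n : ℝ) / 2) * ((n : ℝ) / 2 + 1))) ≤ Real.exp (-α / 4) ^ n := by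
    rw [← Real.exp_nat_mul, Real.exp_le_exp]
    have : (0 : ℝ) ≤ n := Nat.cast_nonneg n
    nlinarith [mul_nonneg hα.le this, mul_nonneg (mul_nonneg hα.le this) this]
  calc heatCoeff α n * ((n : ℝ) + 1)
      = (((n : ℝ) + 1) * ((n : ℝ) + 1)) * Real.exp (-α * (((n : ℝ) / 2) * ((n : ℝ) / 2 + 1))) := by
        unfold heatCoeff; ring
    _ ≤ (((n : ℝ) + 1) * ((n : ℝ) + 1)) * Real.exp (-α / 4) ^ n := by gcongr
    _ = _ := by ring

theorem norm_heatKernel_term_le (α : ℝ) (n : ℕ) (g : SU2) :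
    ‖heatCoeff α n * character n g‖ ≤ heatCoeff α n * ((n : ℝ) + 1) := by
  rw [norm_mul, Real.norm_of_nonneg (heatCoeff_pos α n).le, Real.norm_eq_abs]
  exact mul_le_mul_of_nonneg_left (abs_character_le n g) (heatCoeff_pos α n).le

theorem heatKernel_one (α : ℝ) : heatKernel α 1 = ∑' n : ℕ, heatCoeff α n * ((n : ℝ) + 1) :=
  tsum_congr fun n => by rw [character_one, heatCoeff]

theorem heatKernel_le {α : ℝ} (hα : 0 < α) (g : SU2) : heatKernel α g ≤ heatKernel α 1 := by
  rw [heatKernel_one]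
  have hs := summable_heatCoeff hα
  exact (Summable.of_norm_bounded hs fun n => norm_heatKernel_term_le α n g).tsum_le_tsum
    (fun n => (le_abs_self _).trans (norm_heatKernel_term_le α n g)) hs

theorem heatKernel_one_pos {α : ℝ} (hα : 0 < α) : 0 < heatKernel α 1 := by
  rw [heatKernel_one]
  exact (summable_heatCoeff hα).tsum_pos
    (fun n => mul_nonneg (heatCoeff_pos α n).le (by positivity)) 0
    (mul_pos (heatCoeff_pos α 0) (by positivity))

theorem continuous_heatKernel {α : ℝ} (hα : 0 < α) : Continuous (heatKernel α) :=
  continuous_tsum (fun n => continuous_const.mul (continuous_character n)) (summable_heatCoeff hα)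
    fun n g => norm_heatKernel_term_le α n g

theorem character_congr (n : ℕ) {g h : SU2} (hgh : coord 0 g = coord 0 h) :
    character n g = character n h := by rw [character_eq, character_eq, hgh]

theorem heatKernel_congr (α : ℝ) {g h : SU2} (hgh : coord 0 g = coord 0 h) :
    heatKernel α g = heatKernel α h :=
  tsum_congr fun n => by rw [character_congr n hgh]

theorem integral_mul_heatKernel {α : ℝ} (hα : 0 < α) {f : SU2 → ℝ} (hf : Continuous f) {c : ℝ}
    (hc : ∀ g, |f g| ≤ c) :
    ∫ g, f g * heatKernel α g ∂haarSU2
      = ∑' n : ℕ, heatCoeff α n * ∫ g, f g * character n g ∂haarSU2 := by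
  have hi : ∀ n, Integrable (fun g => f g * (heatCoeff α n * character n g)) haarSU2 := fun n =>
    integrable_of_continuous (hf.mul (continuous_const.mul (continuous_character n)))
  have hb : ∀ n g, ‖f g * (heatCoeff α n * character n g)‖
      ≤ c * (heatCoeff α n * ((n : ℝ) + 1)) := by
    intro n g
    rw [norm_mul]
    exact mul_le_mul (hc g) (norm_heatKernel_term_le α n g) (norm_nonneg _)
      ((abs_nonneg _).trans (hc g))
  have h := integral_tsum_of_summable_integral_norm hi
    (Summable.of_nonneg_of_le (fun n => integral_nonneg fun g => norm_nonneg _) (fun n => by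
      refine (integral_mono (hi n).norm (integrable_const _) (hb n)).trans ?_
      simp) ((summable_heatCoeff hα).mul_left c))
  calc ∫ g, f g * heatKernel α g ∂haarSU2
      = ∫ g, ∑' n, f g * (heatCoeff α n * character n g) ∂haarSU2 :=
        integral_congr_ae (Eventually.of_forall fun g => tsum_mul_left.symm)
    _ = ∑' n, ∫ g, f g * (heatCoeff α n * character n g) ∂haarSU2 := h.symm
    _ = _ := tsum_congr fun n => by
        rw [← integral_const_mul]
        exact integral_congr_ae (Eventually.of_forall fun g => by simp only; ring)

theorem integral_heatKernel {α : ℝ} (hα : 0 < α) : ∫ g, heatKernel α g ∂haarSU2 = 1 := by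
  have h := integral_mul_heatKernel hα (f := fun _ => 1) continuous_const (c := 1) (by simp)
  simp only [one_mul] at h
  rw [h, tsum_eq_single 0]
  · rw [integral_character_zero]; simp [heatCoeff]
  · intro n hn
    obtain ⟨m, rfl⟩ := Nat.exists_eq_succ_of_ne_zero hn
    rw [integral_character_succ, mul_zero]

/-- Since gap = 2 - χ_{1/2}, only the spins 0 and 1/2 contribute and the exact value is 2 - 2
exp(-3α/4). -/
theorem integral_gap_mul_heatKernel {α : ℝ} (hα : 0 < α) :
    ∫ g, gap g * heatKernel α g ∂haarSU2 ≤ 3 / 2 * α := by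
  have hK := continuous_heatKernel hα
  have h := integral_mul_heatKernel hα (f := fun g => 2 * coord 0 g)
    (continuous_const.mul (continuous_coord 0)) (c := 2) (fun g => by
      rw [abs_mul, abs_two]; linarith [abs_coord_le 0 g])
  have h2 : ∫ g, 2 * coord 0 g * heatKernel α g ∂haarSU2 = 2 * Real.exp (-α * (3 / 4)) := by
    rw [h, tsum_eq_single 1]
    · rw [integral_coord_mul_character]
      simp only [heatCoeff, if_true, Nat.cast_one, mul_one]
      norm_num
    · intro n hn
      rw [integral_coord_mul_character, if_neg hn, mul_zero]
  have h3 : ∫ g, gap g * heatKernel α g ∂haarSU2 = 2 - 2 * Real.exp (-α * (3 / 4)) := by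
    have : ∫ g, 2 * heatKernel α g ∂haarSU2 = 2 := by
      rw [integral_const_mul, integral_heatKernel hα, mul_one]
    rw [← h2, ← sub_left_inj.mpr this, ← integral_sub]
    · exact integral_congr_ae (Eventually.of_forall fun g => by simp only [gap]; ring)
    · exact integrable_of_continuous (continuous_const.mul hK)
    · exact integrable_of_continuous ((continuous_const.mul (continuous_coord 0)).mul hK)
  rw [h3]
  have := Real.add_one_le_exp (-α * (3 / 4))
  linarith

/-- The heat kernel puts at least half of its mass on a ball of radius comparable with `√α`. -/
theorem half_le_setIntegral_heatKernel {α : ℝ} (hα : 0 < α) :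
    1 / 2 ≤ ∫ g in {g | gap g ≤ 3 * α}, heatKernel α g ∂haarSU2 := by
  have hK := continuous_heatKernel hα
  have hm : MeasurableSet {g : SU2 | gap g ≤ 3 * α} :=
    (isClosed_le continuous_gap continuous_const).measurableSet
  have hi := integrable_of_continuous hK
  have hig := integrable_of_continuous (continuous_gap.mul hK)
  have h1 := integral_add_compl hm hi
  rw [integral_heatKernel hα] at h1
  -- Markov's inequality; the threshold 3α is twice the bound on the mean of `gap`.
  have h2 : (3 * α) * ∫ g in {g | gap g ≤ 3 * α}ᶜ, heatKernel α g ∂haarSU2 ≤ 3 / 2 * α := by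
    refine le_trans ?_ (integral_gap_mul_heatKernel hα)
    rw [← integral_const_mul]
    refine le_trans ?_ (setIntegral_le_integral (s := {g | gap g ≤ 3 * α}ᶜ) hig
      (Eventually.of_forall fun g => mul_nonneg (gap_nonneg g) (heatKernel_nonneg hα g)))
    refine setIntegral_mono_on (hi.const_mul _).integrableOn hig.integrableOn hm.compl
      fun g hg => ?_
    exact mul_le_mul_of_nonneg_right (le_of_lt (not_le.mp hg)) (heatKernel_nonneg hα g)
  have h3 : ∫ g in {g | gap g ≤ 3 * α}ᶜ, heatKernel α g ∂haarSU2 ≤ 1 / 2 := by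
    by_contra h
    nlinarith [not_le.mp h]
  linarith

/-- All terms at the identity are positive, and finite partial sums are continuous in α with
arbitrarily large values at α = 0. -/
theorem tendsto_heatKernel_one : Tendsto (fun α => heatKernel α 1) (𝓝[>] 0) atTop := by
  rw [tendsto_atTop]
  intro b
  obtain ⟨M, hM⟩ := exists_nat_gt b
  have hc : Tendsto (fun α : ℝ => ∑ n ∈ Finset.range (M + 1), heatCoeff α n * ((n : ℝ) + 1))
      (𝓝[>] 0) (𝓝 (∑ n ∈ Finset.range (M + 1), heatCoeff 0 n * ((n : ℝ) + 1))) := by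
    refine Tendsto.mono_left (Continuous.tendsto ?_ 0) nhdsWithin_le_nhds
    unfold heatCoeff
    fun_prop
  have hb : b < ∑ n ∈ Finset.range (M + 1), heatCoeff 0 n * ((n : ℝ) + 1) := by
    refine hM.trans_le ?_
    calc (M : ℝ) ≤ ∑ n ∈ Finset.range (M + 1), (1 : ℝ) := by simp
      _ ≤ _ := Finset.sum_le_sum fun n _ => by
        simp only [heatCoeff, neg_zero, zero_mul, Real.exp_zero, mul_one]
        have : (0 : ℝ) ≤ n := Nat.cast_nonneg n
        nlinarith
  filter_upwards [hc.eventually (lt_mem_nhds hb), self_mem_nhdsWithin] with α h1 h2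
  rw [heatKernel_one]
  exact h1.le.trans ((summable_heatCoeff h2).sum_le_tsum _
    fun n _ => mul_nonneg (heatCoeff_pos α n).le (by positivity))

/-! ### Successive elimination of kernels in an integral -/

open scoped ENNReal in
/-- If the factors can be integrated out one after the other, each by means of a family of measure
preserving transformations which does not affect the factors that come later, then the integral of
their product is the product of the integrals. -/
theorem lintegral_prod_eq_pow_card {X Γ ι R : Type*} [MeasurableSpace X] [MeasurableSpace Γ]
    [DecidableEq ι] [LinearOrder R] (μ : Measure X) [IsProbabilityMeasure μ] (ν : Measure Γ)
    [IsProbabilityMeasure ν] (rank : ι → R) (f : ι → X → ℝ≥0∞) (T : ι → Γ → X → X) (c : ℝ≥0∞)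
    (S : Finset ι) (hf : ∀ k ∈ S, Measurable (f k))
    (hT : ∀ k ∈ S, Measurable (Function.uncurry (T k)))
    (hμ : ∀ k ∈ S, ∀ h, MeasurePreserving (T k h) μ μ)
    (hc : ∀ k ∈ S, ∀ x, ∫⁻ h, f k (T k h x) ∂ν = c)
    (hinv : ∀ k ∈ S, ∀ k' ∈ S, k' ≠ k → rank k ≤ rank k' → ∀ h x, f k' (T k h x) = f k' x) :
    ∫⁻ x, ∏ k ∈ S, f k x ∂μ = c ^ S.card := by
  induction S using Finset.strongInduction with
  | H S ih =>
    rcases S.eq_empty_or_nonempty with rfl | hS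
    · simp
    -- The factor of least rank is removed first: its move leaves all the remaining factors
    -- unchanged.
    obtain ⟨k, hk, hmin⟩ := S.exists_min_image rank hS
    have hsub : S.erase k ⊆ S := Finset.erase_subset _ _
    have ih' := ih (S.erase k) (Finset.erase_ssubset hk) (fun j hj => hf j (hsub hj))
      (fun j hj => hT j (hsub hj)) (fun j hj => hμ j (hsub hj)) (fun j hj => hc j (hsub hj))
      (fun j hj j' hj' => hinv j (hsub hj) j' (hsub hj'))
    have hprod : Measurable fun x => ∏ j ∈ S.erase k, f j x :=
      Finset.measurable_fun_prod _ fun j hj => hf j (hsub hj)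
    have hall : Measurable fun x => f k x * ∏ j ∈ S.erase k, f j x := (hf k hk).mul hprod
    have hTx : ∀ x, Measurable fun h => T k h x := fun x =>
      (hT k hk).comp (measurable_id.prodMk measurable_const)
    calc ∫⁻ x, ∏ j ∈ S, f j x ∂μ = ∫⁻ x, f k x * ∏ j ∈ S.erase k, f j x ∂μ := by
          exact lintegral_congr fun x => (Finset.mul_prod_erase S (fun j => f j x) hk).symm
      -- A dummy average over the transformations is inserted; after the change of variables and
      -- Tonelli it acts on the factor k alone.
      _ = ∫⁻ _, ∫⁻ x, f k x * ∏ j ∈ S.erase k, f j x ∂μ ∂ν := by simp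
      _ = ∫⁻ h, ∫⁻ x, f k (T k h x) * ∏ j ∈ S.erase k, f j (T k h x) ∂μ ∂ν :=
          lintegral_congr fun h => ((hμ k hk h).lintegral_comp hall).symm
      _ = ∫⁻ h, ∫⁻ x, f k (T k h x) * ∏ j ∈ S.erase k, f j x ∂μ ∂ν := by
          refine lintegral_congr fun h => lintegral_congr fun x => ?_
          congr 1
          refine Finset.prod_congr rfl fun j hj => ?_
          exact hinv k hk j (hsub hj) (Finset.ne_of_mem_erase hj) (hmin j (hsub hj)) h x
      _ = ∫⁻ x, ∫⁻ h, f k (T k h x) * ∏ j ∈ S.erase k, f j x ∂ν ∂μ := by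
          refine lintegral_lintegral_swap (Measurable.aemeasurable ?_)
          exact ((hf k hk).comp (hT k hk)).mul (hprod.comp measurable_snd)
      _ = ∫⁻ x, c * ∏ j ∈ S.erase k, f j x ∂μ := by
          refine lintegral_congr fun x => ?_
          have hm : Measurable fun h => f k (T k h x) := (hf k hk).comp (hTx x)
          rw [lintegral_mul_const _ hm, hc k hk x]
      _ = c ^ S.card := by
          rw [lintegral_const_mul _ hprod, ih', Finset.card_erase_of_mem hk, ← pow_succ',
            Nat.sub_add_cancel (Finset.card_pos.mpr hS)]

/-! ### Moves preserving the closure constraints -/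

instance : IsProbabilityMeasure closureMeasure :=
  Measure.isProbabilityMeasure_map measurable_closedTriple.aemeasurable

/-- The move `(x_s, x_{s+1}) ↦ (x_s h⁻¹, h x_{s+1})`. -/
def shiftTriple (s : Fin 3) (h : SU2) (x : Fin 3 → SU2) : Fin 3 → SU2 := fun t =>
  if t = s then x t * h⁻¹ else if t = s + 1 then h * x t else x t

theorem measurable_shiftTriple (s : Fin 3) :
    Measurable (Function.uncurry (shiftTriple s)) := by
  refine measurable_pi_lambda _ fun t => ?_
  have h1 : Measurable fun p : SU2 × (Fin 3 → SU2) => p.2 t :=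
    (measurable_pi_apply t).comp measurable_snd
  simp only [Function.uncurry, shiftTriple]
  split_ifs
  · exact h1.mul measurable_fst.inv
  · exact measurable_fst.mul h1
  · exact h1

/-- In the two free coordinates of `closedTriple` each move is a product of translations of SU(2).
For s = 2 the wrapped-around move conjugates the total product by h, so closure still holds. -/
theorem measurePreserving_shiftTriple (s : Fin 3) (h : SU2) :
    MeasurePreserving (shiftTriple s h) closureMeasure closureMeasure := by
  have hm : Measurable (shiftTriple s h) :=
    (measurable_shiftTriple s).comp (measurable_const.prodMk measurable_id)
  have hl := measurePreserving_mul_left haarSU2 h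
  have hr := measurePreserving_mul_right haarSU2 h⁻¹
  have hid := MeasurePreserving.id haarSU2
  have key : ∀ φ : SU2 × SU2 → SU2 × SU2,
      MeasurePreserving φ (haarSU2.prod haarSU2) (haarSU2.prod haarSU2) →
      (∀ p, shiftTriple s h (closedTriple p) = closedTriple (φ p)) →
      MeasurePreserving (shiftTriple s h) closureMeasure closureMeasure := by
    intro φ hφ hcomp
    refine ⟨hm, ?_⟩
    rw [closureMeasure, Measure.map_map hm measurable_closedTriple,
      show shiftTriple s h ∘ closedTriple = closedTriple ∘ φ from funext hcomp,
      ← Measure.map_map measurable_closedTriple hφ.measurable, hφ.map_eq]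
  fin_cases s
  · refine key _ (hr.prod hl) fun p => ?_
    funext t
    fin_cases t <;> simp [shiftTriple, closedTriple, mul_assoc]
  · refine key _ (hid.prod hr) fun p => ?_
    funext t
    fin_cases t <;> simp [shiftTriple, closedTriple, mul_assoc]
  · refine key _ (hl.prod hid) fun p => ?_
    funext t
    fin_cases t <;> simp [shiftTriple, closedTriple, mul_assoc]

/-- The move which multiplies the entry `p` of a closed triple and compensates with the entry
`r`. -/
def moveTriple (p r : Fin 3) : SU2 → (Fin 3 → SU2) → Fin 3 → SU2 :=
  shiftTriple (if r = p + 1 then p else r)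

/-- Two distinct entries of a triple are always cyclically adjacent. Their cyclic order decides
whether the entry p is translated on the right by h⁻¹ or on the left by h. -/
theorem moveTriple_self {p r : Fin 3} (hpr : p ≠ r) :
    (∀ h x, moveTriple p r h x p = x p * h⁻¹) ∨ ∀ h x, moveTriple p r h x p = h * x p := by
  by_cases hr : r = p + 1
  · left
    intro h x
    simp [moveTriple, shiftTriple, hr]
  · right
    have hp : p = r + 1 := by revert p r; decide
    intro h x
    rw [moveTriple, if_neg hr, shiftTriple, if_neg hpr, if_pos hp]

theorem moveTriple_of_ne {p r t : Fin 3} (htp : t ≠ p) (htr : t ≠ r) (hpr : p ≠ r)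
    (h : SU2) (x : Fin 3 → SU2) : moveTriple p r h x t = x t := by
  have h1 : t ≠ (if r = p + 1 then p else r) := by split_ifs <;> assumption
  have h2 : t ≠ (if r = p + 1 then p else r) + 1 := by revert p r t; decide
  rw [moveTriple, shiftTriple, if_neg h1, if_neg h2]

section Configurations

variable {E : Type*} [DecidableEq E]

/-- The move of a configuration which modifies the entries `p` and `r` of the line `e`. -/
def moveAt (e : E) (p r : Fin 3) (h : SU2) (x : E → Fin 3 → SU2) : E → Fin 3 → SU2 := fun e' =>
  if e' = e then moveTriple p r h (x e') else x e'

theorem measurable_moveAt (e : E) (p r : Fin 3) :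
    Measurable fun q : SU2 × (E → Fin 3 → SU2) => moveAt e p r q.1 q.2 := by
  refine measurable_pi_iff.mpr fun e' => ?_
  have h1 : Measurable fun q : SU2 × (E → Fin 3 → SU2) => q.2 e' :=
    (measurable_pi_apply e').comp measurable_snd
  have h2 : Measurable fun q : SU2 × (E → Fin 3 → SU2) => moveTriple p r q.1 (q.2 e') := by
    unfold moveTriple
    generalize (if r = p + 1 then p else r) = s
    exact Measurable.comp (g := Function.uncurry (shiftTriple s)) (measurable_shiftTriple s)
      (f := fun q : SU2 × (E → Fin 3 → SU2) => (q.1, q.2 e')) (measurable_fst.prodMk h1)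
  unfold moveAt
  by_cases he : e' = e
  · simp only [if_pos he]
    exact h2
  · simp only [if_neg he]
    exact h1

theorem measurePreserving_moveAt [Fintype E] (e : E) (p r : Fin 3) (h : SU2) :
    MeasurePreserving (moveAt e p r h) (Measure.pi fun _ => closureMeasure)
      (Measure.pi fun _ => closureMeasure) := by
  have := measurePreserving_pi (fun _ : E => closureMeasure) (fun _ : E => closureMeasure)
    (f := fun e' => if e' = e then moveTriple p r h else id) (fun e' => by
      split_ifs
      · exact measurePreserving_shiftTriple _ h
      · exact MeasurePreserving.id _)
  convert this using 1
  funext x e'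
  simp only [moveAt]
  split_ifs <;> rfl

end Configurations

theorem ord_ne : ∀ (i : Fin 4) (m : Fin 3), ord i m ≠ i := by decide

theorem exists_ord_eq : ∀ i c : Fin 4, c ≠ i → ∃ m, ord i m = c := by decide

theorem ord_injective (i : Fin 4) : Function.Injective (ord i) := by
  revert i; decide

theorem slot_injOn : ∀ c i j : Fin 4, i ≠ c → j ≠ c → slot c i = slot c j → i = j := by decide

/-! ### Holonomies -/

namespace ColoredGraph

variable {W B : Type*} (G : ColoredGraph W B)

/-- The line of colour `c` at a node. -/
def lineAt (n : W ⊕ B) (c : Fin 4) : Fin 4 × W := (c, Sum.elim id (G.line c).symm n)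

/-- The product of the variables `G^c_i` of the lines at a node `n`, that is the holonomy around
the vertex of colour `i` of a tetrahedron. -/
def holonomy {Γ : Type*} [Mul Γ] (k : (W ⊕ B) × Fin 4) (x : Fin 4 × W → Fin 3 → Γ) : Γ :=
  x (G.lineAt k.1 (ord k.2 0)) (slot (ord k.2 0) k.2)
    * x (G.lineAt k.1 (ord k.2 1)) (slot (ord k.2 1) k.2)
    * x (G.lineAt k.1 (ord k.2 2)) (slot (ord k.2 2) k.2)

theorem measurable_holonomy (k : (W ⊕ B) × Fin 4) :
    Measurable fun x : Fin 4 × W → Fin 3 → SU2 => G.holonomy k x := by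
  have h : ∀ (e : Fin 4 × W) (t : Fin 3),
      Measurable fun x : Fin 4 × W → Fin 3 → SU2 => x e t := fun e t =>
    (measurable_pi_apply t).comp (measurable_pi_apply e)
  exact ((h _ _).mul (h _ _)).mul (h _ _)

/-- A holonomy of index j involves only variables G^c_j, so a move of the entries i and r of a line
is felt only by kernels at its ends with index i or r. -/
theorem holonomy_moveAt_of_ne [DecidableEq W] {e : Fin 4 × W} {i r : Fin 4} (hi : i ≠ e.1)
    (hr : r ≠ e.1) (hir : i ≠ r) {k : (W ⊕ B) × Fin 4}
    (hk : G.lineAt k.1 e.1 = e → k.2 ≠ i ∧ k.2 ≠ r) (h : SU2) (x : Fin 4 × W → Fin 3 → SU2) :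
    G.holonomy k (moveAt e (slot e.1 i) (slot e.1 r) h x) = G.holonomy k x := by
  have hpr : slot e.1 i ≠ slot e.1 r := fun h => hir (slot_injOn _ _ _ hi hr h)
  have key : ∀ m, moveAt e (slot e.1 i) (slot e.1 r) h x (G.lineAt k.1 (ord k.2 m))
      (slot (ord k.2 m) k.2) = x (G.lineAt k.1 (ord k.2 m)) (slot (ord k.2 m) k.2) := by
    intro m
    unfold moveAt
    split_ifs with he
    · have hc : ord k.2 m = e.1 := congrArg Prod.fst he
      rw [hc] at he ⊢
      have hke : k.2 ≠ e.1 := hc ▸ (ord_ne k.2 m).symm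
      obtain ⟨h1, h2⟩ := hk he
      exact moveTriple_of_ne (fun h => h1 (slot_injOn _ _ _ hke hi h))
        (fun h => h2 (slot_injOn _ _ _ hke hr h)) hpr h _
    · rfl
  simp only [holonomy, key]

-- Exactly one of the three factors moves, so the holonomy becomes a·(h y)·b or a·(y h⁻¹)·b.
-- Two-sided invariance of the Haar measure absorbs everything else; the symmetry of F under
-- inversion handles h⁻¹.
open scoped ENNReal in
theorem lintegral_holonomy_moveAt [DecidableEq W] {F : SU2 → ℝ≥0∞} (hF : ∀ g, F g⁻¹ = F g)
    {e : Fin 4 × W} {k : (W ⊕ B) × Fin 4} {r : Fin 4} (hi : k.2 ≠ e.1) (hr : r ≠ e.1)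
    (hir : k.2 ≠ r) (hk : G.lineAt k.1 e.1 = e) (x : Fin 4 × W → Fin 3 → SU2) :
    ∫⁻ h, F (G.holonomy k (moveAt e (slot e.1 k.2) (slot e.1 r) h x)) ∂haarSU2
      = ∫⁻ g, F g ∂haarSU2 := by
  have hpr : slot e.1 k.2 ≠ slot e.1 r := fun h => hir (slot_injOn _ _ _ hi hr h)
  obtain ⟨m₀, hm₀⟩ := exists_ord_eq k.2 e.1 hi.symm
  have hoth : ∀ m, m ≠ m₀ → ∀ h, moveAt e (slot e.1 k.2) (slot e.1 r) h x
      (G.lineAt k.1 (ord k.2 m)) (slot (ord k.2 m) k.2)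
      = x (G.lineAt k.1 (ord k.2 m)) (slot (ord k.2 m) k.2) := by
    intro m hm h
    have : G.lineAt k.1 (ord k.2 m) ≠ e := fun he =>
      hm (ord_injective k.2 ((congrArg Prod.fst he).trans hm₀.symm))
    simp [moveAt, this]
  have hself : ∀ h, moveAt e (slot e.1 k.2) (slot e.1 r) h x
      (G.lineAt k.1 (ord k.2 m₀)) (slot (ord k.2 m₀) k.2)
      = moveTriple (slot e.1 k.2) (slot e.1 r) h (x e) (slot e.1 k.2) := by
    intro h
    rw [hm₀, hk]
    simp [moveAt]
  have hform : ∃ a b : SU2, ∀ h, G.holonomy k (moveAt e (slot e.1 k.2) (slot e.1 r) h x)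
      = a * moveTriple (slot e.1 k.2) (slot e.1 r) h (x e) (slot e.1 k.2) * b := by
    let v : Fin 3 → SU2 := fun m => x (G.lineAt k.1 (ord k.2 m)) (slot (ord k.2 m) k.2)
    fin_cases m₀
    · refine ⟨1, v 1 * v 2, fun h => ?_⟩
      rw [holonomy, hoth 1 (by decide), hoth 2 (by decide), one_mul, mul_assoc]
      exact congrArg (· * (v 1 * v 2)) (hself h)
    · refine ⟨v 0, v 2, fun h => ?_⟩
      rw [holonomy, hoth 0 (by decide), hoth 2 (by decide)]
      exact congrArg (fun y => v 0 * y * v 2) (hself h)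
    · refine ⟨v 0 * v 1, 1, fun h => ?_⟩
      rw [holonomy, hoth 0 (by decide), hoth 1 (by decide), mul_one]
      exact congrArg (v 0 * v 1 * ·) (hself h)
  obtain ⟨a, b, hab⟩ := hform
  simp_rw [hab]
  rcases moveTriple_self hpr with h1 | h1
  · simp_rw [h1]
    have : ∀ h : SU2, F (a * (x e (slot e.1 k.2) * h⁻¹) * b)
        = F (b⁻¹ * (h * ((x e (slot e.1 k.2))⁻¹ * a⁻¹))) := by
      intro h
      rw [← hF]
      congr 1
      group
    simp_rw [this]
    rw [lintegral_mul_right_eq_self (fun g => F (b⁻¹ * g)), lintegral_mul_left_eq_self F]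
  · simp_rw [h1]
    have : ∀ h : SU2, F (a * (h * x e (slot e.1 k.2)) * b)
        = F (a * (h * (x e (slot e.1 k.2) * b))) := by
      intro h
      congr 1
      group
    simp_rw [this]
    rw [lintegral_mul_right_eq_self (fun g => F (a * g)), lintegral_mul_left_eq_self F]

open scoped ENNReal in
/-- The kernels in `S` can be integrated out one after the other: the kernel `k` by means of the
variable `G^c_i` of the line of colour `c = col k` at its node, the variable `G^c_r`, `r = rem c`,
being determined by the closure constraint. -/
theorem lintegral_prod_holonomy [Fintype W] {R : Type*} [LinearOrder R]
    (S : Finset ((W ⊕ B) × Fin 4)) (col : (W ⊕ B) × Fin 4 → Fin 4) (rem : Fin 4 → Fin 4)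
    (rank : (W ⊕ B) × Fin 4 → R) (hrem : ∀ c, rem c ≠ c)
    (hcol : ∀ k ∈ S, k.2 ≠ col k ∧ k.2 ≠ rem (col k))
    (hrank : ∀ k ∈ S, ∀ k' ∈ S, k' ≠ k → G.lineAt k'.1 (col k) = G.lineAt k.1 (col k) →
      k'.2 = k.2 ∨ k'.2 = rem (col k) → rank k' < rank k)
    {F : SU2 → ℝ≥0∞} (hFm : Measurable F) (hF : ∀ g, F g⁻¹ = F g) :
    ∫⁻ x : Fin 4 × W → Fin 3 → SU2, ∏ k ∈ S, F (G.holonomy k x)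
      ∂(Measure.pi fun _ => closureMeasure) = (∫⁻ g, F g ∂haarSU2) ^ S.card := by
  classical
  refine lintegral_prod_eq_pow_card _ haarSU2 rank (fun k x => F (G.holonomy k x))
    (fun k => moveAt (G.lineAt k.1 (col k)) (slot (col k) k.2) (slot (col k) (rem (col k))))
    _ S (fun k _ => hFm.comp (G.measurable_holonomy k)) (fun k _ => measurable_moveAt _ _ _)
    (fun k _ h => measurePreserving_moveAt _ _ _ h) (fun k hk x => ?_) ?_
  · exact G.lintegral_holonomy_moveAt hF (e := G.lineAt k.1 (col k)) (hcol k hk).1 (hrem _)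
      (hcol k hk).2 rfl x
  · intro k hk k' hk' hne hle h x
    refine congrArg F ?_
    refine G.holonomy_moveAt_of_ne (e := G.lineAt k.1 (col k)) (hcol k hk).1 (hrem _)
      (hcol k hk).2 (fun hline => ?_) h x
    by_contra hcon
    rw [not_and_or, not_not, not_not] at hcon
    exact absurd (hrank k hk k' hk' hne hline hcon) (not_lt.mpr hle)

end ColoredGraph

/-! ### Power counting -/

namespace ColoredGraph

variable {W B : Type*} [Fintype W] [Fintype B] (G : ColoredGraph W B)

/-- The measure on the configurations of line variables. -/
abbrev configMeasure (W : Type*) [Fintype W] : Measure (Fin 4 × W → Fin 3 → SU2) :=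
  Measure.pi fun _ => closureMeasure

/-- Each node carries 1/K_α(1) from the interaction and 1/√K_α(1) from the rescaling, whence the
exponent 3/2. -/
theorem amplitude_eq {α : ℝ} (hα : 0 < α) : G.amplitude α =
    (∫ x, ∏ k, heatKernel α (G.holonomy k x) ∂configMeasure W) *
      heatKernel α 1 ^ (-(3 / 2 * (Fintype.card (W ⊕ B) : ℝ))) := by
  have hK := heatKernel_one_pos hα
  have h1 : ∀ (n : W ⊕ B) (x : Fin 4 × W → Fin 3 → SU2),
      nodeKernel α (fun c => x (G.lineAt n c))
        = (∏ i, heatKernel α (G.holonomy (n, i) x)) / heatKernel α 1 := fun n x => rfl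
  have h2 : G.bareAmplitude α = (∫ x, ∏ k, heatKernel α (G.holonomy k x) ∂configMeasure W)
      / heatKernel α 1 ^ Fintype.card (W ⊕ B) := by
    rw [bareAmplitude, ← integral_div]
    congr 1
    funext x
    rw [Fintype.prod_prod_type, Fintype.prod_sum_type, Fintype.card_sum, pow_add,
      mul_div_mul_comm, ← Finset.card_univ, ← Finset.card_univ, ← Finset.prod_const,
      ← Finset.prod_const, ← Finset.prod_div_distrib, ← Finset.prod_div_distrib]
    rfl
  rw [amplitude, h2, div_div, div_eq_mul_inv]
  congr 1
  rw [← Fintype.card_sum, Real.sqrt_eq_rpow, ← Real.rpow_natCast, ← Real.rpow_natCast,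
    ← Real.rpow_mul hK.le, ← Real.rpow_add hK, Real.rpow_neg hK.le]
  congr 2
  ring

theorem ofReal_integral_prod_heatKernel {α : ℝ} (hα : 0 < α) :
    ENNReal.ofReal (∫ x, ∏ k, heatKernel α (G.holonomy k x) ∂configMeasure W)
      = ∫⁻ x, ∏ k, ENNReal.ofReal (heatKernel α (G.holonomy k x)) ∂configMeasure W := by
  have hm : Measurable fun x => ∏ k, heatKernel α (G.holonomy k x) :=
    Finset.measurable_fun_prod _ fun k _ =>
      (continuous_heatKernel hα).measurable.comp (G.measurable_holonomy k)
  have hb : ∀ x, ∏ k, heatKernel α (G.holonomy k x)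
      ≤ ∏ _k : (W ⊕ B) × Fin 4, heatKernel α 1 := fun x =>
    Finset.prod_le_prod (fun k _ => heatKernel_nonneg hα _) fun k _ => heatKernel_le hα _
  have h0 : ∀ x, 0 ≤ ∏ k, heatKernel α (G.holonomy k x) := fun x =>
    Finset.prod_nonneg fun k _ => heatKernel_nonneg hα _
  rw [ofReal_integral_eq_lintegral_ofReal
    (Integrable.of_bound hm.aestronglyMeasurable (∏ _k : (W ⊕ B) × Fin 4, heatKernel α 1)
      (Eventually.of_forall fun x => by rw [Real.norm_of_nonneg (h0 x)]; exact hb x))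
    (Eventually.of_forall h0)]
  exact lintegral_congr fun x => ENNReal.ofReal_prod_of_nonneg fun k _ => heatKernel_nonneg hα _

theorem integral_prod_heatKernel_nonneg {α : ℝ} (hα : 0 < α) :
    0 ≤ ∫ x, ∏ k, heatKernel α (G.holonomy k x) ∂configMeasure W :=
  integral_nonneg fun _ => Finset.prod_nonneg fun _ _ => heatKernel_nonneg hα _

theorem amplitude_nonneg {α : ℝ} (hα : 0 < α) : 0 ≤ G.amplitude α := by
  rw [G.amplitude_eq hα]
  exact mul_nonneg (G.integral_prod_heatKernel_nonneg hα)
    (Real.rpow_nonneg (heatKernel_one_pos hα).le _)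

/-- An elimination scheme: the kernels in `S` can be integrated out one after the other, the
kernel `k` by means of the line of colour `col k` at its node. When it is modified, the entry
`rem c` of a line of colour `c` is adjusted so as to preserve the closure constraint. -/
structure Elimination {W B : Type*} (G : ColoredGraph W B) (S : Finset ((W ⊕ B) × Fin 4)) where
  R : Type
  [order : LinearOrder R]
  col : (W ⊕ B) × Fin 4 → Fin 4
  rem : Fin 4 → Fin 4
  rank : (W ⊕ B) × Fin 4 → R
  rem_ne : ∀ c, rem c ≠ c
  col_ne : ∀ k ∈ S, k.2 ≠ col k ∧ k.2 ≠ rem (col k)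
  rank_lt : ∀ k ∈ S, ∀ k' ∈ S, k' ≠ k → G.lineAt k'.1 (col k) = G.lineAt k.1 (col k) →
      k'.2 = k.2 ∨ k'.2 = rem (col k) → rank k' < rank k

variable {G} {S : Finset ((W ⊕ B) × Fin 4)}

open scoped ENNReal in
theorem Elimination.lintegral_eq {W B : Type*} [Fintype W] {G : ColoredGraph W B}
    {S : Finset ((W ⊕ B) × Fin 4)} (d : G.Elimination S) {F : SU2 → ℝ≥0∞} (hFm : Measurable F)
    (hF : ∀ g, F g⁻¹ = F g) :
    ∫⁻ x, ∏ k ∈ S, F (G.holonomy k x) ∂configMeasure W = (∫⁻ g, F g ∂haarSU2) ^ S.card :=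
  letI := d.order
  G.lintegral_prod_holonomy S d.col d.rem d.rank d.rem_ne d.col_ne d.rank_lt hFm hF

theorem heatKernel_inv (α : ℝ) (g : SU2) : heatKernel α g⁻¹ = heatKernel α g :=
  heatKernel_congr α (coord_zero_inv g)

/-- Kernels outside S are replaced by their maximum K_α(1); those in S are then integrated out, each
contributing ∫ K_α = 1. -/
theorem Elimination.integral_le (d : G.Elimination S) {α : ℝ} (hα : 0 < α) :
    ∫ x, ∏ k, heatKernel α (G.holonomy k x) ∂configMeasure W
      ≤ heatKernel α 1 ^ (Fintype.card ((W ⊕ B) × Fin 4) - S.card) := by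
  classical
  have hK := (heatKernel_one_pos hα).le
  have hcont := continuous_heatKernel hα
  rw [← ENNReal.ofReal_le_ofReal_iff (pow_nonneg hK _), G.ofReal_integral_prod_heatKernel hα]
  have hint : ∫⁻ g, ENNReal.ofReal (heatKernel α g) ∂haarSU2 = 1 := by
    rw [← ofReal_integral_eq_lintegral_ofReal (integrable_of_continuous hcont)
      (Eventually.of_forall fun g => heatKernel_nonneg hα g), integral_heatKernel hα,
      ENNReal.ofReal_one]
  have hS := d.lintegral_eq (F := fun g => ENNReal.ofReal (heatKernel α g))
    hcont.measurable.ennreal_ofReal (fun g => by rw [heatKernel_inv])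
  rw [hint, one_pow] at hS
  have hm : Measurable fun x : Fin 4 × W → Fin 3 → SU2 =>
      ∏ k ∈ S, ENNReal.ofReal (heatKernel α (G.holonomy k x)) :=
    Finset.measurable_fun_prod _ fun k _ =>
      (hcont.measurable.comp (G.measurable_holonomy k)).ennreal_ofReal
  calc ∫⁻ x, ∏ k, ENNReal.ofReal (heatKernel α (G.holonomy k x)) ∂configMeasure W
      ≤ ∫⁻ x, (∏ k ∈ S, ENNReal.ofReal (heatKernel α (G.holonomy k x))) *
          ENNReal.ofReal (heatKernel α 1) ^ (Sᶜ).card ∂configMeasure W := by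
        refine lintegral_mono fun x => ?_
        rw [← Finset.prod_mul_prod_compl S, ← Finset.prod_const]
        exact mul_le_mul' le_rfl (Finset.prod_le_prod' fun k _ =>
          ENNReal.ofReal_le_ofReal (heatKernel_le hα _))
    _ = ENNReal.ofReal (heatKernel α 1 ^ (Fintype.card ((W ⊕ B) × Fin 4) - S.card)) := by
        rw [lintegral_mul_const _ hm, hS, one_mul, Finset.card_compl, ENNReal.ofReal_pow hK]

theorem rpow_exponent {α : ℝ} (hα : 0 < α) (S : Finset ((W ⊕ B) × Fin 4)) :
    heatKernel α 1 ^ (Fintype.card ((W ⊕ B) × Fin 4) - S.card) *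
      heatKernel α 1 ^ (-(3 / 2 * (Fintype.card (W ⊕ B) : ℝ)))
    = heatKernel α 1 ^ (5 / 2 * (Fintype.card (W ⊕ B) : ℝ) - S.card) := by
  have hK := heatKernel_one_pos hα
  rw [← Real.rpow_natCast, ← Real.rpow_add hK, Nat.cast_sub (Finset.card_le_univ S),
    Fintype.card_prod, Fintype.card_fin]
  congr 1
  push_cast
  ring

theorem Elimination.amplitude_le (d : G.Elimination S) {α : ℝ} (hα : 0 < α) :
    G.amplitude α ≤ heatKernel α 1 ^ (5 / 2 * (Fintype.card (W ⊕ B) : ℝ) - S.card) := by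
  rw [G.amplitude_eq hα, ← rpow_exponent hα S]
  exact mul_le_mul_of_nonneg_right (d.integral_le hα)
    (Real.rpow_nonneg (heatKernel_one_pos hα).le _)

/-! ### From power bounds on the amplitude to the divergence degree. -/

theorem divergenceDegree_le {D : ℝ}
    (h : ∀ α : ℝ, 0 < α → G.amplitude α ≤ heatKernel α 1 ^ D) : G.divergenceDegree ≤ (D : EReal) := by
  -- Each real γ > D is admissible with limit 0; admissibility of D itself is not claimed and not
  -- needed for the infimum.
  refine EReal.le_of_forall_lt_iff_le.mp fun γ hγ => ?_
  have hγ' : D < γ := EReal.coe_lt_coe_iff.mp hγ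
  refine sInf_le ⟨γ, rfl, 0, ?_⟩
  have hlim : Tendsto (fun α : ℝ => heatKernel α 1 ^ (-(γ - D))) (𝓝[>] 0) (𝓝 0) :=
    (tendsto_rpow_neg_atTop (sub_pos.mpr hγ')).comp tendsto_heatKernel_one
  refine squeeze_zero' ?_ ?_ hlim
  · filter_upwards [self_mem_nhdsWithin] with α hα
    exact mul_nonneg (Real.rpow_nonneg (heatKernel_one_pos hα).le _) (G.amplitude_nonneg hα)
  · filter_upwards [self_mem_nhdsWithin] with α hα
    have hK := heatKernel_one_pos hα
    calc heatKernel α 1 ^ (-γ) * G.amplitude α ≤ heatKernel α 1 ^ (-γ) * heatKernel α 1 ^ D :=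
          mul_le_mul_of_nonneg_left (h α hα) (Real.rpow_nonneg hK.le _)
      _ = _ := by rw [← Real.rpow_add hK]; congr 1; ring

theorem le_divergenceDegree {D c : ℝ} (hc : 0 < c)
    (h : ∀ᶠ α in 𝓝[>] (0 : ℝ), c * heatKernel α 1 ^ D ≤ G.amplitude α) :
    (D : EReal) ≤ G.divergenceDegree := by
  refine le_sInf ?_
  rintro _ ⟨γ, rfl, L, hL⟩
  rw [EReal.coe_le_coe_iff]
  by_contra hlt
  rw [not_le] at hlt
  have hlim : Tendsto (fun α : ℝ => c * heatKernel α 1 ^ (D - γ)) (𝓝[>] 0) atTop :=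
    ((tendsto_rpow_atTop (sub_pos.mpr hlt)).comp tendsto_heatKernel_one).const_mul_atTop hc
  have hlim' : Tendsto (fun α : ℝ => heatKernel α 1 ^ (-γ) * G.amplitude α) (𝓝[>] 0) atTop := by
    refine tendsto_atTop_mono' _ ?_ hlim
    filter_upwards [h, self_mem_nhdsWithin] with α h1 hα
    have hK := heatKernel_one_pos hα
    calc c * heatKernel α 1 ^ (D - γ) = heatKernel α 1 ^ (-γ) * (c * heatKernel α 1 ^ D) := by
          rw [mul_left_comm, ← Real.rpow_add hK]; congr 2; ring
      _ ≤ _ := mul_le_mul_of_nonneg_left h1 (Real.rpow_nonneg hK.le _)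
  exact not_tendsto_nhds_of_tendsto_atTop hlim' L hL

/-- The closure constraint on all the lines. -/
def IsClosedConfig {W Γ : Type*} [Mul Γ] [One Γ] (x : Fin 4 × W → Fin 3 → Γ) : Prop :=
  ∀ e, x e 0 * x e 1 * x e 2 = 1

theorem ae_isClosedConfig : ∀ᵐ x ∂configMeasure W, IsClosedConfig x := by
  have h1 : ∀ᵐ y ∂closureMeasure, y 0 * y 1 * y 2 = 1 := by
    have hm : MeasurableSet {y : Fin 3 → SU2 | y 0 * y 1 * y 2 = 1} :=
      measurableSet_eq_fun (((measurable_pi_apply 0).mul (measurable_pi_apply 1)).mul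
        (measurable_pi_apply 2)) measurable_const
    rw [closureMeasure, ae_map_iff measurable_closedTriple.aemeasurable hm]
    exact Eventually.of_forall fun p => by simp [closedTriple]
  refine ae_all_iff.mpr fun e => ?_
  exact (Measure.tendsto_eval_ae_ae (μ := fun _ : Fin 4 × W => closureMeasure) (i := e)).eventually h1

/-- Restrict to configurations whose kept holonomies lie in the ball gap ≤ 3α. There the other
holonomies have gap at most 3Cα, so their kernels are comparable with K_α(1), while the truncated
kept kernels can still be eliminated exactly and give at least 1/2 each. -/
theorem Elimination.integral_ge (d : G.Elimination S) {C : ℝ}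
    (hC : ∀ ε : ℝ, 0 ≤ ε → ∀ x : Fin 4 × W → Fin 3 → SU2, IsClosedConfig x →
      (∀ k ∈ S, gap (G.holonomy k x) ≤ ε) → ∀ k, gap (G.holonomy k x) ≤ C * ε)
    {α : ℝ} (hα : 0 < α) (hα2 : α ≤ 2) (hCα : 3 * C * α ≤ 1) :
    (Real.exp (-(8 * (3 * C))) * heatKernel α 1) ^ (Fintype.card ((W ⊕ B) × Fin 4) - S.card)
      * (1 / 2) ^ S.card ≤ ∫ x, ∏ k, heatKernel α (G.holonomy k x) ∂configMeasure W := by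
  classical
  have hK := (heatKernel_one_pos hα).le
  have hcont := continuous_heatKernel hα
  have hcK : 0 ≤ Real.exp (-(8 * (3 * C))) * heatKernel α 1 := mul_nonneg (Real.exp_pos _).le hK
  have hms : MeasurableSet {g : SU2 | gap g ≤ 3 * α} :=
    (isClosed_le continuous_gap continuous_const).measurableSet
  let F : SU2 → ENNReal :=
    {g | gap g ≤ 3 * α}.indicator fun g => ENNReal.ofReal (heatKernel α g)
  have hFm : Measurable F := hcont.measurable.ennreal_ofReal.indicator hms
  have hF : ∀ g, F g⁻¹ = F g := fun g => by
    simp only [F, Set.indicator, Set.mem_ofPred_eq, gap_inv, heatKernel_inv]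
  have hFint : ENNReal.ofReal (1 / 2) ≤ ∫⁻ g, F g ∂haarSU2 := by
    rw [lintegral_indicator hms, ← ofReal_integral_eq_lintegral_ofReal
      (integrable_of_continuous hcont).integrableOn
      (Eventually.of_forall fun g => heatKernel_nonneg hα g)]
    exact ENNReal.ofReal_le_ofReal (half_le_setIntegral_heatKernel hα)
  have hm : Measurable fun x : Fin 4 × W → Fin 3 → SU2 => ∏ k ∈ S, F (G.holonomy k x) :=
    Finset.measurable_fun_prod _ fun k _ => hFm.comp (G.measurable_holonomy k)
  rw [← ENNReal.ofReal_le_ofReal_iff (G.integral_prod_heatKernel_nonneg hα),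
    G.ofReal_integral_prod_heatKernel hα, ENNReal.ofReal_mul (pow_nonneg hcK _),
    ENNReal.ofReal_pow hcK, ENNReal.ofReal_pow (by norm_num), ← Finset.card_compl]
  calc ENNReal.ofReal (Real.exp (-(8 * (3 * C))) * heatKernel α 1) ^ (Sᶜ).card
        * ENNReal.ofReal (1 / 2) ^ S.card
      ≤ ENNReal.ofReal (Real.exp (-(8 * (3 * C))) * heatKernel α 1) ^ (Sᶜ).card
        * ∫⁻ x, ∏ k ∈ S, F (G.holonomy k x) ∂configMeasure W := by
        rw [d.lintegral_eq hFm hF]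
        gcongr
    _ = ∫⁻ x, ENNReal.ofReal (Real.exp (-(8 * (3 * C))) * heatKernel α 1) ^ (Sᶜ).card
        * ∏ k ∈ S, F (G.holonomy k x) ∂configMeasure W := (lintegral_const_mul _ hm).symm
    _ ≤ ∫⁻ x, ∏ k, ENNReal.ofReal (heatKernel α (G.holonomy k x)) ∂configMeasure W := by
        refine lintegral_mono_ae ?_
        filter_upwards [ae_isClosedConfig] with x hx
        by_cases hnear : ∀ k ∈ S, gap (G.holonomy k x) ≤ 3 * α
        · have hall := hC (3 * α) (by positivity) x hx hnear
          rw [← Finset.prod_mul_prod_compl S, mul_comm, ← Finset.prod_const]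
          refine mul_le_mul' (Finset.prod_le_prod' fun k _ => Set.indicator_le_self _ _ _)
            (Finset.prod_le_prod' fun k _ => ENNReal.ofReal_le_ofReal ?_)
          exact heatKernel_ge_of_gap_le hα hα2 hCα (by linarith [hall k])
        · push Not at hnear
          obtain ⟨k, hk, hlt⟩ := hnear
          rw [Finset.prod_eq_zero hk, mul_zero]
          · exact zero_le
          · exact Set.indicator_of_notMem (by simpa using hlt) _

theorem Elimination.le_divergenceDegree (d : G.Elimination S) {C : ℝ}
    (hC : ∀ ε : ℝ, 0 ≤ ε → ∀ x : Fin 4 × W → Fin 3 → SU2, IsClosedConfig x →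
      (∀ k ∈ S, gap (G.holonomy k x) ≤ ε) → ∀ k, gap (G.holonomy k x) ≤ C * ε) :
    ((5 / 2 * (Fintype.card (W ⊕ B) : ℝ) - S.card : ℝ) : EReal) ≤ G.divergenceDegree := by
  set m := Fintype.card ((W ⊕ B) × Fin 4) - S.card with hm
  refine ColoredGraph.le_divergenceDegree
    (c := Real.exp (-(8 * (3 * C))) ^ m * (1 / 2) ^ S.card) (by positivity) ?_
  have h1 : ∀ᶠ α in 𝓝[>] (0 : ℝ), 3 * C * α < 1 := by
    have : Tendsto (fun α : ℝ => 3 * C * α) (𝓝[>] 0) (𝓝 (3 * C * 0)) :=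
      ((continuous_const.mul continuous_id).tendsto 0).mono_left nhdsWithin_le_nhds
    rw [mul_zero] at this
    exact this.eventually (gt_mem_nhds one_pos)
  have h2 : ∀ᶠ α in 𝓝[>] (0 : ℝ), α < 2 := nhdsWithin_le_nhds (gt_mem_nhds two_pos)
  filter_upwards [h1, h2, self_mem_nhdsWithin] with α h1 h2 hα
  have hge := d.integral_ge hC hα h2.le h1.le
  rw [G.amplitude_eq hα, ← rpow_exponent hα S, ← mul_assoc]
  refine mul_le_mul_of_nonneg_right (le_trans (le_of_eq ?_) hge)
    (Real.rpow_nonneg (heatKernel_one_pos hα).le _)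
  rw [mul_pow]
  ring

end ColoredGraph

/-! ### The elimination scheme attached to the bubbles of a given colour -/

theorem exists_adj_dist_lt {V : Type*} {H : SimpleGraph V} {x r : V} (h : H.Reachable x r)
    (hne : x ≠ r) : ∃ y, H.Adj x y ∧ H.dist y r < H.dist x r := by
  obtain ⟨p, hp⟩ := h.exists_walk_length_eq_dist
  cases p with
  | nil => exact absurd rfl hne
  | cons hadj q =>
    refine ⟨_, hadj, ?_⟩
    rw [← hp, SimpleGraph.Walk.length_cons]
    exact Nat.lt_succ_of_le (SimpleGraph.dist_le q)

namespace ColoredGraph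

variable {W B : Type*} (G : ColoredGraph W B)

theorem lineAt_inl (w : W) (c : Fin 4) : G.lineAt (Sum.inl w) c = (c, w) := rfl

theorem lineAt_inr_line (w : W) (c : Fin 4) : G.lineAt (Sum.inr (G.line c w)) c = (c, w) := by
  simp [lineAt]

theorem restrict_adj_iff {S : Set (Fin 4)} {x y : W ⊕ B} :
    (G.restrict S).Adj x y ↔ x ≠ y ∧ ∃ c ∈ S, G.lineAt x c = G.lineAt y c := by
  rw [restrict, SimpleGraph.fromRel_adj]
  refine and_congr_right fun hne => ⟨?_, ?_⟩
  · rintro (⟨c, hc, w, rfl, rfl⟩ | ⟨c, hc, w, rfl, rfl⟩)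
    · exact ⟨c, hc, (G.lineAt_inr_line w c).symm⟩
    · exact ⟨c, hc, G.lineAt_inr_line w c⟩
  · rintro ⟨c, hc, h⟩
    have h2 : Sum.elim id (G.line c).symm x = Sum.elim id (G.line c).symm y :=
      congrArg Prod.snd h
    rcases x with w | b <;> rcases y with w' | b'
    · exact absurd (congrArg Sum.inl h2) hne
    · exact Or.inl ⟨c, hc, w, rfl, by
        simp only [Sum.elim_inl, Sum.elim_inr, id] at h2; rw [h2, Equiv.apply_symm_apply]⟩
    · exact Or.inr ⟨c, hc, w', rfl, by
        simp only [Sum.elim_inl, Sum.elim_inr, id] at h2; rw [← h2, Equiv.apply_symm_apply]⟩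
    · exact absurd (congrArg Sum.inr ((G.line c).symm.injective h2)) hne

/-- A line has only two ends. This pins down the single other kernel that a move can disturb. -/
theorem eq_or_eq_of_lineAt_eq {x y z : W ⊕ B} {c : Fin 4} (hxy : x ≠ y)
    (h : G.lineAt x c = G.lineAt y c) (hz : G.lineAt z c = G.lineAt x c) : z = x ∨ z = y := by
  have h2 : Sum.elim id (G.line c).symm x = Sum.elim id (G.line c).symm y := congrArg Prod.snd h
  have h3 : Sum.elim id (G.line c).symm z = Sum.elim id (G.line c).symm x := congrArg Prod.snd hz
  rcases x with x | x <;> rcases y with y | y <;> rcases z with z | z <;>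
    simp only [Sum.elim_inl, Sum.elim_inr, id] at h2 h3
  · exact Or.inl (congrArg _ h3)
  · exact absurd (congrArg _ h2) hxy
  · exact Or.inl (congrArg _ h3)
  · exact Or.inr (congrArg _ ((G.line c).symm.injective (h3.trans h2)))
  · exact Or.inr (congrArg _ (h3.trans h2))
  · exact Or.inl (congrArg _ ((G.line c).symm.injective h3))
  · exact absurd (congrArg _ ((G.line c).symm.injective h2)) hxy
  · exact Or.inl (congrArg _ ((G.line c).symm.injective h3))

theorem restrict_mono {S T : Set (Fin 4)} (h : S ⊆ T) : G.restrict S ≤ G.restrict T := by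
  intro x y
  rw [restrict_adj_iff, restrict_adj_iff]
  exact fun ⟨hne, c, hc, he⟩ => ⟨hne, c, h hc, he⟩

theorem reachable_of_lineAt_eq {S : Set (Fin 4)} {x y : W ⊕ B} {c : Fin 4} (hc : c ∈ S)
    (h : G.lineAt x c = G.lineAt y c) : (G.restrict S).Reachable x y := by
  by_cases hxy : x = y
  · rw [hxy]
  · exact (G.restrict_adj_iff.mpr ⟨hxy, c, hc, h⟩).reachable

/-- The bubble of colour `ℓ` of a node. -/
def bubbleOf (ℓ : Fin 4) (n : W ⊕ B) : G.Bubble ℓ := (G.restrict {ℓ}ᶜ).connectedComponentMk n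

/-- The vertex of colour `i` of the bubble of colour `ℓ` of a node. -/
def cycleOf (ℓ i : Fin 4) (n : W ⊕ B) : (G.restrict {ℓ, i}ᶜ).ConnectedComponent :=
  (G.restrict {ℓ, i}ᶜ).connectedComponentMk n

theorem compl_pair_subset (ℓ i : Fin 4) : ({ℓ, i}ᶜ : Set (Fin 4)) ⊆ {ℓ}ᶜ :=
  Set.compl_subset_compl.mpr (Set.singleton_subset_iff.mpr (Set.mem_insert _ _))

theorem bubbleOf_eq_of_cycleOf_eq {ℓ i : Fin 4} {m n : W ⊕ B}
    (h : G.cycleOf ℓ i m = G.cycleOf ℓ i n) : G.bubbleOf ℓ m = G.bubbleOf ℓ n :=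
  SimpleGraph.ConnectedComponent.sound ((SimpleGraph.ConnectedComponent.exact h).mono
    (G.restrict_mono (compl_pair_subset ℓ i)))

/-- Base nodes and roots: a base node for every bubble of colour `ℓ`, and a root for every vertex of
these bubbles, such that the base node of a bubble is the root of the vertices that contain it. -/
structure Rooting (ℓ : Fin 4) where
  depth : W ⊕ B → ℕ
  top : G.Bubble ℓ
  base : G.Bubble ℓ → W ⊕ B
  root : ∀ i, (G.restrict {ℓ, i}ᶜ).ConnectedComponent → W ⊕ B
  bubbleOf_base : ∀ b, G.bubbleOf ℓ (base b) = b
  depth_base_le : ∀ n, depth (base (G.bubbleOf ℓ n)) ≤ depth n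
  exists_parent : ∀ b, b ≠ top → ∃ m, m ≠ base b ∧
    G.lineAt (base b) ℓ = G.lineAt m ℓ ∧ depth m < depth (base b)
  cycleOf_root : ∀ i v, G.cycleOf ℓ i (root i v) = v
  root_base : ∀ i b, root i (G.cycleOf ℓ i (base b)) = base b

variable {G}

/-- Depth is the distance to a fixed node x₀, and the base of a bubble is one of its nodes closest
to x₀. The next node on a geodesic from the base to x₀ then lies outside the bubble. Roots are
arbitrary, except that a cycle through the base is rooted there. -/
theorem Connected.exists_rooting (hG : G.Connected) (ℓ : Fin 4) : Nonempty (G.Rooting ℓ) := by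
  classical
  obtain ⟨x₀⟩ := hG.nonempty
  let D : W ⊕ B → ℕ := fun n => (G.restrict Set.univ).dist n x₀
  have hbase : ∀ b : G.Bubble ℓ, ∃ n, G.bubbleOf ℓ n = b ∧ ∀ m, G.bubbleOf ℓ m = b → D n ≤ D m := by
    intro b
    obtain ⟨n₀, hn₀⟩ := b.exists_rep
    obtain ⟨n, hn, hmin⟩ := WellFounded.has_min (measure D).wf {n | G.bubbleOf ℓ n = b} ⟨n₀, hn₀⟩
    exact ⟨n, hn, fun m hm => not_lt.mp (hmin m hm)⟩
  choose base hb1 hb2 using hbase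
  have hroot : ∀ i v, ∃ r, G.cycleOf ℓ i r = v ∧
      (G.cycleOf ℓ i (base (G.bubbleOf ℓ r)) = v → r = base (G.bubbleOf ℓ r)) := by
    intro i v
    obtain ⟨m, rfl⟩ := v.exists_rep
    by_cases h : G.cycleOf ℓ i (base (G.bubbleOf ℓ m)) = G.cycleOf ℓ i m
    · exact ⟨_, h, fun _ => by rw [hb1]⟩
    · exact ⟨m, rfl, fun h' => absurd h' h⟩
  choose root hr1 hr2 using hroot
  refine ⟨⟨D, G.bubbleOf ℓ x₀, base, root, hb1, fun n => hb2 _ n rfl, fun b hb => ?_, hr1,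
    fun i b => ?_⟩⟩
  · have hne : base b ≠ x₀ := fun h => hb (by rw [← h, hb1])
    obtain ⟨m, hadj, hlt⟩ := exists_adj_dist_lt (hG.preconnected (base b) x₀) hne
    obtain ⟨hne', c, -, hc⟩ := G.restrict_adj_iff.mp hadj
    -- A line of another colour would stay in the bubble and contradict the minimality of the base.
    have hcℓ : c = ℓ := by
      by_contra hcℓ
      have : G.bubbleOf ℓ m = b := by
        rw [← hb1 b]
        exact SimpleGraph.ConnectedComponent.sound
          (G.reachable_of_lineAt_eq (S := {ℓ}ᶜ) hcℓ hc.symm)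
      exact absurd (hb2 b m this) (not_le.mpr hlt)
    subst hcℓ
    exact ⟨m, hne'.symm, hc, hlt⟩
  · have h1 := G.bubbleOf_eq_of_cycleOf_eq (hr1 i (G.cycleOf ℓ i (base b)))
    rw [hb1] at h1
    have h2 := hr2 i (G.cycleOf ℓ i (base b))
    rw [h1] at h2
    exact h2 rfl

namespace Rooting

variable {ℓ : Fin 4} (ρ : G.Rooting ℓ)

/-- The root of the vertex of colour `i` of the bubble of a node. -/
def rootOf (i : Fin 4) (n : W ⊕ B) : W ⊕ B := ρ.root i (G.cycleOf ℓ i n)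

theorem exists_step {k : (W ⊕ B) × Fin 4} (hk : k.1 ≠ ρ.rootOf k.2 k.1) : ∃ (c : Fin 4) (m : W ⊕ B),
    c ≠ ℓ ∧ c ≠ k.2 ∧ k.1 ≠ m ∧ G.lineAt k.1 c = G.lineAt m c ∧
    G.cycleOf ℓ k.2 m = G.cycleOf ℓ k.2 k.1 ∧
    (G.restrict {ℓ, k.2}ᶜ).dist m (ρ.rootOf k.2 k.1)
      < (G.restrict {ℓ, k.2}ᶜ).dist k.1 (ρ.rootOf k.2 k.1) := by
  have hreach : (G.restrict {ℓ, k.2}ᶜ).Reachable k.1 (ρ.rootOf k.2 k.1) :=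
    (SimpleGraph.ConnectedComponent.exact (ρ.cycleOf_root k.2 (G.cycleOf ℓ k.2 k.1))).symm
  obtain ⟨m, hadj, hlt⟩ := exists_adj_dist_lt hreach hk
  obtain ⟨hne, c, hc, hl⟩ := G.restrict_adj_iff.mp hadj
  simp only [Set.mem_compl_iff, Set.mem_insert_iff, Set.mem_singleton_iff, not_or] at hc
  exact ⟨c, m, hc.1, hc.2, hne, hl,
    SimpleGraph.ConnectedComponent.sound hadj.reachable.symm, hlt⟩

open Classical in
/-- The colour of the line used to integrate out a kernel: the line which leads towards the root of
the vertex, or the line of colour `ℓ` at the base node of a bubble. -/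
def col (k : (W ⊕ B) × Fin 4) : Fin 4 :=
  if hk : k.1 ≠ ρ.rootOf k.2 k.1 then (ρ.exists_step hk).choose else ℓ

/-- The order in which the kernels are integrated out. -/
def rank (k : (W ⊕ B) × Fin 4) : Lex (ℕ × ℕ) :=
  toLex (ρ.depth (ρ.base (G.bubbleOf ℓ k.1)),
    (G.restrict {ℓ, k.2}ᶜ).dist k.1 (ρ.rootOf k.2 k.1))

/-- A kernel which is integrated out by moving towards the root of its vertex. -/
def IsInner (k : (W ⊕ B) × Fin 4) : Prop := k.2 ≠ ℓ ∧ k.1 ≠ ρ.rootOf k.2 k.1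

/-- A kernel at a base node which is integrated out by means of its line of colour `ℓ`. -/
def IsOuter (κ : Fin 4) (k : (W ⊕ B) × Fin 4) : Prop :=
  k.2 ≠ ℓ ∧ k.2 ≠ κ ∧ G.bubbleOf ℓ k.1 ≠ ρ.top ∧ k.1 = ρ.base (G.bubbleOf ℓ k.1)

theorem eq_rootOf_base {k : (W ⊕ B) × Fin 4} (h : k.1 = ρ.base (G.bubbleOf ℓ k.1)) (i : Fin 4) :
    k.1 = ρ.rootOf i k.1 := by
  rw [rootOf]
  conv_rhs => rw [h, ρ.root_base]
  exact h

variable [Fintype W] [Fintype B]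

open Classical in
/-- The kernels which are integrated out. -/
def kept (κ : Fin 4) : Finset ((W ⊕ B) × Fin 4) :=
  Finset.univ.filter fun k => ρ.IsInner k ∨ ρ.IsOuter κ k

open Classical in
/-- The elimination scheme attached to the bubbles of colour `ℓ`. -/
def elimination {κ : Fin 4} (hκ : κ ≠ ℓ) : G.Elimination (ρ.kept κ) where
  R := Lex (ℕ × ℕ)
  col := ρ.col
  -- Kernels of index ℓ are never kept, so G^c_ℓ is free to restore closure when c ≠ ℓ. A line of
  -- colour ℓ has no such variable: the index κ is sacrificed, leaving two kernels per base node.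
  rem c := if c = ℓ then κ else ℓ
  rank := ρ.rank
  rem_ne c := by
    split_ifs with h
    · rwa [h]
    · exact Ne.symm h
  col_ne k hk := by
    simp only [kept, Finset.mem_filter, Finset.mem_univ, true_and] at hk
    rcases hk with ⟨h1, h2⟩ | ⟨h1, h2, h3, h4⟩
    · obtain ⟨m, hc, hck, -⟩ := (ρ.exists_step h2).choose_spec
      rw [col, dif_pos h2, if_neg hc]
      exact ⟨hck.symm, h1⟩
    · rw [col, dif_neg (not_not.mpr (ρ.eq_rootOf_base h4 _)), if_pos rfl]
      exact ⟨h1, h2⟩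
  rank_lt k hk k' hk' hne hline hor := by
    have hk'ℓ : k'.2 ≠ ℓ := by
      simp only [kept, Finset.mem_filter, Finset.mem_univ, true_and] at hk'
      rcases hk' with h | h <;> exact h.1
    simp only [kept, Finset.mem_filter, Finset.mem_univ, true_and] at hk
    rcases hk with ⟨h1, h2⟩ | ⟨h1, h2, h3, h4⟩
    · obtain ⟨m, hc, hck, hnm, hl, hcyc, hlt⟩ := (ρ.exists_step h2).choose_spec
      have hcol : ρ.col k = (ρ.exists_step h2).choose := dif_pos h2
      rw [hcol] at hline hor
      rw [if_neg hc] at hor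
      have hk2 : k'.2 = k.2 := hor.resolve_right hk'ℓ
      have hk1 : k'.1 = m := (G.eq_or_eq_of_lineAt_eq hnm hl hline).resolve_left
        fun h => hne (Prod.ext h hk2)
      -- The other end is in the same cycle and strictly nearer to its root, so its kernel has
      -- already been eliminated.
      rw [rank, rank, Prod.Lex.toLex_lt_toLex]
      refine Or.inr ⟨?_, ?_⟩
      · rw [hk1, G.bubbleOf_eq_of_cycleOf_eq hcyc]
      · simp only [hk1, hk2]
        rw [rootOf, hcyc]
        exact hlt
    · have hroot := ρ.eq_rootOf_base h4
      have hcol : ρ.col k = ℓ := dif_neg (not_not.mpr (hroot _))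
      rw [hcol] at hline hor
      rw [if_pos rfl] at hor
      obtain ⟨m, hm1, hm2, hm3⟩ := ρ.exists_parent _ h3
      rw [← h4] at hm1 hm2 hm3
      have hk1 : k'.1 = m := by
        refine (G.eq_or_eq_of_lineAt_eq hm1.symm hm2 hline).resolve_left fun h => ?_
        rcases hor with hor | hor
        · exact hne (Prod.ext h hor)
        -- At the base node itself the kernel of index κ is not kept: it is not inner because the
        -- base is a root, and `IsOuter` excludes κ.
        · simp only [kept, Finset.mem_filter, Finset.mem_univ, true_and] at hk'
          rcases hk' with h' | h'
          · exact h'.2 (by rw [h]; exact hroot _)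
          · exact h'.2.1 hor
      rw [rank, rank, Prod.Lex.toLex_lt_toLex]
      -- The line of colour ℓ leads to a bubble whose base has strictly smaller depth; all the
      -- kernels of that bubble come earlier in the order.
      refine Or.inl ?_
      simp only
      rw [hk1, ← h4]
      exact (ρ.depth_base_le m).trans_lt hm3

/-! ### Counting the kernels that are integrated out -/

open Classical in
theorem card_inner (i : Fin 4) :
    (Finset.univ.filter fun n : W ⊕ B => n ≠ ρ.rootOf i n).card
      + Nat.card (G.restrict {ℓ, i}ᶜ).ConnectedComponent = Fintype.card (W ⊕ B) := by
  have h1 : (Finset.univ.filter fun n : W ⊕ B => n = ρ.rootOf i n).card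
      = Nat.card (G.restrict {ℓ, i}ᶜ).ConnectedComponent := by
    rw [← Fintype.card_subtype, ← Nat.card_eq_fintype_card]
    refine Nat.card_congr ⟨fun n => G.cycleOf ℓ i n.1, fun v => ⟨ρ.root i v, ?_⟩, ?_, ?_⟩
    · rw [rootOf, ρ.cycleOf_root]
    · intro n
      exact Subtype.ext n.2.symm
    · intro v
      exact ρ.cycleOf_root i v
  rw [← h1, add_comm, ← Finset.card_univ]
  exact Finset.card_filter_add_card_filter_not _

open Classical in
theorem card_outer :
    (Finset.univ.filter fun n : W ⊕ B =>
      G.bubbleOf ℓ n ≠ ρ.top ∧ n = ρ.base (G.bubbleOf ℓ n)).card + 1 = Nat.card (G.Bubble ℓ) := by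
  have h1 : (Finset.univ.filter fun n : W ⊕ B =>
      G.bubbleOf ℓ n ≠ ρ.top ∧ n = ρ.base (G.bubbleOf ℓ n)).card
      = ((Finset.univ : Finset (G.Bubble ℓ)).erase ρ.top).card := by
    refine Finset.card_bij' (fun n _ => G.bubbleOf ℓ n) (fun b _ => ρ.base b) ?_ ?_ ?_ ?_
    · intro n hn
      simp only [Finset.mem_filter, Finset.mem_univ, true_and] at hn
      simp [hn.1]
    · intro b hb
      simp only [Finset.mem_erase, Finset.mem_univ, and_true] at hb
      simp [ρ.bubbleOf_base, hb]
    · intro n hn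
      simp only [Finset.mem_filter, Finset.mem_univ, true_and] at hn
      exact hn.2.symm
    · intro b _
      exact ρ.bubbleOf_base b
  rw [h1, Finset.card_erase_add_one (Finset.mem_univ _), Finset.card_univ,
    Nat.card_eq_fintype_card]

/-- For each of the three indices i ≠ ℓ all nodes but one per cycle are inner. Each bubble other
than the top one adds two outer kernels, disjoint from the inner ones because the base is a root. -/
theorem card_kept {κ : Fin 4} (hκ : κ ≠ ℓ) :
    (ρ.kept κ).card + ∑ i ∈ Finset.univ.erase ℓ, Nat.card (G.restrict {ℓ, i}ᶜ).ConnectedComponent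
      + 2 = 3 * Fintype.card (W ⊕ B) + 2 * Nat.card (G.Bubble ℓ) := by
  classical
  have hsplit : ρ.kept κ = (Finset.univ.filter fun k => ρ.IsInner k) ∪
      (Finset.univ.filter fun k => ρ.IsOuter κ k) := Finset.filter_or _ _ _
  have hdisj : Disjoint (Finset.univ.filter fun k => ρ.IsInner k)
      (Finset.univ.filter fun k => ρ.IsOuter κ k) := by
    refine Finset.disjoint_filter.mpr fun k _ h1 h2 => h1.2 (ρ.eq_rootOf_base h2.2.2.2 _)
  have hin : (Finset.univ.filter fun k => ρ.IsInner k).card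
      = ∑ i ∈ Finset.univ.erase ℓ, (Finset.univ.filter fun n : W ⊕ B => n ≠ ρ.rootOf i n).card := by
    rw [Finset.card_eq_sum_card_fiberwise (f := Prod.snd) (t := Finset.univ.erase ℓ)]
    · refine Finset.sum_congr rfl fun i hi => ?_
      refine Finset.card_bij' (fun k _ => k.1) (fun n _ => (n, i)) ?_ ?_ ?_ ?_
      · intro k hk
        simp only [Finset.mem_filter, Finset.mem_univ, true_and] at hk ⊢
        rw [← hk.2]; exact hk.1.2
      · intro n hn
        simp only [Finset.mem_filter, Finset.mem_univ, true_and, and_true] at hn ⊢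
        exact ⟨Finset.ne_of_mem_erase hi, hn⟩
      · intro k hk
        simp only [Finset.mem_filter] at hk
        exact Prod.ext rfl hk.2.symm
      · intro n _; rfl
    · intro k hk
      simp only [Finset.coe_filter, Finset.mem_univ, true_and, Set.mem_ofPred_eq] at hk
      simpa using hk.1
  have hout : (Finset.univ.filter fun k => ρ.IsOuter κ k).card
      = ((Finset.univ.filter fun n : W ⊕ B =>
        G.bubbleOf ℓ n ≠ ρ.top ∧ n = ρ.base (G.bubbleOf ℓ n)) ×ˢ
        ((Finset.univ.erase ℓ).erase κ)).card := by
    congr 1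
    ext k
    rw [Finset.mem_filter, Finset.mem_product, Finset.mem_filter, Finset.mem_erase,
      Finset.mem_erase, IsOuter]
    simp only [Finset.mem_univ, true_and, and_true]
    tauto
  have h2 : ((Finset.univ.erase ℓ).erase κ).card = 2 := by
    rw [Finset.card_erase_of_mem (by simp [hκ]), Finset.card_erase_of_mem (Finset.mem_univ _)]
    simp
  have h3 : (Finset.univ.erase ℓ).card = 3 := by
    rw [Finset.card_erase_of_mem (Finset.mem_univ _)]
    simp
  have h4 : ∑ i ∈ Finset.univ.erase ℓ, ((Finset.univ.filter fun n : W ⊕ B =>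
      n ≠ ρ.rootOf i n).card + Nat.card (G.restrict {ℓ, i}ᶜ).ConnectedComponent)
      = 3 * Fintype.card (W ⊕ B) := by
    rw [Finset.sum_congr rfl fun i _ => ρ.card_inner i, Finset.sum_const, h3, smul_eq_mul]
  rw [Finset.sum_add_distrib] at h4
  rw [hsplit, Finset.card_union_of_disjoint hdisj, hin, hout, Finset.card_product, h2,
    ← h4, ← ρ.card_outer]
  ring

end Rooting

/-! ### The Euler characteristics of the bubbles -/

variable (G)
variable {ℓ : Fin 4}

theorem supp_cycleOf_subset_iff {i : Fin 4} {n : W ⊕ B} {b : G.Bubble ℓ} :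
    (G.cycleOf ℓ i n).supp ⊆ b.supp ↔ G.bubbleOf ℓ n = b := by
  constructor
  · intro h
    exact h (rfl : n ∈ (G.cycleOf ℓ i n).supp)
  · intro h m hm
    have : G.cycleOf ℓ i m = G.cycleOf ℓ i n := hm
    exact (G.bubbleOf_eq_of_cycleOf_eq this).trans h

/-- The vertices of all the bubbles of colour `ℓ`. -/
def sigmaBubbleVertexEquiv (i : Fin 4) :
    (Σ b : G.Bubble ℓ, G.BubbleVertex b i) ≃ (G.restrict {ℓ, i}ᶜ).ConnectedComponent :=
  Equiv.ofBijective (fun v => v.2.1) <| by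
    constructor
    · rintro ⟨b, v, hv⟩ ⟨b', v', hv'⟩ (rfl : v = v')
      obtain ⟨n, rfl⟩ := v.exists_rep
      have h1 := G.supp_cycleOf_subset_iff.mp hv
      have h2 := G.supp_cycleOf_subset_iff.mp hv'
      subst h1
      subst h2
      rfl
    · intro v
      obtain ⟨n, rfl⟩ := v.exists_rep
      exact ⟨⟨G.bubbleOf ℓ n, _, G.supp_cycleOf_subset_iff.mpr rfl⟩, rfl⟩

/-- The lines of all the bubbles of colour `ℓ`. -/
def sigmaBubbleEdgeEquiv :
    (Σ b : G.Bubble ℓ, G.BubbleEdge b) ≃ {c : Fin 4 // c ≠ ℓ} × W where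
  toFun e := (⟨e.2.1.1, e.2.2.1⟩, e.2.1.2)
  invFun e := ⟨G.bubbleOf ℓ (Sum.inl e.2), (e.1, e.2), e.1.2, rfl⟩
  left_inv := by
    rintro ⟨b, ⟨c, w⟩, hc, rfl⟩
    rfl
  right_inv _ := rfl

/-- The nodes of all the bubbles of colour `ℓ`. -/
def sigmaBubbleFaceEquiv : (Σ b : G.Bubble ℓ, G.BubbleFace b) ≃ W ⊕ B where
  toFun x := x.2.1
  invFun x := ⟨G.bubbleOf ℓ x, x, rfl⟩
  left_inv := by
    rintro ⟨b, x, rfl⟩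
    rfl
  right_inv _ := rfl

variable [Fintype W] [Fintype B]

instance : Finite (G.Bubble ℓ) := Quot.finite _

instance (b : G.Bubble ℓ) (i : Fin 4) : Finite (G.BubbleVertex b i) :=
  haveI : Finite (G.restrict {ℓ, i}ᶜ).ConnectedComponent := Quot.finite _
  Subtype.finite

instance (b : G.Bubble ℓ) : Finite (G.BubbleEdge b) := Subtype.finite

instance (b : G.Bubble ℓ) : Finite (G.BubbleFace b) := Subtype.finite

theorem card_white_eq_card_black {W B : Type*} [Fintype W] [Fintype B] (G : ColoredGraph W B) :
    Fintype.card W = Fintype.card B :=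
  Fintype.card_congr (G.line 0)

/-- Every cycle, line of colour ≠ ℓ and node belongs to exactly one bubble, so the Euler
characteristics add up to V - 3N/2 + N. -/
theorem two_sub_sum_genus :
    2 - 2 * ∑ᶠ b : G.Bubble ℓ, G.genus b
      = 2 - 2 * (Nat.card (G.Bubble ℓ) : ℝ)
        + ∑ i ∈ Finset.univ.erase ℓ, (Nat.card (G.restrict {ℓ, i}ᶜ).ConnectedComponent : ℝ)
        - Fintype.card (W ⊕ B) / 2 := by
  classical
  have := Fintype.ofFinite (G.Bubble ℓ)
  have hV : ∀ i, (Nat.card (G.restrict {ℓ, i}ᶜ).ConnectedComponent : ℝ)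
      = ∑ b : G.Bubble ℓ, (Nat.card (G.BubbleVertex b i) : ℝ) := by
    intro i
    rw [← Nat.card_congr (G.sigmaBubbleVertexEquiv i), Nat.card_sigma]
    push_cast
    rfl
  have hE : 3 * (Fintype.card W : ℝ) = ∑ b : G.Bubble ℓ, (Nat.card (G.BubbleEdge b) : ℝ) := by
    have h1 : Nat.card ({c : Fin 4 // c ≠ ℓ} × W) = 3 * Fintype.card W := by
      rw [Nat.card_prod, Nat.card_eq_fintype_card, Nat.card_eq_fintype_card,
        Fintype.card_subtype_compl]
      simp
    rw [← Nat.card_congr (G.sigmaBubbleEdgeEquiv (ℓ := ℓ)), Nat.card_sigma] at h1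
    exact_mod_cast h1.symm
  have hF : (Fintype.card (W ⊕ B) : ℝ) = ∑ b : G.Bubble ℓ, (Nat.card (G.BubbleFace b) : ℝ) := by
    rw [← Nat.card_eq_fintype_card, ← Nat.card_congr (G.sigmaBubbleFaceEquiv (ℓ := ℓ)), Nat.card_sigma]
    push_cast
    rfl
  have hW : (Fintype.card (W ⊕ B) : ℝ) = 2 * Fintype.card W := by
    rw [Fintype.card_sum, ← G.card_white_eq_card_black]
    push_cast
    ring
  have hsum : ∑ b : G.Bubble ℓ, G.genus b = (Nat.card (G.Bubble ℓ) : ℝ) -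
      (∑ i ∈ Finset.univ.erase ℓ, (Nat.card (G.restrict {ℓ, i}ᶜ).ConnectedComponent : ℝ)
        - 3 * (Fintype.card W : ℝ) + Fintype.card (W ⊕ B)) / 2 := by
    simp_rw [hV]
    rw [Finset.sum_comm, hE, hF, ← Finset.sum_sub_distrib, ← Finset.sum_add_distrib,
      Finset.sum_div, Nat.card_eq_fintype_card, ← Finset.card_univ, Finset.card_eq_sum_ones]
    push_cast
    rw [← Finset.sum_sub_distrib]
    refine Finset.sum_congr rfl fun b _ => ?_
    rw [genus, eulerChar]
    push_cast
    ring
  rw [finsum_eq_sum_of_fintype, hsum, hW]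
  ring

theorem Rooting.exponent_eq {G : ColoredGraph W B} {ℓ κ : Fin 4} (ρ : G.Rooting ℓ) (hκ : κ ≠ ℓ) :
    5 / 2 * (Fintype.card (W ⊕ B) : ℝ) - (ρ.kept κ).card
      = 2 - 2 * ∑ᶠ b : G.Bubble ℓ, G.genus b := by
  have h := congrArg (Nat.cast : ℕ → ℝ) (ρ.card_kept hκ)
  push_cast at h
  rw [G.two_sub_sum_genus]
  linarith

/-- The bound on the divergence degree by the genera of the bubbles of a given colour. -/
theorem Connected.divergenceDegree_le {G : ColoredGraph W B} (hG : G.Connected) (ℓ : Fin 4) :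
    G.divergenceDegree ≤ ((2 - 2 * ∑ᶠ b : G.Bubble ℓ, G.genus b : ℝ) : EReal) := by
  obtain ⟨ρ⟩ := hG.exists_rooting ℓ
  have hκ : ℓ + 1 ≠ ℓ := by clear ρ; revert ℓ; decide
  rw [← ρ.exponent_eq hκ]
  exact ColoredGraph.divergenceDegree_le fun α hα => (ρ.elimination hκ).amplitude_le hα

end ColoredGraph

/-! ### The genus of a bubble is a natural number -/

/-- Orbits are fixed points and nontrivial cycles together; Φ labels each point by the one
containing it, and a cycle of length m has sign (-1)^(m-1). -/
theorem sign_eq_neg_one_pow_card_orbits {α : Type*} [Fintype α] [DecidableEq α]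
    (σ : Equiv.Perm α) : Equiv.Perm.sign σ
      = (-1) ^ (Fintype.card α + Nat.card (Quotient (Equiv.Perm.SameCycle.setoid σ))) := by
  let Φ : α → Function.fixedPoints σ ⊕ σ.cycleFactorsFinset := fun x =>
    if h : σ x = x then Sum.inl ⟨x, h⟩ else
      Sum.inr ⟨σ.cycleOf x, Equiv.Perm.cycleOf_mem_cycleFactorsFinset_iff.mpr
        (Equiv.Perm.mem_support.mpr h)⟩
  have hΦ : ∀ x y, Φ x = Φ y ↔ σ.SameCycle x y := by
    intro x y
    by_cases hx : σ x = x
    · by_cases hy : σ y = y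
      · simp only [Φ, dif_pos hx, dif_pos hy, Sum.inl.injEq]
        exact ⟨fun h => Eq.subst (motive := σ.SameCycle x) (congrArg Subtype.val h)
            (Equiv.Perm.SameCycle.refl _ _),
          fun h => Subtype.ext (h.eq_of_left hx)⟩
      · simp only [Φ, dif_pos hx, dif_neg hy, reduceCtorEq, false_iff]
        exact fun h => hy (h.eq_of_left hx ▸ hx)
    · by_cases hy : σ y = y
      · simp only [Φ, dif_neg hx, dif_pos hy, reduceCtorEq, false_iff]
        exact fun h => hx (h.eq_of_right hy ▸ hy)
      · simp only [Φ, dif_neg hx, dif_neg hy, Sum.inr.injEq, Subtype.mk.injEq]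
        exact (Equiv.Perm.sameCycle_iff_cycleOf_eq_of_mem_support
          (Equiv.Perm.mem_support.mpr hx) (Equiv.Perm.mem_support.mpr hy)).symm
  have hsurj : Function.Surjective Φ := by
    rintro (⟨x, hx⟩ | ⟨f, hf⟩)
    · exact ⟨x, dif_pos hx⟩
    · obtain ⟨hcyc, hfσ⟩ := Equiv.Perm.mem_cycleFactorsFinset_iff.mp hf
      obtain ⟨x, hx⟩ := hcyc.nonempty_support
      have hσx : x ∈ σ.support := Equiv.Perm.mem_cycleFactorsFinset_support_le hf hx
      refine ⟨x, ?_⟩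
      simp only [Φ, dif_neg (Equiv.Perm.mem_support.mp hσx), Sum.inr.injEq, Subtype.mk.injEq]
      exact (Equiv.Perm.cycle_is_cycleOf hx hf).symm
  have hcard : Nat.card (Quotient (Equiv.Perm.SameCycle.setoid σ))
      = Fintype.card (Function.fixedPoints σ) + σ.cycleFactorsFinset.card := by
    rw [← Fintype.card_coe σ.cycleFactorsFinset, ← Fintype.card_sum, ← Nat.card_eq_fintype_card]
    refine Nat.card_congr (Equiv.ofBijective
      (Quotient.lift Φ fun x y h => (hΦ x y).mpr h) ⟨?_, ?_⟩)
    · intro a b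
      refine Quotient.inductionOn₂ a b fun x y h => Quotient.sound ((hΦ x y).mp h)
    · intro z
      obtain ⟨x, hx⟩ := hsurj z
      exact ⟨Quotient.mk _ x, hx⟩
  have h1 := σ.card_fixedPoints
  have h2 := σ.sum_cycleType_le
  have h3 : Multiset.card σ.cycleType = σ.cycleFactorsFinset.card := by
    rw [Equiv.Perm.cycleType_def, Multiset.card_map]
    rfl
  rw [Equiv.Perm.sign_of_cycleType, hcard, h3, h1]
  have h4 : Fintype.card α + (Fintype.card α - σ.cycleType.sum + σ.cycleFactorsFinset.card)
      = σ.cycleType.sum + σ.cycleFactorsFinset.card + 2 * (Fintype.card α - σ.cycleType.sum) := by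
    omega
  rw [h4, pow_add _ _ (2 * _), pow_mul]
  simp

theorem rel_of_reachable {V : Type*} {H : SimpleGraph V} {r : V → V → Prop} (hr : Equivalence r)
    (h : ∀ x y, H.Adj x y → r x y) {x y : V} (hxy : H.Reachable x y) : r x y := by
  obtain ⟨p⟩ := hxy
  induction p with
  | nil => exact hr.refl _
  | cons hadj _ ih => exact hr.trans (h _ _ hadj) ih

theorem compl_pair_ord : ∀ (ℓ : Fin 4) (m : Fin 3) (c : Fin 4),
    c ∈ ({ℓ, ord ℓ m}ᶜ : Set (Fin 4)) ↔ c = ord ℓ (m + 1) ∨ c = ord ℓ (m + 2) := by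
  simp only [Set.mem_compl_iff, Set.mem_insert_iff, Set.mem_singleton_iff]
  decide

theorem sum_erase_eq_sum_ord {M : Type*} [AddCommMonoid M] (ℓ : Fin 4) (f : Fin 4 → M) :
    ∑ i ∈ Finset.univ.erase ℓ, f i = ∑ m, f (ord ℓ m) := by
  have : Finset.univ.erase ℓ = Finset.univ.map ⟨ord ℓ, ord_injective ℓ⟩ := by
    revert ℓ; decide
  rw [this, Finset.sum_map]
  rfl

theorem add_ne_self : ∀ m : Fin 3, m + 1 ≠ m ∧ m + 2 ≠ m := by decide

namespace ColoredGraph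

variable {W B : Type*} (G : ColoredGraph W B) {ℓ : Fin 4}

theorem rel_of_reachable_restrict {S : Set (Fin 4)} {r : W ⊕ B → W ⊕ B → Prop}
    (hr : Equivalence r)
    (h : ∀ c ∈ S, ∀ w, r (Sum.inl w) (Sum.inr (G.line c w))) {x y : W ⊕ B}
    (hxy : (G.restrict S).Reachable x y) : r x y := by
  refine rel_of_reachable hr (fun x y hadj => ?_) hxy
  rw [restrict, SimpleGraph.fromRel_adj] at hadj
  rcases hadj.2 with ⟨c, hc, w, rfl, rfl⟩ | ⟨c, hc, w, rfl, rfl⟩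
  · exact h c hc w
  · exact hr.symm (h c hc w)

theorem bubbleOf_line {c : Fin 4} (hc : c ≠ ℓ) (w : W) :
    G.bubbleOf ℓ (Sum.inr (G.line c w)) = G.bubbleOf ℓ (Sum.inl w) :=
  SimpleGraph.ConnectedComponent.sound
    (G.reachable_of_lineAt_eq (S := {ℓ}ᶜ) hc (G.lineAt_inr_line w c))

theorem cycleOf_line {i c : Fin 4} (hc : c ∈ ({ℓ, i}ᶜ : Set (Fin 4))) (w : W) :
    G.cycleOf ℓ i (Sum.inr (G.line c w)) = G.cycleOf ℓ i (Sum.inl w) :=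
  SimpleGraph.ConnectedComponent.sound
    (G.reachable_of_lineAt_eq hc (G.lineAt_inr_line w c))

/-- The white nodes of a bubble. -/
abbrev BubbleWhite (b : G.Bubble ℓ) : Type _ := {w : W // G.bubbleOf ℓ (Sum.inl w) = b}

/-- The permutation of the white nodes which follows the bicoloured cycles around the vertices of
colour `ord ℓ m`. -/
def cyclePerm (ℓ : Fin 4) (m : Fin 3) : Equiv.Perm W :=
  (G.line (ord ℓ (m + 1))).trans (G.line (ord ℓ (m + 2))).symm

theorem bubbleOf_cyclePerm (m : Fin 3) (w : W) :
    G.bubbleOf ℓ (Sum.inl (G.cyclePerm ℓ m w)) = G.bubbleOf ℓ (Sum.inl w) := by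
  rw [← G.bubbleOf_line (ord_ne ℓ (m + 2)), cyclePerm, Equiv.trans_apply, Equiv.apply_symm_apply,
    G.bubbleOf_line (ord_ne ℓ (m + 1))]

/-- The permutation `cyclePerm` restricted to the white nodes of a bubble. -/
def bubblePerm (b : G.Bubble ℓ) (m : Fin 3) : Equiv.Perm (G.BubbleWhite b) :=
  (G.cyclePerm ℓ m).subtypePerm fun w => by rw [G.bubbleOf_cyclePerm]

/-- Following one line of each of the two colours takes a white node to the next white node of its
bicoloured cycle; a black node is represented by its white neighbour along the second colour. -/
theorem cycleOf_eq_iff_sameCycle (m : Fin 3) (w w' : W) :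
    G.cycleOf ℓ (ord ℓ m) (Sum.inl w) = G.cycleOf ℓ (ord ℓ m) (Sum.inl w')
      ↔ (G.cyclePerm ℓ m).SameCycle w w' := by
  set σ := G.cyclePerm ℓ m with hσ
  have hc1 := (compl_pair_ord ℓ m (ord ℓ (m + 1))).mpr (Or.inl rfl)
  have hc2 := (compl_pair_ord ℓ m (ord ℓ (m + 2))).mpr (Or.inr rfl)
  constructor
  · intro h
    let rep : W ⊕ B → W := Sum.elim id (G.line (ord ℓ (m + 2))).symm
    refine G.rel_of_reachable_restrict (r := fun x y => σ.SameCycle (rep x) (rep y))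
      ⟨fun x => Equiv.Perm.SameCycle.refl _ _, Equiv.Perm.SameCycle.symm,
        Equiv.Perm.SameCycle.trans⟩ (fun c hc w => ?_) (SimpleGraph.ConnectedComponent.exact h)
    rcases (compl_pair_ord ℓ m c).mp hc with rfl | rfl
    · exact ⟨1, rfl⟩
    · simp only [rep, Sum.elim_inl, Sum.elim_inr, Equiv.symm_apply_apply, id]
      exact Equiv.Perm.SameCycle.refl _ _
  · have hstep : ∀ w, G.cycleOf ℓ (ord ℓ m) (Sum.inl (σ w)) = G.cycleOf ℓ (ord ℓ m) (Sum.inl w) := by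
      intro w
      rw [← G.cycleOf_line hc2, hσ, cyclePerm, Equiv.trans_apply, Equiv.apply_symm_apply,
        G.cycleOf_line hc1]
    rintro ⟨k, rfl⟩
    induction k using Int.induction_on with
    | zero => rfl
    | succ k ih => rw [ih, add_comm, zpow_add, zpow_one, Equiv.Perm.mul_apply, hstep]
    | pred k ih =>
      rw [ih, ← hstep ((σ ^ (-(k : ℤ) - 1)) w), ← Equiv.Perm.mul_apply, ← zpow_one_add]
      congr 4
      ring

theorem card_bubbleVertex (b : G.Bubble ℓ) (m : Fin 3) :
    Nat.card (G.BubbleVertex b (ord ℓ m))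
      = Nat.card (Quotient (Equiv.Perm.SameCycle.setoid (G.bubblePerm b m))) := by
  have hsame : ∀ w w' : G.BubbleWhite b, (G.bubblePerm b m).SameCycle w w' ↔
      G.cycleOf ℓ (ord ℓ m) (Sum.inl w.1) = G.cycleOf ℓ (ord ℓ m) (Sum.inl w'.1) := by
    intro w w'
    rw [G.cycleOf_eq_iff_sameCycle, bubblePerm, Equiv.Perm.sameCycle_subtypePerm]
  refine (Nat.card_congr (Equiv.ofBijective (Quotient.lift
    (fun w : G.BubbleWhite b => (⟨G.cycleOf ℓ (ord ℓ m) (Sum.inl w.1),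
      G.supp_cycleOf_subset_iff.mpr w.2⟩ : G.BubbleVertex b (ord ℓ m)))
    fun w w' h => Subtype.ext ((hsame w w').mp h)) ⟨?_, ?_⟩)).symm
  · intro x y
    refine Quotient.inductionOn₂ x y fun w w' h => Quotient.sound ?_
    exact (hsame w w').mpr (congrArg Subtype.val h)
  · rintro ⟨v, hv⟩
    obtain ⟨n, rfl⟩ := v.exists_rep
    have hw : ∃ w, G.cycleOf ℓ (ord ℓ m) (Sum.inl w) = G.cycleOf ℓ (ord ℓ m) n := by
      rcases n with w | b
      · exact ⟨w, rfl⟩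
      · refine ⟨(G.line (ord ℓ (m + 1))).symm b, ?_⟩
        rw [← G.cycleOf_line ((compl_pair_ord ℓ m (ord ℓ (m + 1))).mpr (Or.inl rfl)),
          Equiv.apply_symm_apply]
    obtain ⟨w, hw⟩ := hw
    refine ⟨Quotient.mk _ ⟨w, ?_⟩, Subtype.ext hw⟩
    rw [G.bubbleOf_eq_of_cycleOf_eq hw]
    exact G.supp_cycleOf_subset_iff.mp hv

/-- The number of vertices of a bubble. -/
def numVertices (b : G.Bubble ℓ) : ℕ := ∑ m, Nat.card (G.BubbleVertex b (ord ℓ m))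

theorem card_bubbleEdge (b : G.Bubble ℓ) :
    Nat.card (G.BubbleEdge b) = 3 * Nat.card (G.BubbleWhite b) := by
  have e : G.BubbleEdge b ≃ {c : Fin 4 // c ≠ ℓ} × G.BubbleWhite b :=
    { toFun := fun e => (⟨e.1.1, e.2.1⟩, ⟨e.1.2, e.2.2⟩)
      invFun := fun e => ⟨(e.1.1, e.2.1), e.1.2, e.2.2⟩
      left_inv := fun _ => rfl
      right_inv := fun _ => rfl }
  rw [Nat.card_congr e, Nat.card_prod, Nat.card_eq_fintype_card, Fintype.card_subtype_compl]
  simp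

/-- A line of colour `c` matches the white nodes of a bubble with its black nodes. -/
def bubbleLine (b : G.Bubble ℓ) {c : Fin 4} (hc : c ≠ ℓ) :
    G.BubbleWhite b ≃ {x : B // G.bubbleOf ℓ (Sum.inr x) = b} :=
  (G.line c).subtypeEquiv fun w => by rw [G.bubbleOf_line hc]

/-! ### Vertex and face coboundaries of a bubble. -/

section Faces

variable (b : G.Bubble ℓ)

/-- The vertices of a bubble, with their colours. -/
abbrev AllVertices : Type _ := Σ m : Fin 3, G.BubbleVertex b (ord ℓ m)

/-- The vertex of colour `ord ℓ m` of a node. -/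
def vertexAt (m : Fin 3) (n : G.BubbleFace b) : G.AllVertices b :=
  ⟨m, G.cycleOf ℓ (ord ℓ m) n.1, G.supp_cycleOf_subset_iff.mpr n.2⟩

/-- A white node, as a face of the bubble. -/
def whiteFace (w : G.BubbleWhite b) : G.BubbleFace b := ⟨Sum.inl w.1, w.2⟩

/-- A black node, as a face of the bubble. -/
def blackFace (x : {x : B // G.bubbleOf ℓ (Sum.inr x) = b}) : G.BubbleFace b := ⟨Sum.inr x.1, x.2⟩

theorem vertexAt_line (w : G.BubbleWhite b) {m j : Fin 3} (hj : j ≠ m) :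
    G.vertexAt b j (G.blackFace b (G.bubbleLine b (ord_ne ℓ m) w))
      = G.vertexAt b j (G.whiteFace b w) := by
  have hmem : ord ℓ m ∈ ({ℓ, ord ℓ j}ᶜ : Set (Fin 4)) := by
    rw [compl_pair_ord]
    have : m = j + 1 ∨ m = j + 2 := by revert m j; decide
    rcases this with rfl | rfl
    · exact Or.inl rfl
    · exact Or.inr rfl
  have h := G.cycleOf_line hmem w.1
  refine Sigma.ext rfl (heq_of_eq (Subtype.ext h))

/-- Connectedness of the bubble. The relation carried along a path also records membership in b,
since f is defined only there. -/
theorem eq_of_bubble {γ : Type*} (f : G.BubbleFace b → γ)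
    (h : ∀ (m : Fin 3) (w : G.BubbleWhite b),
      f (G.whiteFace b w) = f (G.blackFace b (G.bubbleLine b (ord_ne ℓ m) w)))
    (x y : G.BubbleFace b) : f x = f y := by
  have hreach : (G.restrict {ℓ}ᶜ).Reachable x.1 y.1 :=
    SimpleGraph.ConnectedComponent.exact (show G.bubbleOf ℓ x.1 = G.bubbleOf ℓ y.1 from
      Eq.trans x.2 (Eq.symm y.2))
  have key := G.rel_of_reachable_restrict (S := {ℓ}ᶜ)
    (r := fun p q => (G.bubbleOf ℓ p = b ↔ G.bubbleOf ℓ q = b) ∧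
      ∀ (hp : G.bubbleOf ℓ p = b) (hq : G.bubbleOf ℓ q = b),
        f ⟨p, hp⟩ = f ⟨q, hq⟩)
    ⟨fun p => ⟨Iff.rfl, fun _ _ => rfl⟩, fun h => ⟨h.1.symm, fun hp hq => (h.2 hq hp).symm⟩,
      fun h h' => ⟨h.1.trans h'.1, fun hp hq => (h.2 hp (h.1.mp hp)).trans (h'.2 _ hq)⟩⟩
    (fun c hc w => ?_) hreach
  · exact key.2 x.2 y.2
  · refine ⟨by rw [G.bubbleOf_line hc], fun hp hq => ?_⟩
    obtain ⟨m, rfl⟩ := exists_ord_eq ℓ c hc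
    exact h m ⟨w, hp⟩

theorem exists_vertexAt_eq (v : G.AllVertices b) : ∃ m n, G.vertexAt b m n = v := by
  obtain ⟨m, v, hv⟩ := v
  obtain ⟨n, rfl⟩ := v.exists_rep
  exact ⟨m, ⟨n, G.supp_cycleOf_subset_iff.mp hv⟩, rfl⟩

/-- The coboundary of functions on vertices. -/
def vertexCoboundary : (G.AllVertices b → ℝ) →ₗ[ℝ] (Fin 3 × G.BubbleWhite b → ℝ) :=
  LinearMap.funLeft ℝ ℝ (fun e => G.vertexAt b (e.1 + 1) (G.whiteFace b e.2))
    - LinearMap.funLeft ℝ ℝ fun e => G.vertexAt b (e.1 + 2) (G.whiteFace b e.2)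

/-- The coboundary of functions on faces, in the dual cell decomposition. -/
def faceCoboundary : (G.BubbleFace b → ℝ) →ₗ[ℝ] (Fin 3 × G.BubbleWhite b → ℝ) :=
  LinearMap.funLeft ℝ ℝ (fun e => G.whiteFace b e.2)
    - LinearMap.funLeft ℝ ℝ fun e => G.blackFace b (G.bubbleLine b (ord_ne ℓ e.1) e.2)

/-- At each node the three vertices take the same value, and a line joins nodes sharing two of these
vertices, so the common value propagates over the whole bubble. -/
theorem eq_of_vertexCoboundary_eq_zero {φ : G.AllVertices b → ℝ}
    (h : G.vertexCoboundary b φ = 0) (v v' : G.AllVertices b) : φ v = φ v' := by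
  have hw : ∀ (m : Fin 3) (w : G.BubbleWhite b), φ (G.vertexAt b (m + 1) (G.whiteFace b w))
      = φ (G.vertexAt b (m + 2) (G.whiteFace b w)) := fun m w =>
    sub_eq_zero.mp (congrFun h (m, w))
  have hall : ∀ (n : G.BubbleFace b) (m : Fin 3), φ (G.vertexAt b (m + 1) n)
      = φ (G.vertexAt b (m + 2) n) := by
    rintro ⟨w | x, hn⟩ m
    · exact hw m ⟨w, hn⟩
    · obtain ⟨w, hw'⟩ := (G.bubbleLine b (ord_ne ℓ m)).surjective ⟨x, hn⟩
      have e1 := G.vertexAt_line b w (add_ne_self m).1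
      have e2 := G.vertexAt_line b w (add_ne_self m).2
      rw [hw'] at e1 e2
      exact (congrArg φ e1).trans ((hw m w).trans (congrArg φ e2).symm)
  have hj : ∀ (n : G.BubbleFace b) (i j : Fin 3),
      φ (G.vertexAt b i n) = φ (G.vertexAt b j n) := by
    intro n i j
    have a0 := hall n 0
    have a1 := hall n 1
    have a2 := hall n 2
    simp only [show (0 : Fin 3) + 1 = 1 from rfl, show (0 : Fin 3) + 2 = 2 from rfl,
      show (1 : Fin 3) + 1 = 2 from rfl, show (1 : Fin 3) + 2 = 0 from rfl,
      show (2 : Fin 3) + 1 = 0 from rfl, show (2 : Fin 3) + 2 = 1 from rfl] at a0 a1 a2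
    fin_cases i <;> fin_cases j <;> simp only [Fin.zero_eta, Fin.mk_one, Fin.reduceFinMk] <;>
      linarith
  obtain ⟨i, n, rfl⟩ := G.exists_vertexAt_eq b v
  obtain ⟨j, n', rfl⟩ := G.exists_vertexAt_eq b v'
  rw [hj n i 0, hj n' j 0]
  refine G.eq_of_bubble b (fun n => φ (G.vertexAt b 0 n)) (fun m w => ?_) n n'
  rw [hj _ 0 (m + 1), hj (G.blackFace b _) 0 (m + 1),
    G.vertexAt_line b w (add_ne_self m).1]

end Faces

variable [Fintype W]

/-- The three cycle permutations compose to the identity. Their signs multiply to 1, so 3w + V is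
even, with w the number of white nodes. -/
theorem even_card_add_numVertices (b : G.Bubble ℓ) :
    Even (Nat.card (G.BubbleWhite b) + G.numVertices b) := by
  classical
  have hprod : G.bubblePerm b 1 * G.bubblePerm b 0 * G.bubblePerm b 2 = 1 := by
    refine Equiv.ext fun w => Subtype.ext ?_
    change (G.line (ord ℓ 0)).symm (G.line (ord ℓ 2) ((G.line (ord ℓ 2)).symm (G.line (ord ℓ 1)
      ((G.line (ord ℓ 1)).symm (G.line (ord ℓ 0) w.1))))) = w.1
    simp only [Equiv.apply_symm_apply, Equiv.symm_apply_apply]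
  have hsign := congrArg Equiv.Perm.sign hprod
  rw [map_mul, map_mul, map_one, sign_eq_neg_one_pow_card_orbits,
    sign_eq_neg_one_pow_card_orbits, sign_eq_neg_one_pow_card_orbits, ← card_bubbleVertex,
    ← card_bubbleVertex, ← card_bubbleVertex, ← pow_add, ← pow_add,
    ← Nat.card_eq_fintype_card] at hsign
  have heven : Even (Nat.card (G.BubbleWhite b) + Nat.card (G.BubbleVertex b (ord ℓ 1))
      + (Nat.card (G.BubbleWhite b) + Nat.card (G.BubbleVertex b (ord ℓ 0)))
      + (Nat.card (G.BubbleWhite b) + Nat.card (G.BubbleVertex b (ord ℓ 2)))) := by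
    by_contra hodd
    rw [Nat.not_even_iff_odd] at hodd
    rw [hodd.neg_one_pow] at hsign
    exact absurd hsign (by decide)
  rw [numVertices, Fin.sum_univ_three]
  rw [Nat.even_iff] at heven ⊢
  omega

variable [Fintype B]

theorem card_bubbleFace (b : G.Bubble ℓ) :
    Nat.card (G.BubbleFace b) = 2 * Nat.card (G.BubbleWhite b) := by
  have e : G.BubbleFace b ≃ G.BubbleWhite b ⊕ {x : B // G.bubbleOf ℓ (Sum.inr x) = b} :=
    Equiv.subtypeSum
  rw [Nat.card_congr e, Nat.card_sum, ← Nat.card_congr (G.bubbleLine b (ord_ne ℓ 0))]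
  ring

theorem eulerChar_eq (b : G.Bubble ℓ) :
    G.eulerChar b = (G.numVertices b : ℤ) - Nat.card (G.BubbleWhite b) := by
  rw [eulerChar, sum_erase_eq_sum_ord, card_bubbleEdge, card_bubbleFace, numVertices]
  push_cast
  ring

section Homology

variable (b : G.Bubble ℓ)

open Classical in
instance : Fintype (G.BubbleWhite b) := Fintype.ofFinite _

open Classical in
instance : Fintype {x : B // G.bubbleOf ℓ (Sum.inr x) = b} := Fintype.ofFinite _

/-- This is d² = 0: around each white or black face the differences of φ along the three edges
telescope. The black faces are reached by reindexing each colour along its matching. -/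
theorem orthogonal_coboundary (φ : G.AllVertices b → ℝ) (ψ : G.BubbleFace b → ℝ) :
    ∑ e, G.vertexCoboundary b φ e * G.faceCoboundary b ψ e = 0 := by
  classical
  have hcyc : ∀ f : Fin 3 → ℝ, ∑ m : Fin 3, (f (m + 1) - f (m + 2)) = 0 := by
    intro f
    rw [Fin.sum_univ_three]
    simp only [show (0 : Fin 3) + 1 = 1 from rfl, show (0 : Fin 3) + 2 = 2 from rfl,
      show (1 : Fin 3) + 1 = 2 from rfl, show (1 : Fin 3) + 2 = 0 from rfl,
      show (2 : Fin 3) + 1 = 0 from rfl, show (2 : Fin 3) + 2 = 1 from rfl]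
    ring
  have h1 : ∑ e, G.vertexCoboundary b φ e * ψ (G.whiteFace b e.2) = 0 := by
    rw [Fintype.sum_prod_type_right]
    refine Finset.sum_eq_zero fun w _ => ?_
    change ∑ m : Fin 3, (φ (G.vertexAt b (m + 1) (G.whiteFace b w))
      - φ (G.vertexAt b (m + 2) (G.whiteFace b w))) * ψ (G.whiteFace b w) = 0
    rw [← Finset.sum_mul, hcyc fun m => φ (G.vertexAt b m (G.whiteFace b w)), zero_mul]
  have h2 : ∑ e : Fin 3 × G.BubbleWhite b, G.vertexCoboundary b φ e *
      ψ (G.blackFace b (G.bubbleLine b (ord_ne ℓ e.1) e.2)) = 0 := by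
    have hb : ∀ e : Fin 3 × G.BubbleWhite b, G.vertexCoboundary b φ e
        = φ (G.vertexAt b (e.1 + 1) (G.blackFace b (G.bubbleLine b (ord_ne ℓ e.1) e.2)))
          - φ (G.vertexAt b (e.1 + 2) (G.blackFace b (G.bubbleLine b (ord_ne ℓ e.1) e.2))) := by
      rintro ⟨m, w⟩
      rw [G.vertexAt_line b w (add_ne_self m).1,
        G.vertexAt_line b w (add_ne_self m).2]
      rfl
    simp_rw [hb]
    rw [Fintype.sum_prod_type]
    have hre : ∀ m : Fin 3, ∑ w : G.BubbleWhite b,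
        (φ (G.vertexAt b (m + 1) (G.blackFace b (G.bubbleLine b (ord_ne ℓ m) w)))
          - φ (G.vertexAt b (m + 2) (G.blackFace b (G.bubbleLine b (ord_ne ℓ m) w))))
          * ψ (G.blackFace b (G.bubbleLine b (ord_ne ℓ m) w))
        = ∑ x : {x : B // G.bubbleOf ℓ (Sum.inr x) = b},
          (φ (G.vertexAt b (m + 1) (G.blackFace b x)) - φ (G.vertexAt b (m + 2) (G.blackFace b x)))
            * ψ (G.blackFace b x) := fun m =>
      Equiv.sum_comp (G.bubbleLine b (ord_ne ℓ m)) fun x =>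
        (φ (G.vertexAt b (m + 1) (G.blackFace b x)) - φ (G.vertexAt b (m + 2) (G.blackFace b x)))
            * ψ (G.blackFace b x)
    rw [Finset.sum_congr rfl fun m _ => hre m, Finset.sum_comm]
    refine Finset.sum_eq_zero fun x _ => ?_
    rw [← Finset.sum_mul, hcyc fun m => φ (G.vertexAt b m (G.blackFace b x)), zero_mul]
  rw [← sub_eq_zero_of_eq (h1.trans h2.symm), ← Finset.sum_sub_distrib]
  refine Finset.sum_congr rfl fun e _ => ?_
  rw [← mul_sub]
  rfl

theorem finrank_ker_le_one_of_const {ι V : Type*} [AddCommGroup V] [Module ℝ V]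
    (d : (ι → ℝ) →ₗ[ℝ] V) (h : ∀ φ, d φ = 0 → ∀ i j, φ i = φ j) :
    Module.finrank ℝ (LinearMap.ker d) ≤ 1 := by
  rcases isEmpty_or_nonempty ι with hι | ⟨⟨i₀⟩⟩
  · have : Subsingleton (LinearMap.ker d) :=
      ⟨fun x y => Subtype.ext (funext fun i => (hι.false i).elim)⟩
    rw [Module.finrank_zero_of_subsingleton]
    exact zero_le_one
  · by_cases hd : d 1 = 0
    · refine finrank_le_one (⟨1, hd⟩ : LinearMap.ker d) fun φ => ⟨φ.1 i₀, Subtype.ext ?_⟩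
      funext i
      simpa using h φ.1 φ.2 i₀ i
    · have : Subsingleton (LinearMap.ker d) := by
        refine subsingleton_of_forall_eq 0 fun φ => Subtype.ext ?_
        have h1 : φ.1 = φ.1 i₀ • (1 : ι → ℝ) := by
          funext i
          simpa using h φ.1 φ.2 i i₀
        have h2 : φ.1 i₀ • d 1 = 0 := by rw [← map_smul, ← h1]; exact φ.2
        rw [h1, (smul_eq_zero.mp h2).resolve_right hd, zero_smul]
        rfl
      rw [Module.finrank_zero_of_subsingleton]
      exact zero_le_one

/-- The ranks of the two coboundaries are at least V - 1 and 2w - 1, and their orthogonal images fit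
into a space of dimension 3w. -/
theorem numVertices_le : G.numVertices b ≤ Nat.card (G.BubbleWhite b) + 2 := by
  classical
  have := Fintype.ofFinite (G.BubbleFace b)
  have : ∀ m, Fintype (G.BubbleVertex b (ord ℓ m)) := fun m => Fintype.ofFinite _
  have h0 := (G.vertexCoboundary b).finrank_range_add_finrank_ker
  have h2 := (G.faceCoboundary b).finrank_range_add_finrank_ker
  have k0 := finrank_ker_le_one_of_const (G.vertexCoboundary b)
    fun φ h => G.eq_of_vertexCoboundary_eq_zero b h
  have k2 := finrank_ker_le_one_of_const (G.faceCoboundary b)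
    fun ψ h => G.eq_of_bubble b ψ fun m w => sub_eq_zero.mp (congrFun h (m, w))
  have hdisj : Disjoint (LinearMap.range (G.vertexCoboundary b))
      (LinearMap.range (G.faceCoboundary b)) := by
    rw [Submodule.disjoint_def]
    rintro x ⟨φ, hφ⟩ ⟨ψ, hψ⟩
    have h := G.orthogonal_coboundary b φ ψ
    rw [hφ, hψ] at h
    funext e
    have := (Finset.sum_eq_zero_iff_of_nonneg fun e _ => mul_self_nonneg (x e)).mp h e
      (Finset.mem_univ e)
    exact mul_self_eq_zero.mp this
  have hle := Submodule.finrank_add_finrank_le_of_disjoint hdisj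
  rw [Module.finrank_fintype_fun_eq_card, ← Nat.card_eq_fintype_card, Nat.card_sigma] at h0
  rw [Module.finrank_fintype_fun_eq_card, ← Nat.card_eq_fintype_card, card_bubbleFace] at h2
  rw [Module.finrank_fintype_fun_eq_card, Fintype.card_prod, Fintype.card_fin,
    ← Nat.card_eq_fintype_card] at hle
  have hV : G.numVertices b = ∑ m, Nat.card (G.BubbleVertex b (ord ℓ m)) := rfl
  rw [← hV] at h0
  omega

end Homology

theorem exists_genus_eq (b : G.Bubble ℓ) : ∃ k : ℕ, G.genus b = k := by
  have h1 := G.numVertices_le b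
  obtain ⟨r, hr⟩ := G.even_card_add_numVertices b
  refine ⟨(Nat.card (G.BubbleWhite b) + 2 - G.numVertices b) / 2, ?_⟩
  obtain ⟨k, hk⟩ : ∃ k, Nat.card (G.BubbleWhite b) + 2 = G.numVertices b + 2 * k :=
    ⟨(Nat.card (G.BubbleWhite b) + 2 - G.numVertices b) / 2, by omega⟩
  have hk' : (Nat.card (G.BubbleWhite b) + 2 - G.numVertices b) / 2 = k := by omega
  rw [hk', genus, eulerChar_eq]
  have := congrArg (Nat.cast : ℕ → ℝ) hk
  push_cast at this ⊢
  linarith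

theorem numSingular_le_sum_genus :
    (G.numSingular ℓ : ℝ) ≤ ∑ᶠ b : G.Bubble ℓ, G.genus b := by
  classical
  have := Fintype.ofFinite (G.Bubble ℓ)
  rw [finsum_eq_sum_of_fintype, numSingular, Nat.card_eq_fintype_card, Fintype.card_subtype,
    Finset.card_filter]
  push_cast
  refine Finset.sum_le_sum fun b _ => ?_
  obtain ⟨k, hk⟩ := G.exists_genus_eq b
  rw [hk]
  split_ifs with h
  · exact_mod_cast Nat.one_le_iff_ne_zero.mpr (by exact_mod_cast h)
  · exact Nat.cast_nonneg k

theorem Connected.divergenceDegree_le_numSingular {G : ColoredGraph W B} (hG : G.Connected)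
    (ℓ : Fin 4) :
    G.divergenceDegree ≤ ((2 * (1 - (G.numSingular ℓ : ℝ)) : ℝ) : EReal) := by
  refine (hG.divergenceDegree_le ℓ).trans (EReal.coe_le_coe_iff.mpr ?_)
  linarith [G.numSingular_le_sum_genus (ℓ := ℓ)]

end ColoredGraph

/-! ### Canonical bubbles -/

theorem canonicalFun_same {g : ℕ} (s : Bool) (k : Fin g) :
    canonicalFun s (some (k, s)) = some (k, !s) := by simp [canonicalFun]

theorem canonicalFun_not {g : ℕ} (s : Bool) (k : Fin g) :
    canonicalFun s (some (k, !s)) = nextNode k s := by simp [canonicalFun]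

/-- Induction along the handles; after the last one, or at once when g = 0, the path reaches the
external black node. -/
theorem forall_of_firstNode {g : ℕ} {s : Bool} {P : CanonicalNode g → Prop}
    (h0 : P (firstNode g s)) (hs : ∀ k, P (some (k, s)) → P (nextNode k s)) :
    P none ∧ ∀ k, P (some (k, s)) := by
  have hall : ∀ (m : ℕ) (hm : m < g), P (some (⟨m, hm⟩, s)) := by
    intro m
    induction m with
    | zero =>
      intro hm
      rwa [firstNode, dif_pos hm] at h0
    | succ m ih =>
      intro hm
      have h := hs _ (ih (by omega))
      rwa [nextNode, dif_pos hm] at h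
  refine ⟨?_, fun k => hall k k.2⟩
  by_cases hg : 0 < g
  · have h := hs ⟨g - 1, by omega⟩ (hall _ _)
    rwa [nextNode, dif_neg (by simp only; omega)] at h
  · rwa [firstNode, dif_neg hg] at h0

theorem eq_none_of_lines_two_three {γ : Type*} {g : ℕ} {fw fb : CanonicalNode g → γ}
    (h : ∀ s x, fb (canonicalFun s x) = fw x) (x : CanonicalNode g) :
    fw x = fw none ∧ fb x = fw none := by
  have hP : ∀ s, fb none = fw none ∧ ∀ k, fb (some (k, s)) = fw none := fun s =>
    forall_of_firstNode (P := fun x => fb x = fw none) (h s none) fun k hk => by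
      rw [← canonicalFun_not, h, ← h (!s), canonicalFun_same, Bool.not_not, hk]
  have hb : ∀ x, fb x = fw none := by
    rintro (_ | ⟨k, s⟩)
    · exact (hP true).1
    · exact (hP s).2 k
  exact ⟨by rw [← h true, hb], hb x⟩

/-- Within one handle the lines of the two colours connect its two black nodes, so a value
propagated along s reaches the other black nodes as well. -/
theorem eq_none_of_lines_one {γ : Type*} {g : ℕ} {fw fb : CanonicalNode g → γ} (s : Bool)
    (h1 : ∀ x, fb x = fw x) (h : ∀ x, fb (canonicalFun s x) = fw x) (x : CanonicalNode g) :
    fw x = fw none ∧ fb x = fw none := by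
  have hnot : ∀ k, fb (some (k, !s)) = fb (some (k, s)) := fun k => by
    rw [← canonicalFun_same, h, h1]
  have hP := forall_of_firstNode (P := fun x => fb x = fw none) (h none) fun k hk => by
    rw [← canonicalFun_not, h, ← h1, hnot, hk]
  have hb : ∀ x, fb x = fw none := by
    rintro (_ | ⟨k, b⟩)
    · exact hP.1
    · rcases Bool.eq_or_eq_not b s with rfl | rfl
      · exact hP.2 k
      · rw [hnot, hP.2]
  exact ⟨by rw [← h1, hb], hb x⟩

/-! ### The bubbles of the chain -/

section Chain

variable {n : ℕ} (g : Fin n → ℕ)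

/-- The position along the chain of the canonical graph which contains a node. -/
def blockOf : ChainNode g ⊕ ChainNode g → Fin n := Sum.elim Sigma.fst Sigma.fst

/-- The external white nodes. -/
def outerWhite (i : Fin n) : ChainNode g ⊕ ChainNode g := Sum.inl ⟨i, none⟩

/-- The external black nodes. -/
def outerBlack (i : Fin n) : ChainNode g ⊕ ChainNode g := Sum.inr ⟨i, none⟩

theorem blockOf_outerWhite (i : Fin n) : blockOf g (outerWhite g i) = i := rfl

theorem blockOf_line {c : Fin 4} (hc : c ≠ 0) (w : ChainNode g) :
    blockOf g (Sum.inr ((chain g).line c w)) = blockOf g (Sum.inl w) := by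
  fin_cases c
  · exact absurd rfl hc
  · rfl
  · rfl
  · rfl

theorem cycleOf_eq_outerWhite {i : Fin 4} (hi : i ≠ 0) (x : ChainNode g ⊕ ChainNode g) :
    (chain g).cycleOf 0 i x = (chain g).cycleOf 0 i (outerWhite g (blockOf g x)) := by
  have hline : ∀ c, c ≠ 0 → c ≠ i → ∀ w, (chain g).cycleOf 0 i (Sum.inr ((chain g).line c w))
      = (chain g).cycleOf 0 i (Sum.inl w) := fun c h0 hc w =>
    (chain g).cycleOf_line (by simp [h0, hc]) w
  have key : ∀ (j : Fin n) (y : CanonicalNode (g j)),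
      (chain g).cycleOf 0 i (Sum.inl ⟨j, y⟩) = (chain g).cycleOf 0 i (outerWhite g j) ∧
      (chain g).cycleOf 0 i (Sum.inr ⟨j, y⟩) = (chain g).cycleOf 0 i (outerWhite g j) := by
    intro j
    fin_cases i
    · exact absurd rfl hi
    · refine eq_none_of_lines_two_three (fw := fun y => (chain g).cycleOf 0 1 (Sum.inl ⟨j, y⟩))
        (fb := fun y => (chain g).cycleOf 0 1 (Sum.inr ⟨j, y⟩)) ?_
      rintro (_ | _) y
      · exact hline 3 (by decide) (by decide) ⟨j, y⟩
      · exact hline 2 (by decide) (by decide) ⟨j, y⟩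
    · exact eq_none_of_lines_one (fw := fun y => (chain g).cycleOf 0 2 (Sum.inl ⟨j, y⟩))
        (fb := fun y => (chain g).cycleOf 0 2 (Sum.inr ⟨j, y⟩)) false
        (fun y => hline 1 (by decide) (by decide) ⟨j, y⟩)
        (fun y => hline 3 (by decide) (by decide) ⟨j, y⟩)
    · exact eq_none_of_lines_one (fw := fun y => (chain g).cycleOf 0 3 (Sum.inl ⟨j, y⟩))
        (fb := fun y => (chain g).cycleOf 0 3 (Sum.inr ⟨j, y⟩)) true
        (fun y => hline 1 (by decide) (by decide) ⟨j, y⟩)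
        (fun y => hline 2 (by decide) (by decide) ⟨j, y⟩)
  rcases x with ⟨j, y⟩ | ⟨j, y⟩
  · exact (key j y).1
  · exact (key j y).2

theorem cycleOf_eq_outerWhite' (i : Fin 4) (x : ChainNode g ⊕ ChainNode g) :
    (chain g).cycleOf 0 i x = (chain g).cycleOf 0 i (outerWhite g (blockOf g x)) := by
  by_cases hi : i = 0
  · subst hi
    -- For i = 0 the removed pair degenerates to the single colour 0, so more lines remain than for
    -- i = 1.
    exact SimpleGraph.ConnectedComponent.sound ((SimpleGraph.ConnectedComponent.exact
      (cycleOf_eq_outerWhite g one_ne_zero x)).mono ((chain g).restrict_mono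
        (Set.compl_subset_compl.mpr (by simp))))
  · exact cycleOf_eq_outerWhite g hi x

theorem bubbleOf_eq_outerWhite (x : ChainNode g ⊕ ChainNode g) :
    (chain g).bubbleOf 0 x = (chain g).bubbleOf 0 (outerWhite g (blockOf g x)) :=
  (chain g).bubbleOf_eq_of_cycleOf_eq (cycleOf_eq_outerWhite g one_ne_zero x)

theorem bubbleOf_eq_iff_blockOf_eq (x y : ChainNode g ⊕ ChainNode g) :
    (chain g).bubbleOf 0 x = (chain g).bubbleOf 0 y ↔ blockOf g x = blockOf g y := by
  refine ⟨fun h => ?_, fun h => ?_⟩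
  · exact (chain g).rel_of_reachable_restrict (r := fun x y => blockOf g x = blockOf g y)
      ⟨fun _ => rfl, Eq.symm, Eq.trans⟩ (fun c hc w => (blockOf_line g hc w).symm)
      (SimpleGraph.ConnectedComponent.exact h)
  · rw [bubbleOf_eq_outerWhite, h, ← bubbleOf_eq_outerWhite]

/-- The bubbles of colour `1` of the chain. -/
def chainBubble : Fin n ≃ (chain g).Bubble 0 :=
  Equiv.ofBijective (fun i => (chain g).bubbleOf 0 (outerWhite g i))
    ⟨fun i j h => (bubbleOf_eq_iff_blockOf_eq g _ _).mp h, fun b => by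
      obtain ⟨x, rfl⟩ := b.exists_rep
      exact ⟨blockOf g x, (bubbleOf_eq_outerWhite g x).symm⟩⟩

theorem chainBubble_apply (i : Fin n) :
    chainBubble g i = (chain g).bubbleOf 0 (outerWhite g i) := rfl

theorem chainBubble_symm_bubbleOf (x : ChainNode g ⊕ ChainNode g) :
    (chainBubble g).symm ((chain g).bubbleOf 0 x) = blockOf g x := by
  rw [Equiv.symm_apply_eq, chainBubble_apply, ← bubbleOf_eq_outerWhite]

theorem card_bubbleWhite_chain (i : Fin n) :
    Nat.card ((chain g).BubbleWhite (chainBubble g i)) = 2 * g i + 1 := by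
  have e : (chain g).BubbleWhite (chainBubble g i) ≃ CanonicalNode (g i) :=
    (Equiv.subtypeEquivRight fun w => bubbleOf_eq_iff_blockOf_eq g (Sum.inl w)
      (outerWhite g i)).trans (Equiv.sigmaSubtype i)
  rw [Nat.card_congr e, Nat.card_eq_fintype_card, Fintype.card_option, Fintype.card_prod,
    Fintype.card_fin, Fintype.card_bool, mul_comm]

/-- Each pair of colours traces a single cycle through all the nodes of a canonical bubble. With 2g
+ 1 white nodes, the Euler characteristic is 3 - (2g + 1). -/
theorem numVertices_chain (i : Fin n) : (chain g).numVertices (chainBubble g i) = 3 := by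
  have h : ∀ m, Nat.card ((chain g).BubbleVertex (chainBubble g i) (ord 0 m)) = 1 := by
    intro m
    refine Nat.card_eq_one_iff_exists.mpr ⟨⟨(chain g).cycleOf 0 (ord 0 m) (outerWhite g i),
      (chain g).supp_cycleOf_subset_iff.mpr rfl⟩, ?_⟩
    rintro ⟨v, hv⟩
    obtain ⟨x, rfl⟩ := v.exists_rep
    refine Subtype.ext ((cycleOf_eq_outerWhite g (ord_ne 0 m) x).trans ?_)
    rw [(bubbleOf_eq_iff_blockOf_eq g x (outerWhite g i)).mp
      ((chain g).supp_cycleOf_subset_iff.mp hv), blockOf_outerWhite]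
  simp [ColoredGraph.numVertices, h]

theorem genus_chainBubble (i : Fin n) : (chain g).genus (chainBubble g i) = g i := by
  rw [ColoredGraph.genus, ColoredGraph.eulerChar_eq, numVertices_chain, card_bubbleWhite_chain]
  push_cast
  ring

/-! ### Connectedness and rooting of the chain. -/

theorem line_zero_outer (i : Fin n) :
    (chain g).line 0 ⟨i, none⟩ = ⟨(finRotate n).symm i, none⟩ := rfl

theorem finRotate_symm_val {n : ℕ} {i : Fin n} (hi : 0 < (i : ℕ)) :
    (((finRotate n).symm i : Fin n) : ℕ) + 1 = i := by
  obtain ⟨j, rfl⟩ := (finRotate n).surjective i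
  rw [Equiv.symm_apply_apply]
  rcases n with _ | n
  · exact j.elim0
  · rw [coe_finRotate] at hi ⊢
    split_ifs at hi ⊢ with h
    · exact absurd hi (lt_irrefl _)
    · rfl

theorem lineAt_zero_outerWhite (i : Fin n) :
    (chain g).lineAt (outerWhite g i) 0
      = (chain g).lineAt (outerBlack g ((finRotate n).symm i)) 0 := by
  rw [outerBlack, ← line_zero_outer, ColoredGraph.lineAt_inr_line]
  rfl

theorem chain_connected (hn : 0 < n) : (chain g).Connected := by
  have hreach : ∀ x, ((chain g).restrict Set.univ).Reachable x (outerWhite g (blockOf g x)) :=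
    fun x => (SimpleGraph.ConnectedComponent.exact (bubbleOf_eq_outerWhite g x)).mono
      ((chain g).restrict_mono (Set.subset_univ _))
  have houter : ∀ (m : ℕ) (hm : m < n),
      ((chain g).restrict Set.univ).Reachable (outerWhite g ⟨m, hm⟩) (outerWhite g ⟨0, hn⟩) := by
    intro m
    induction m with
    | zero => exact fun _ => SimpleGraph.Reachable.refl _
    | succ m ih =>
      intro hm
      have hrot : (finRotate n).symm ⟨m + 1, hm⟩ = ⟨m, by omega⟩ :=
        Fin.ext (by have := finRotate_symm_val (i := ⟨m + 1, hm⟩) (Nat.succ_pos m); simpa using this)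
      have hlink := (chain g).reachable_of_lineAt_eq (S := Set.univ) (Set.mem_univ 0)
        (lineAt_zero_outerWhite g ⟨m + 1, hm⟩)
      rw [hrot] at hlink
      exact hlink.trans ((hreach _).trans (ih _))
  refine SimpleGraph.connected_iff_exists_forall_reachable _ |>.mpr ⟨outerWhite g ⟨0, hn⟩, fun x => ?_⟩
  exact ((hreach x).trans (houter _ (blockOf g x).2)).symm

/-- The rooting of the chain in its external white nodes. -/
def chainRooting (hn : 0 < n) : (chain g).Rooting 0 where
  depth x := blockOf g x
  top := chainBubble g ⟨0, hn⟩
  base b := outerWhite g ((chainBubble g).symm b)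
  root i v := outerWhite g (blockOf g v.out)
  bubbleOf_base b := (chainBubble g).apply_symm_apply b
  depth_base_le x := by rw [chainBubble_symm_bubbleOf, blockOf_outerWhite]
  exists_parent b hb := by
    obtain ⟨i, rfl⟩ := (chainBubble g).surjective b
    have hi : 0 < (i : ℕ) := Nat.pos_of_ne_zero fun h => hb (congrArg _ (Fin.ext h))
    rw [Equiv.symm_apply_apply]
    refine ⟨outerBlack g ((finRotate n).symm i), Sum.inr_ne_inl, lineAt_zero_outerWhite g i, ?_⟩
    change (((finRotate n).symm i : Fin n) : ℕ) < (i : ℕ)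
    have := finRotate_symm_val hi
    omega
  cycleOf_root i v := by
    rw [← cycleOf_eq_outerWhite' g i]
    exact v.out_eq
  root_base i b := by
    have h := (chain g).bubbleOf_eq_of_cycleOf_eq (ℓ := 0) (i := i)
      ((chain g).cycleOf 0 i (outerWhite g ((chainBubble g).symm b))).out_eq
    rw [(bubbleOf_eq_iff_blockOf_eq g _ _).mp h, blockOf_outerWhite]

theorem rootOf_chainRooting (hn : 0 < n) (i : Fin 4) (x : ChainNode g ⊕ ChainNode g) :
    (chainRooting g hn).rootOf i x = outerWhite g (blockOf g x) := by
  have h := (chain g).bubbleOf_eq_of_cycleOf_eq (ℓ := 0) (i := i) ((chain g).cycleOf 0 i x).out_eq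
  exact congrArg (outerWhite g) ((bubbleOf_eq_iff_blockOf_eq g _ _).mp h)

theorem mem_kept_of_ne (hn : 0 < n) {κ i : Fin 4} (hi : i ≠ 0) {x : ChainNode g ⊕ ChainNode g}
    (hx : ∀ j, x ≠ outerWhite g j) : (x, i) ∈ (chainRooting g hn).kept κ := by
  simp only [ColoredGraph.Rooting.kept, Finset.mem_filter_univ]
  refine Or.inl ⟨hi, ?_⟩
  rw [rootOf_chainRooting]
  exact hx _

theorem mem_kept_outerWhite (hn : 0 < n) {κ i : Fin 4} (hi : i ≠ 0) (hiκ : i ≠ κ) {j : Fin n}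
    (hj : 0 < (j : ℕ)) : (outerWhite g j, i) ∈ (chainRooting g hn).kept κ := by
  simp only [ColoredGraph.Rooting.kept, Finset.mem_filter_univ]
  refine Or.inr ⟨hi, hiκ, fun h => ?_, ?_⟩
  · have := (chainBubble g).injective (show chainBubble g j = chainBubble g ⟨0, hn⟩ from h)
    rw [this] at hj
    exact lt_irrefl _ hj
  · exact congrArg (outerWhite g) ((chainBubble_symm_bubbleOf g (outerWhite g j)).symm)

end Chain

/-! ### Triviality of all the holonomies of a chain -/

section Flatness

variable {n : ℕ} (g : Fin n → ℕ)

/-- The chain holonomies which are kept determine all the others: in any group, if the former are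
trivial, so are the latter. -/
theorem chain_holonomy_eq_one (hn : 0 < n) {Γ : Type*} [Group Γ]
    {x : Fin 4 × ChainNode g → Fin 3 → Γ} (hx : ColoredGraph.IsClosedConfig x)
    (hS : ∀ k ∈ (chainRooting g hn).kept 3, (chain g).holonomy k x = 1)
    (k : (ChainNode g ⊕ ChainNode g) × Fin 4) : (chain g).holonomy k x = 1 := by
  obtain ⟨y, hy⟩ : ∃ y : Fin 4 → Fin 4 → ChainNode g ⊕ ChainNode g → Γ,
      ∀ c i m, x ((chain g).lineAt m c) (slot c i) = y c i m := ⟨_, fun _ _ _ => rfl⟩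
  have hline : ∀ c i w, y c i (Sum.inr ((chain g).line c w)) = y c i (Sum.inl w) := by
    intro c i w
    rw [← hy, ← hy, ColoredGraph.lineAt_inr_line, ColoredGraph.lineAt_inl]
  have hol : ∀ m i, (chain g).holonomy (m, i) x
      = y (ord i 0) i m * y (ord i 1) i m * y (ord i 2) i m := by
    intro m i
    rw [← hy, ← hy, ← hy]
    rfl
  have hol1 : ∀ m, (chain g).holonomy (m, 1) x = y 3 1 m * y 2 1 m * y 0 1 m := (hol · 1)
  have hol2 : ∀ m, (chain g).holonomy (m, 2) x = y 3 2 m * y 0 2 m * y 1 2 m := (hol · 2)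
  have hol3 : ∀ m, (chain g).holonomy (m, 3) x = y 0 3 m * y 2 3 m * y 1 3 m := (hol · 3)
  have cl0 : ∀ m, y 0 1 m * y 0 2 m * y 0 3 m = 1 := fun m => by
    rw [← hy, ← hy, ← hy]; exact hx _
  have cl1 : ∀ m, y 1 3 m * y 1 2 m * y 1 0 m = 1 := fun m => by
    rw [← hy, ← hy, ← hy]; exact hx _
  have cl2 : ∀ m, y 2 3 m * y 2 0 m * y 2 1 m = 1 := fun m => by
    rw [← hy, ← hy, ← hy]; exact hx _
  have cl3 : ∀ m, y 3 0 m * y 3 2 m * y 3 1 m = 1 := fun m => by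
    rw [← hy, ← hy, ← hy]; exact hx _
  have inner : ∀ i, i ≠ 0 → ∀ m, (∀ j, m ≠ outerWhite g j) → (chain g).holonomy (m, i) x = 1 :=
    fun i hi m hm => hS _ (mem_kept_of_ne g hn hi hm)
  have hwhite : ∀ i, i ≠ 0 → ∀ j p, (chain g).holonomy (Sum.inl ⟨j, some p⟩, i) x = 1 :=
    fun i hi j p => inner i hi _ fun j' h => by
      have := Sum.inl.inj h
      rw [Sigma.mk.injEq] at this
      obtain ⟨rfl, h2⟩ := this
      exact absurd (eq_of_heq h2) (by simp)
  have hblack : ∀ i, i ≠ 0 → ∀ z, (chain g).holonomy (Sum.inr z, i) x = 1 :=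
    fun i hi z => inner i hi _ fun _ => Sum.inr_ne_inl
  -- transport of the variables from one end of a canonical graph to the other
  have transport : ∀ (c i : Fin 4) (s : Bool),
      (∀ j z, y c i (Sum.inr ⟨j, canonicalFun s z⟩) = y c i (Sum.inl ⟨j, z⟩)) →
      (∀ j k, y c i (Sum.inl ⟨j, some (k, !s)⟩) = y c i (Sum.inr ⟨j, some (k, s)⟩)) →
      ∀ j, y c i (outerBlack g j) = y c i (outerWhite g j) := by
    intro c i s h1 h2 j
    exact (forall_of_firstNode (P := fun z => y c i (Sum.inr ⟨j, z⟩) = y c i (outerWhite g j))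
      (h1 j none) fun k hk => by rw [← canonicalFun_not, h1, h2, hk]).1
  have l0 : ∀ i j k s, y 0 i (Sum.inr ⟨j, some (k, !s)⟩) = y 0 i (Sum.inl ⟨j, some (k, s)⟩) :=
    fun i j k s => hline 0 i ⟨j, some (k, s)⟩
  have l1 : ∀ i z, y 1 i (Sum.inr z) = y 1 i (Sum.inl z) := fun i z => hline 1 i z
  have l2 : ∀ i j z, y 2 i (Sum.inr ⟨j, canonicalFun true z⟩) = y 2 i (Sum.inl ⟨j, z⟩) :=
    fun i j z => hline 2 i ⟨j, z⟩
  have l3 : ∀ i j z, y 3 i (Sum.inr ⟨j, canonicalFun false z⟩) = y 3 i (Sum.inl ⟨j, z⟩) :=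
    fun i j z => hline 3 i ⟨j, z⟩
  have m2 : ∀ i j k, y 2 i (Sum.inr ⟨j, some (k, false)⟩) = y 2 i (Sum.inl ⟨j, some (k, true)⟩) :=
    fun i j k => by rw [← l2, canonicalFun_same]; rfl
  have m3 : ∀ i j k, y 3 i (Sum.inr ⟨j, some (k, true)⟩) = y 3 i (Sum.inl ⟨j, some (k, false)⟩) :=
    fun i j k => by rw [← l3, canonicalFun_same]; rfl
  have m0 : ∀ i j k, y 0 i (Sum.inr ⟨j, some (k, false)⟩) = y 0 i (Sum.inl ⟨j, some (k, true)⟩) :=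
    fun i j k => l0 i j k true
  have m0' : ∀ i j k, y 0 i (Sum.inr ⟨j, some (k, true)⟩) = y 0 i (Sum.inl ⟨j, some (k, false)⟩) :=
    fun i j k => l0 i j k false
  -- The nodes v_k and p_k share two of the three lines entering the holonomy of index 1; comparing
  -- these trivial holonomies equates the third variables. The next transport does the same with u_k
  -- and q_k.
  have t31 : ∀ j, y 3 1 (outerBlack g j) = y 3 1 (outerWhite g j) :=
    transport 3 1 false (l3 1) fun j k => by
      have hv := hwhite 1 one_ne_zero j (k, true)
      have hp := hblack 1 one_ne_zero ⟨j, some (k, false)⟩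
      rw [hol1] at hv hp
      rw [m2, m0] at hp
      exact mul_right_cancel (mul_right_cancel (hv.trans hp.symm))
  have t21 : ∀ j, y 2 1 (outerBlack g j) = y 2 1 (outerWhite g j) :=
    transport 2 1 true (l2 1) fun j k => by
      have hu := hwhite 1 one_ne_zero j (k, false)
      have hq := hblack 1 one_ne_zero ⟨j, some (k, true)⟩
      rw [hol1] at hu hq
      rw [m3, m0'] at hq
      exact mul_left_cancel (mul_right_cancel (hu.trans hq.symm))
  -- Now v_k and p_k share only one relevant line. Comparing u_k with q_k first shows that the
  -- variables of the two handle lines of the second colour agree, which supplies the missing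
  -- equality.
  have t32 : ∀ j, y 3 2 (outerBlack g j) = y 3 2 (outerWhite g j) :=
    transport 3 2 false (l3 2) fun j k => by
      have hu := hwhite 2 (by decide) j (k, false)
      have hq := hblack 2 (by decide) ⟨j, some (k, true)⟩
      have hv := hwhite 2 (by decide) j (k, true)
      have hp := hblack 2 (by decide) ⟨j, some (k, false)⟩
      rw [hol2] at hu hq hv hp
      rw [m3, m0', l1] at hq
      rw [m0, l1, mul_left_cancel (hu.trans hq.symm)] at hp
      exact mul_right_cancel (mul_right_cancel (hv.trans hp.symm))
  have t23 : ∀ j, y 2 3 (outerBlack g j) = y 2 3 (outerWhite g j) :=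
    transport 2 3 true (l2 3) fun j k => by
      have hu := hwhite 3 (by decide) j (k, false)
      have hq := hblack 3 (by decide) ⟨j, some (k, true)⟩
      have hv := hwhite 3 (by decide) j (k, true)
      have hp := hblack 3 (by decide) ⟨j, some (k, false)⟩
      rw [hol3] at hu hq hv hp
      rw [m0, m2, l1] at hp
      rw [m0', l1, mul_left_cancel (hv.trans hp.symm)] at hq
      exact mul_left_cancel (mul_right_cancel (hu.trans hq.symm))
  have t1 : ∀ i j, y 1 i (outerBlack g j) = y 1 i (outerWhite g j) := fun i j => l1 i ⟨j, none⟩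
  have link : ∀ i j, y 0 i (outerWhite g j) = y 0 i (outerBlack g ((finRotate n).symm j)) :=
    fun i j => by rw [← hy, ← hy, lineAt_zero_outerWhite]
  -- the variables of the lines which link the canonical graphs are all equal
  have step1 : ∀ j : Fin n, 0 < (j : ℕ) → y 0 1 (outerWhite g j) = y 0 1 (outerBlack g j) := by
    intro j hj
    have h1 := hS _ (mem_kept_outerWhite g hn (i := 1) (κ := 3) (by decide) (by decide) hj)
    have h2 := hblack 1 one_ne_zero ⟨j, none⟩
    rw [hol1] at h1 h2
    have t31 := t31 j
    have t21 := t21 j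
    unfold outerBlack at *
    rw [t31, t21] at h2
    exact mul_left_cancel (h1.trans h2.symm)
  have step2 : ∀ j : Fin n, 0 < (j : ℕ) → y 0 2 (outerWhite g j) = y 0 2 (outerBlack g j) := by
    intro j hj
    have h1 := hS _ (mem_kept_outerWhite g hn (i := 2) (κ := 3) (by decide) (by decide) hj)
    have h2 := hblack 2 (by decide) ⟨j, none⟩
    rw [hol2] at h1 h2
    have t32 := t32 j
    have t1 := t1 2 j
    unfold outerBlack at *
    rw [t32, t1] at h2
    exact mul_left_cancel (mul_right_cancel (h1.trans h2.symm))
  -- Passing through all the blocks but the first equates every link variable; as the chain is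
  -- closed, this includes the two links at the first block, where no outer kernel was kept.
  have around : ∀ i : Fin 4,
      (∀ j : Fin n, 0 < (j : ℕ) → y 0 i (outerWhite g j) = y 0 i (outerBlack g j)) →
      ∀ j : Fin n, y 0 i (outerWhite g j) = y 0 i (outerBlack g j) := by
    intro i hi
    have hall : ∀ (m : ℕ) (hm : m < n),
        y 0 i (outerBlack g ⟨m, hm⟩) = y 0 i (outerBlack g ⟨0, hn⟩) := by
      intro m
      induction m with
      | zero => exact fun _ => rfl
      | succ m ih =>
        intro hm
        have hrot : (finRotate n).symm ⟨m + 1, hm⟩ = ⟨m, by omega⟩ := Fin.ext (by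
          have := finRotate_symm_val (i := ⟨m + 1, hm⟩) (Nat.succ_pos m); simpa using this)
        rw [← hi ⟨m + 1, hm⟩ (Nat.succ_pos m), link, hrot, ih]
    intro j
    rw [link]
    exact (hall _ _).trans (hall _ _).symm
  have t01 := around 1 step1
  have t02 := around 2 step2
  -- The index 3 was sacrificed at the base nodes; the closure constraint of the links recovers it.
  have t03 : ∀ j, y 0 3 (outerWhite g j) = y 0 3 (outerBlack g j) := by
    intro j
    have h1 := cl0 (outerWhite g j)
    have h2 := cl0 (outerBlack g j)
    rw [t01, t02] at h1
    exact mul_left_cancel (h1.trans h2.symm)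
  have hol_ne : ∀ i, i ≠ 0 → ∀ m, (chain g).holonomy (m, i) x = 1 := by
    rintro i hi (⟨j, _ | p⟩ | z)
    · change (chain g).holonomy (outerWhite g j, i) x = 1
      refine Eq.trans ?_ (hblack i hi ⟨j, none⟩)
      change _ = (chain g).holonomy (outerBlack g j, i) x
      fin_cases i
      · exact absurd rfl hi
      · exact (hol1 _).trans (by rw [t01, ← t31, ← t21]; exact (hol1 _).symm)
      · exact (hol2 _).trans (by rw [t02, ← t32, ← t1]; exact (hol2 _).symm)
      · exact (hol3 _).trans (by rw [t03, ← t23, ← t1]; exact (hol3 _).symm)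
    · exact hwhite i hi j p
    · exact hblack i hi z
  obtain ⟨m, i⟩ := k
  by_cases hi : i = 0
  · subst hi
    -- A discrete Bianchi identity at one tetrahedron: the four closure relations and three trivial
    -- holonomies imply that the fourth is trivial.
    have h1 := (hol1 m).symm.trans (hol_ne 1 (by decide) m)
    have h2 := (hol2 m).symm.trans (hol_ne 2 (by decide) m)
    have h3 := (hol3 m).symm.trans (hol_ne 3 (by decide) m)
    rw [hol]
    change y 1 0 m * y 2 0 m * y 3 0 m = 1
    have mid : ∀ {a b c : Γ}, a * b * c = 1 → b = a⁻¹ * c⁻¹ := fun {a b c} h => by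
      rw [← eq_inv_of_mul_eq_one_left h, inv_mul_cancel_left]
    rw [eq_inv_of_mul_eq_one_right (cl1 m), mid (cl2 m),
      eq_inv_of_mul_eq_one_left ((mul_assoc _ _ _).symm.trans (cl3 m)), mid h1, mid h3,
      eq_inv_of_mul_eq_one_left ((mul_assoc _ _ _).symm.trans h2), eq_inv_of_mul_eq_one_right (cl0 m)]
    group
  · exact hol_ne i hi m

end Flatness

/-! ### From groups to approximate identities -/

/-- The families of elements of `SU(2)` whose distance to the identity is controlled by `ε`. -/
def nearOne {ι : Type*} (ε : ι → ℝ) : Subgroup (ι → SU2) where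
  carrier := {f | ∃ C, ∀ p, gap (f p) ≤ C * ε p}
  mul_mem' := by
    rintro f f' ⟨C, hC⟩ ⟨C', hC'⟩
    refine ⟨2 * C + 2 * C', fun p => (gap_mul_le _ _).trans ?_⟩
    linarith [hC p, hC' p]
  one_mem' := ⟨0, fun p => by simp [gap_one]⟩
  inv_mem' := by
    rintro f ⟨C, hC⟩
    exact ⟨C, fun p => by rw [Pi.inv_apply, gap_inv]; exact hC p⟩

instance {ι : Type*} (ε : ι → ℝ) : (nearOne ε).Normal :=
  ⟨fun f ⟨C, hC⟩ h => ⟨C, fun p => by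
    rw [Pi.mul_apply, Pi.mul_apply, Pi.inv_apply, gap_conj]; exact hC p⟩⟩

namespace ColoredGraph

variable {W B : Type} [Fintype W] [Fintype B] {G : ColoredGraph W B}

/-- If trivial holonomies in `S` force all holonomies to be trivial, in every group, then small
holonomies in `S` force all holonomies to be small. -/
theorem exists_gap_holonomy_le {S : Finset ((W ⊕ B) × Fin 4)}
    (hS : ∀ (Γ : Type) [Group Γ] (x : Fin 4 × W → Fin 3 → Γ), IsClosedConfig x →
      (∀ k ∈ S, G.holonomy k x = 1) → ∀ k, G.holonomy k x = 1) :
    ∃ C : ℝ, ∀ ε : ℝ, 0 ≤ ε → ∀ x : Fin 4 × W → Fin 3 → SU2, IsClosedConfig x →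
      (∀ k ∈ S, gap (G.holonomy k x) ≤ ε) → ∀ k, gap (G.holonomy k x) ≤ C * ε := by
  -- All admissible pairs (ε, configuration) are gathered into one configuration with values in the
  -- quotient group, where the kept holonomies become exactly trivial. Membership in `nearOne` then
  -- gives a constant uniform over all pairs.
  let ι := {p : ℝ × (Fin 4 × W → Fin 3 → SU2) //
    IsClosedConfig p.2 ∧ ∀ k ∈ S, gap (G.holonomy k p.2) ≤ p.1}
  let ε : ι → ℝ := fun p => p.1.1
  let x : Fin 4 × W → Fin 3 → (ι → SU2) ⧸ nearOne ε := fun e s =>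
    QuotientGroup.mk fun p : ι => p.1.2 e s
  have hhol : ∀ k, G.holonomy k x = QuotientGroup.mk fun p : ι => G.holonomy k p.1.2 :=
    fun k => rfl
  have hall := hS _ x (fun e => by
      refine (QuotientGroup.eq_one_iff (N := nearOne ε) _).mpr ⟨0, fun p => ?_⟩
      have : gap (p.1.2 e 0 * p.1.2 e 1 * p.1.2 e 2) ≤ 0 * ε p := by
        rw [p.2.1 e, gap_one, zero_mul]
      exact this)
    (fun k hk => by
      rw [hhol]
      exact (QuotientGroup.eq_one_iff (N := nearOne ε) _).mpr
        ⟨1, fun p => by rw [one_mul]; exact p.2.2 k hk⟩)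
  have hC : ∀ k, ∃ C : ℝ, ∀ p : ι, gap (G.holonomy k p.1.2) ≤ C * ε p := fun k => by
    have h := hall k
    rw [hhol] at h
    exact (QuotientGroup.eq_one_iff (N := nearOne ε) _).mp h
  choose C hC using hC
  refine ⟨∑ k, |C k|, fun ε hε x hx hk k => ?_⟩
  refine (hC k ⟨(ε, x), hx, hk⟩).trans (mul_le_mul_of_nonneg_right ((le_abs_self _).trans ?_) hε)
  exact Finset.single_le_sum (f := fun k => |C k|) (fun k _ => abs_nonneg _) (Finset.mem_univ k)

end ColoredGraph

/-- The general upper bound for colour 1 meets the lower bound from the explicit rooting at the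
external white nodes; any rooting gives the same exponent. -/
theorem divergenceDegree_chain {n : ℕ} (hn : 0 < n) (g : Fin n → ℕ) :
    (chain g).divergenceDegree = ((2 - 2 * ∑ i, (g i : ℝ) : ℝ) : EReal) := by
  have hsum : ∑ᶠ b : (chain g).Bubble 0, (chain g).genus b = ∑ i, (g i : ℝ) := by
    rw [← finsum_comp_equiv (chainBubble g), finsum_eq_sum_of_fintype]
    exact Finset.sum_congr rfl fun i _ => genus_chainBubble g i
  rw [← hsum]
  refine le_antisymm ((chain_connected g hn).divergenceDegree_le 0) ?_
  obtain ⟨C, hC⟩ := ColoredGraph.exists_gap_holonomy_le (G := chain g)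
    (S := (chainRooting g hn).kept 3) fun Γ _ x hx hS k => chain_holonomy_eq_one g hn hx hS k
  rw [← (chainRooting g hn).exponent_eq (show (3 : Fin 4) ≠ 0 by decide)]
  exact ((chainRooting g hn).elimination (show (3 : Fin 4) ≠ 0 by decide)).le_divergenceDegree hC

end Boulatov

end

theorem mainTheorem7 :
    (∀ (W B : Type*) [Fintype W] [Fintype B] (G : Boulatov.ColoredGraph W B),
      G.Connected → ∀ ℓ : Fin 4,
        G.divergenceDegree ≤ ((2 - 2 * ∑ᶠ b : G.Bubble ℓ, G.genus b : ℝ) : EReal) ∧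
        G.divergenceDegree ≤ ((2 * (1 - (G.numSingular ℓ : ℝ)) : ℝ) : EReal)) ∧
    (∀ (n : ℕ) (_ : 0 < n) (g : Fin n → ℕ),
      (Boulatov.chain g).Connected ∧
      (∃ e : Fin n ≃ (Boulatov.chain g).Bubble 0,
        ∀ i, (Boulatov.chain g).genus (e i) = (g i : ℝ)) ∧
      (Boulatov.chain g).divergenceDegree = ((2 - 2 * ∑ i, (g i : ℝ) : ℝ) : EReal)) :=
  ⟨fun _ _ _ _ _ hG ℓ => ⟨hG.divergenceDegree_le ℓ, hG.divergenceDegree_le_numSingular ℓ⟩,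
    fun _ hn g => ⟨Boulatov.chain_connected g hn,
      ⟨Boulatov.chainBubble g, Boulatov.genus_chainBubble g⟩,
      Boulatov.divergenceDegree_chain hn g⟩⟩
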